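/- Let $n \ge 1$ and let $t_1,\dots,t_n \ge 1$ be integers. Consider the following game for two players who move alternately (planar generalized Brussels sprouts, $BS_n(\mathcal O_0 : t_1,\dots,t_n)$). It starts with $n$ spots (vertices) drawn in the plane, the $i$-th of which has $t_i$ open tips (short straight arms sticking out of the spot, each with one free end), and nothing crosses or overlaps. A move consists of joining the free ends of two different open tips by a polygonal curve that meets neither itself nor anything else already drawn, and then drawing across this curve, at a point of it that becomes a new vertex, a straight crossbar whose two halves, one on each side of the curve, are new open tips; the two joined tips are no longer open, and the resulting picture must again be without crossings. A player who has no valid move on his turn loses. Then, from every starting position and however the game is played, the game ends after exactly $$(n-2)+\sum_{i=1}^n t_i$$ moves: no play is longer, and a position reached after $k$ moves admits no further move if and only if $k=(n-2)+\sum_{i=1}^n t_i$. Hence every completed play is won by the first player if and only if $n+\sum_{i=1}^n t_i$ is odd, and the first player has a winning strategy if and only if $n+\sum_{i=1}^n t_i$ is odd. -/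

import Mathlib

namespace BrusselsSprout

/-- The plane; only its affine structure and its topology matter. -/
abbrev Plane : Type := ℝ × ℝ

/-- The set of points of the polygonal curve with the given successive corner points. -/
def carrier : List Plane → Set Plane
  | [] => ∅
  | [p] => {p}
  | p :: q :: l => segment ℝ p q ∪ carrier (q :: l)

/-- The polygonal curve through the given corner points is non-degenerate and does not meet
itself: each of its segments meets the rest of the curve after it only in their common corner. -/
def IsSimple : List Plane → Prop
  | [] => True
  | [_] => True
  | p :: q :: l => p ≠ q ∧ segment ℝ p q ∩ carrier (q :: l) = {q} ∧ IsSimple (q :: l)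

/-- A polygonal arc: a simple polygonal curve with at least one segment. -/
def IsArc (l : List Plane) : Prop :=
  2 ≤ l.length ∧ IsSimple l

/-- An open tip: a short arm, drawn as a straight segment from a vertex (its `root`)
to a `free` end. -/
@[ext]
structure Tip where
  root : Plane
  free : Plane

/-- The segment by which an open tip is drawn. -/
def Tip.stub (s : Tip) : List Plane := [s.root, s.free]

/-- A picture on the paper: the vertices (the spots, and the points where a crossbar meets a
curve), the edges (polygonal curves joining two vertices), and the arms that are still open. -/
@[ext]
structure Drawing where
  vertices : List Plane
  edges : List (List Plane)
  tips : List Tip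

/-- All the curves of a drawing: its edges and its open arms. -/
def Drawing.curves (D : Drawing) : List (List Plane) :=
  D.edges ++ D.tips.map Tip.stub

/-- The drawing is without crossings. Together with the fact that a curve contains no vertices
except its own end vertices, the last clause says that two different curves of the drawing meet
at most in common end vertices. -/
structure Drawing.IsPlane (D : Drawing) : Prop where
  /-- Different vertices are different points. -/
  nodup : D.vertices.Nodup
  /-- No curve meets itself. -/
  isArc : ∀ A ∈ D.curves, IsArc A
  /-- Every edge joins two vertices and contains no other vertex. -/
  edge_ends : ∀ A ∈ D.edges, ∃ u ∈ D.vertices, ∃ w ∈ D.vertices,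
    A.head? = some u ∧ A.getLast? = some w ∧
      ∀ v ∈ D.vertices, v ∈ carrier A → v = u ∨ v = w
  /-- Every open arm starts at a vertex and contains no other vertex. -/
  tip_ends : ∀ s ∈ D.tips, s.root ∈ D.vertices ∧
    ∀ v ∈ D.vertices, v ∈ carrier s.stub → v = s.root
  /-- Two different curves meet only in vertices. -/
  noncrossing : D.curves.Pairwise fun A B => ∀ x ∈ carrier A ∩ carrier B, x ∈ D.vertices

/-- The starting positions of the game: `n` spots in the plane and nothing else, where the
`i`-th spot has `t i` open tips. -/
def Drawing.IsInitial {n : ℕ} (t : Fin n → ℕ) (D : Drawing) : Prop :=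
  ∃ (v : Fin n → Plane) (a : (i : Fin n) → Fin (t i) → Plane),
    D.vertices = List.ofFn v ∧
    D.edges = [] ∧
    D.tips = (List.ofFn fun i => List.ofFn fun j => Tip.mk (v i) (a i j)).flatten ∧
    D.IsPlane

/-- A valid move from `D` to `D'`. Two open tips `s` and `t` of `D` are joined by a polygonal curve
`l₁, p, q, l₂` from the free end of `s` to the free end of `t`. Then a crossbar, the segment from
`c` to `d`, is drawn across this curve at a point `m` inside the segment from `p` to `q`. The point
`m` becomes a vertex that cuts the joined curve (with the arms `s` and `t`) into two edges; the two
halves of the crossbar, one on each side of the curve, are new open tips. The old picture stays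
as it is, and the new picture must again be without crossings (so the graph that it draws
is planar). -/
def IsMove (D D' : Drawing) : Prop :=
  ∃ (s t : Tip) (rest : List Tip) (l₁ l₂ : List Plane) (p q m c d : Plane),
    D.tips.Perm (s :: t :: rest) ∧
    (l₁ ++ p :: q :: l₂).head? = some s.free ∧
    (l₁ ++ p :: q :: l₂).getLast? = some t.free ∧
    m ∈ openSegment ℝ p q ∧
    m ∈ openSegment ℝ c d ∧
    D'.vertices = m :: D.vertices ∧
    D'.edges = (s.root :: (l₁ ++ [p, m])) :: (m :: q :: (l₂ ++ [t.root])) :: D.edges ∧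
    D'.tips = Tip.mk m c :: Tip.mk m d :: rest ∧
    D'.IsPlane

/-- No valid move is left. -/
def IsOver (D : Drawing) : Prop := ∀ D' : Drawing, ¬ IsMove D D'

/-- `IsPlay D k D'`: there is a play that leads from `D` to `D'` in exactly `k` valid moves. -/
inductive IsPlay (D : Drawing) : ℕ → Drawing → Prop
  | start : IsPlay D 0 D
  | step {k : ℕ} {D' D'' : Drawing} : IsPlay D k D' → IsMove D' D'' → IsPlay D (k + 1) D''

/-- The game from `D` always ends after exactly `N` moves, however it is played: no play has more
than `N` moves, and a play is stuck precisely when `N` moves have been made. -/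
def EndsAfterExactly (D : Drawing) (N : ℕ) : Prop :=
  ∀ (k : ℕ) (D' : Drawing), IsPlay D k D' → k ≤ N ∧ (IsOver D' ↔ k = N)

/-- The two players. -/
inductive Player
  | first
  | second

/-- The opponent of a player. -/
def Player.other : Player → Player
  | .first => .second
  | .second => .first

/-- The player whose turn it is after `k` moves: the players alternate, and the first player
makes the first move. -/
def turn : ℕ → Player
  | 0 => .first
  | k + 1 => (turn k).other

/-- The winner of a play that is over after `k` moves: the player whose turn it is has no valid
move and loses, so the other player wins. -/
def winnerAfter (k : ℕ) : Player := (turn k).other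

/-- The player who is to move in `D` can force a win: some valid move leads to a position
from which, whatever valid move the opponent replies with (if there is any), the player
can again force a win. -/
inductive CanForceWin : Drawing → Prop
  | intro (D D' : Drawing) : IsMove D D' →
      (∀ D'' : Drawing, IsMove D' D'' → CanForceWin D'') → CanForceWin D

end BrusselsSprout

namespace BrusselsSprout

/-! A move uses up two tips and creates two, so the number T of open tips never changes; it adds one
vertex and two edges. After k moves there are n + k vertices and 2k edges, and the length of a play
follows from two inequalities.

No play is too long. Let C be the number of components of the graph formed by vertices and edges,
and F the number of its faces that contain an open tip. If the two joined tips have roots in one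
component, the new curve closes up through the graph to a closed polygonal curve that crosses itself
nowhere near the crossbar; a winding argument puts the two new tips into different faces, so F
grows. Otherwise two components merge and C drops. In neither case does the other number change for
the worse (`MoveData.numFaces_le`, `MoveData.numComponents_le`), so F - C - k never decreases. It is
at least 1 - n at the start, and F ≤ T, C ≥ 1, hence k ≤ n + T - 2.

No play stops too early. Two tips in one face can always be joined
(`Drawing.IsPlane.exists_isMove`), so in a stuck position different tips lie in different faces.
Then the graph is connected: otherwise take a shortest segment between one component and the rest;
from its midpoint one reaches a tip of each of two components without leaving the face, which gives
two tips in one face. A connected plane graph has at most E - V + 2 = k - n + 2 faces, so T ≤ k - n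
+ 2.

The connectedness step needs `Drawing.TipsReachable`: every approach to a component leads to one of
its tips. To survive a move this has to hold inside every open neighbourhood of the component, and
then it is preserved because the crossbar offers a tip on each side of the new curve.

The topology is elementary: faces are classes under polygonal paths; a segment with a free end cuts
no face; any other segment cuts one face into at most two (`mem_of_polyJoined_segment` carries
both); and a closed polygon separates the two sides of each of its segments
(`not_polyJoined_of_polyJoined`). -/

open Set Topology

/-! ### Polygonal paths -/

/-- `a` and `b` are joined by a polygonal path inside `S`. -/
def PolyJoined (S : Set Plane) : Plane → Plane → Prop :=
  Relation.ReflTransGen fun a b => segment ℝ a b ⊆ S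

namespace PolyJoined

variable {S S' : Set Plane} {a b c : Plane}

theorem refl (a : Plane) : PolyJoined S a a := Relation.ReflTransGen.refl

theorem trans (h : PolyJoined S a b) (h' : PolyJoined S b c) : PolyJoined S a c :=
  Relation.ReflTransGen.trans h h'

theorem symm (h : PolyJoined S a b) : PolyJoined S b a := by
  induction h with
  | refl => exact refl _
  | tail _ h ih => exact Relation.ReflTransGen.head (by rwa [segment_symm]) ih

theorem mono (hS : S ⊆ S') (h : PolyJoined S a b) : PolyJoined S' a b := by
  induction h with
  | refl => exact refl _
  | tail _ h ih => exact Relation.ReflTransGen.tail ih (h.trans hS)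

theorem of_segment (h : segment ℝ a b ⊆ S) : PolyJoined S a b := Relation.ReflTransGen.single h

theorem of_convex {C : Set Plane} (hC : Convex ℝ C) (hCS : C ⊆ S) (ha : a ∈ C) (hb : b ∈ C) :
    PolyJoined S a b := of_segment ((hC.segment_subset ha hb).trans hCS)

theorem mem (h : PolyJoined S a b) (ha : a ∈ S) : b ∈ S := by
  induction h with
  | refl => exact ha
  | tail _ h _ => exact h (right_mem_segment ℝ _ _)

/-- A set that separates `S` cannot be left along a polygonal path. -/
theorem mem_of_separation {U V : Set Plane} (hU : IsOpen U) (hV : IsOpen V) (hS : S ⊆ U ∪ V)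
    (hUV : Disjoint U V) (h : PolyJoined S a b) (ha : a ∈ U) : b ∈ U := by
  induction h with
  | refl => exact ha
  | tail _ h ih =>
    exact (convex_segment _ _).isPreconnected.subset_left_of_subset_union hU hV hUV
      (h.trans hS) ⟨_, left_mem_segment ℝ _ _, ih⟩ (right_mem_segment ℝ _ _)

/-- A polygonal path either avoids a set `T` or its start is joined to a point of `T`. -/
theorem avoid_or (T : Set Plane) (h : PolyJoined S a b) :
    PolyJoined (S \ T) a b ∨ ∃ g ∈ T, g ∈ S ∧ PolyJoined S a g := by
  induction h with
  | refl => exact Or.inl (refl _)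
  | @tail x y hax hxy ih =>
    rcases ih with ih | ih
    · by_cases hT : Disjoint (segment ℝ x y) T
      · exact Or.inl (ih.trans (of_segment fun z hz => ⟨hxy hz, disjoint_left.1 hT hz⟩))
      · obtain ⟨g, hg, hgT⟩ := not_disjoint_iff.1 hT
        refine Or.inr ⟨g, hgT, hxy hg, PolyJoined.trans hax (of_segment ?_)⟩
        exact ((convex_segment x y).segment_subset (left_mem_segment ℝ _ _) hg).trans hxy
    · exact Or.inr ih

end PolyJoined

/-- A set which is a union of polygonal components of an open set is open. -/
theorem isOpen_of_saturated {S W : Set Plane} (hS : IsOpen S) (hWS : W ⊆ S)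
    (hW : ∀ z w, z ∈ W → PolyJoined S z w → w ∈ W) : IsOpen W := by
  rw [Metric.isOpen_iff]
  intro z hz
  obtain ⟨r, hr, hb⟩ := Metric.isOpen_iff.1 hS z (hWS hz)
  exact ⟨r, hr, fun w hw => hW z w hz
    (.of_convex (convex_ball z r) hb (Metric.mem_ball_self hr) hw)⟩

/-- Both the points joined to `a` and the points not joined to `a` form open sets, since small balls
are convex. -/
theorem IsPreconnected.polyJoined {S : Set Plane} (hS : IsOpen S) (hc : IsPreconnected S)
    {a b : Plane} (ha : a ∈ S) (hb : b ∈ S) : PolyJoined S a b := by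
  have h1 : IsOpen {z | z ∈ S ∧ PolyJoined S a z} :=
    isOpen_of_saturated hS (fun z hz => hz.1) fun z w hz h => ⟨h.mem hz.1, hz.2.trans h⟩
  have h2 : IsOpen {z | z ∈ S ∧ ¬ PolyJoined S a z} :=
    isOpen_of_saturated hS (fun z hz => hz.1) fun z w hz h =>
      ⟨h.mem hz.1, fun h' => hz.2 (h'.trans h.symm)⟩
  have := hc.subset_left_of_subset_union h1 h2 (disjoint_left.2 fun z hz hz' => hz'.2 hz.2)
    (fun z hz => by by_cases h : PolyJoined S a z <;> simp [hz, h]) ⟨a, ha, ha, .refl a⟩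
  exact (this hb).2

/-! ### Coordinates relative to a segment and its local picture -/

/-- Twice the signed area of the triangle `p`, `q`, `z`. -/
def side (p q z : Plane) : ℝ := (q.1 - p.1) * (z.2 - p.2) - (q.2 - p.2) * (z.1 - p.1)

/-- The inner product of `q - p` and `z - p`. -/
def along (p q z : Plane) : ℝ := (q.1 - p.1) * (z.1 - p.1) + (q.2 - p.2) * (z.2 - p.2)

theorem continuous_along (p q : Plane) : Continuous (along p q) := by unfold along; fun_prop

theorem along_self_pos {p q : Plane} (h : p ≠ q) : 0 < along p q q := by
  unfold along
  rcases eq_or_ne p.1 q.1 with h1 | h1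
  · have h2 : p.2 ≠ q.2 := fun h2 => h (Prod.ext h1 h2)
    have := mul_self_pos.2 (sub_ne_zero.2 h2.symm)
    nlinarith [mul_self_nonneg (q.1 - p.1)]
  · have := mul_self_pos.2 (sub_ne_zero.2 h1.symm)
    nlinarith [mul_self_nonneg (q.2 - p.2)]

theorem mem_segment_iff_exists {p q z : Plane} :
    z ∈ segment ℝ p q ↔ ∃ t : ℝ, 0 ≤ t ∧ t ≤ 1 ∧ z = p + t • (q - p) := by
  rw [segment_eq_image']
  constructor
  · rintro ⟨t, ⟨h0, h1⟩, rfl⟩; exact ⟨t, h0, h1, rfl⟩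
  · rintro ⟨t, h0, h1, rfl⟩; exact ⟨t, ⟨h0, h1⟩, rfl⟩

theorem mem_openSegment_iff_exists {p q z : Plane} :
    z ∈ openSegment ℝ p q ↔ ∃ t : ℝ, 0 < t ∧ t < 1 ∧ z = p + t • (q - p) := by
  rw [openSegment_eq_image']
  constructor
  · rintro ⟨t, ⟨h0, h1⟩, rfl⟩; exact ⟨t, h0, h1, rfl⟩
  · rintro ⟨t, h0, h1, rfl⟩; exact ⟨t, ⟨h0, h1⟩, rfl⟩

theorem side_add_smul (p q z w : Plane) (t : ℝ) :
    side p q (z + t • w) = side p q z + t * ((q.1 - p.1) * w.2 - (q.2 - p.2) * w.1) := by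
  simp only [side, Prod.fst_add, Prod.snd_add, Prod.smul_fst, Prod.smul_snd, smul_eq_mul]; ring

theorem along_add_smul (p q z w : Plane) (t : ℝ) :
    along p q (z + t • w) = along p q z + t * ((q.1 - p.1) * w.1 + (q.2 - p.2) * w.2) := by
  simp only [along, Prod.fst_add, Prod.snd_add, Prod.smul_fst, Prod.smul_snd, smul_eq_mul]; ring

theorem side_left (p q : Plane) : side p q p = 0 := by simp [side]

theorem along_left (p q : Plane) : along p q p = 0 := by simp [along]

theorem side_eq_zero_of_mem {p q z : Plane} (h : z ∈ segment ℝ p q) : side p q z = 0 := by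
  obtain ⟨t, -, -, rfl⟩ := mem_segment_iff_exists.1 h
  rw [side_add_smul, side_left]; simp; right; ring

theorem along_of_mem {p q z : Plane} (h : z ∈ segment ℝ p q) : 0 ≤ along p q z := by
  obtain ⟨t, h0, -, rfl⟩ := mem_segment_iff_exists.1 h
  rw [along_add_smul, along_left]; simp
  exact mul_nonneg h0 (by nlinarith [mul_self_nonneg (q.1 - p.1), mul_self_nonneg (q.2 - p.2)])

/-- Divided by `along p q q`, the values of `along` and `side` are the coordinates of `z - p` in the
orthogonal basis formed by `q - p` and its rotation by a right angle. -/
theorem eq_of_side_eq_zero {p q z : Plane} (h : p ≠ q) (hz : side p q z = 0) :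
    z = p + (along p q z / along p q q) • (q - p) := by
  have hN := along_self_pos h
  have h1 : along p q q * (z.1 - p.1) = along p q z * (q.1 - p.1) := by
    have : along p q q * (z.1 - p.1) = along p q z * (q.1 - p.1) - side p q z * (q.2 - p.2) := by
      unfold along side; ring
    rw [this, hz]; ring
  have h2 : along p q q * (z.2 - p.2) = along p q z * (q.2 - p.2) := by
    have : along p q q * (z.2 - p.2) = along p q z * (q.2 - p.2) + side p q z * (q.1 - p.1) := by
      unfold along side; ring
    rw [this, hz]; ring
  ext
  · simp only [Prod.fst_add, Prod.smul_fst, Prod.fst_sub, smul_eq_mul]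
    field_simp; linarith
  · simp only [Prod.snd_add, Prod.smul_snd, Prod.snd_sub, smul_eq_mul]
    field_simp; linarith

theorem mem_segment_of_side {p q z : Plane} (h : p ≠ q) (hz : side p q z = 0)
    (h0 : 0 ≤ along p q z) (h1 : along p q z ≤ along p q q) : z ∈ segment ℝ p q := by
  have hN := along_self_pos h
  exact mem_segment_iff_exists.2 ⟨_, div_nonneg h0 hN.le, (div_le_one hN).2 h1,
    eq_of_side_eq_zero h hz⟩

theorem side_add_smul_mem_iff (p q : Plane) {y : Plane} (hy : y ∈ segment ℝ p q) (w : Plane)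
    (t : ℝ) : side p q (y + t • w) = t * side p q (p + w) := by
  rw [side_add_smul, side_eq_zero_of_mem hy]; simp [side]

theorem convex_side_pos (p q : Plane) : Convex ℝ {z | 0 < side p q z} := by
  intro x hx y hy a b ha hb hab
  have : side p q (a • x + b • y) = a * side p q x + b * side p q y := by
    obtain rfl : b = 1 - a := by linarith
    simp only [side, Prod.fst_add, Prod.snd_add, Prod.smul_fst, Prod.smul_snd, smul_eq_mul]; ring
  simp only [mem_ofPred_eq] at *
  rw [this]
  rcases ha.eq_or_lt with rfl | ha
  · obtain rfl : b = 1 := by linarith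
    simpa using hy
  · nlinarith [mul_pos ha hx, mul_nonneg hb hy.le]

theorem side_swap (p q z : Plane) : side q p z = - side p q z := by unfold side; ring

theorem convex_along_neg (p q : Plane) : Convex ℝ {z | along p q z < 0} := by
  intro x hx y hy a b ha hb hab
  have : along p q (a • x + b • y) = a * along p q x + b * along p q y := by
    obtain rfl : b = 1 - a := by linarith
    simp only [along, Prod.fst_add, Prod.snd_add, Prod.smul_fst, Prod.smul_snd, smul_eq_mul]; ring
  simp only [mem_ofPred_eq] at *
  rw [this]
  rcases ha.eq_or_lt with rfl | ha
  · obtain rfl : b = 1 := by linarith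
    simpa using hy
  · nlinarith [mul_pos ha (neg_pos.2 hx), mul_nonneg hb (neg_pos.2 hy).le]

/-- Points close to `y` in direction `w`. -/
theorem eventually_add_smul {U : Set Plane} {y : Plane} (hU : U ∈ 𝓝 y) (w : Plane) :
    ∃ e > 0, ∀ t : ℝ, |t| < e → y + t • w ∈ U := by
  have hc : ContinuousAt (fun t : ℝ => y + t • w) 0 := by fun_prop
  have : (fun t : ℝ => y + t • w) ⁻¹' U ∈ 𝓝 (0 : ℝ) := hc (by simpa using hU)
  obtain ⟨e, he, h⟩ := Metric.mem_nhds_iff.1 this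
  exact ⟨e, he, fun t ht => h (by simpa using ht)⟩

theorem isClosed_segment (p q : Plane) : IsClosed (segment ℝ p q) := by
  rw [segment_eq_image']
  exact (isCompact_Icc.image (by fun_prop)).isClosed

/-- A vector pointing to the positive side of the line through `p` and `q`. -/
def normal (p q : Plane) : Plane := (p.2 - q.2, q.1 - p.1)

theorem side_normal (p q : Plane) : side p q (p + normal p q) = along p q q := by
  simp only [side, along, normal, Prod.fst_add, Prod.snd_add]; ring

theorem exists_side_pos {p q y : Plane} (h : p ≠ q) (hy : y ∈ segment ℝ p q) {U : Set Plane}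
    (hU : U ∈ 𝓝 y) : ∃ z ∈ U, 0 < side p q z := by
  obtain ⟨e, he, hu⟩ := eventually_add_smul hU (normal p q)
  refine ⟨_, hu (e / 2) (by rw [abs_of_pos] <;> linarith), ?_⟩
  rw [side_add_smul_mem_iff p q hy, side_normal]
  exact mul_pos (by linarith) (along_self_pos h)

theorem exists_side_neg {p q y : Plane} (h : p ≠ q) (hy : y ∈ segment ℝ p q) {U : Set Plane}
    (hU : U ∈ 𝓝 y) : ∃ z ∈ U, side p q z < 0 := by
  obtain ⟨z, hz, hs⟩ := exists_side_pos h.symm (segment_symm ℝ p q ▸ hy) hU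
  exact ⟨z, hz, by rw [side_swap] at hs; linarith⟩

/-- A half-disc on one side of the line is convex and misses the segment. -/
theorem polyJoined_side_pos {p q y : Plane} {r : ℝ} {X : Set Plane}
    (hX : Metric.ball y r ⊆ Xᶜ) {z w : Plane} (hz : z ∈ Metric.ball y r)
    (hw : w ∈ Metric.ball y r) (hz0 : 0 < side p q z) (hw0 : 0 < side p q w) :
    PolyJoined (X ∪ segment ℝ p q)ᶜ z w := by
  refine .of_convex ((convex_ball y r).inter (convex_side_pos p q)) ?_ ⟨hz, hz0⟩ ⟨hw, hw0⟩
  rintro x ⟨hx, hx0⟩ (h | h)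
  · exact hX hx h
  · exact (side_eq_zero_of_mem h).not_gt hx0

theorem polyJoined_side_neg {p q y : Plane} {r : ℝ} {X : Set Plane}
    (hX : Metric.ball y r ⊆ Xᶜ) {z w : Plane} (hz : z ∈ Metric.ball y r)
    (hw : w ∈ Metric.ball y r) (hz0 : side p q z < 0) (hw0 : side p q w < 0) :
    PolyJoined (X ∪ segment ℝ p q)ᶜ z w := by
  rw [segment_symm]
  rw [side_swap, neg_lt_zero] at hz0 hw0
  exact polyJoined_side_pos hX hz hw hz0 hw0

/-- The half-disc behind `p` also misses the segment; it is the passage from one side to the other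
around a free end. -/
theorem polyJoined_along_neg {p q y : Plane} {r : ℝ} {X : Set Plane}
    (hX : Metric.ball y r ⊆ Xᶜ) {z w : Plane} (hz : z ∈ Metric.ball y r)
    (hw : w ∈ Metric.ball y r) (hz0 : along p q z < 0) (hw0 : along p q w < 0) :
    PolyJoined (X ∪ segment ℝ p q)ᶜ z w := by
  refine .of_convex ((convex_ball y r).inter (convex_along_neg p q)) ?_ ⟨hz, hz0⟩ ⟨hw, hw0⟩
  rintro x ⟨hx, hx0⟩ (h | h)
  · exact hX hx h
  · exact (along_of_mem h).not_gt hx0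

/-- Around an inner point of a segment, the segment looks like a line. -/
theorem exists_ball_of_openSegment {X : Set Plane} (hX : IsClosed X) {p q y : Plane}
    (h : p ≠ q) (hy : y ∈ openSegment ℝ p q) (hyX : y ∉ X) :
    ∃ r > 0, Metric.ball y r ⊆ Xᶜ ∧
      ∀ z ∈ Metric.ball y r, side p q z = 0 → z ∈ segment ℝ p q := by
  have hN := along_self_pos h
  have h1 : 0 < along p q y ∧ along p q y < along p q q := by
    obtain ⟨t, h0, h1, rfl⟩ := mem_openSegment_iff_exists.1 hy
    rw [along_add_smul, along_left, zero_add]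
    change 0 < t * along p q q ∧ t * along p q q < _
    constructor <;> nlinarith
  have hU : IsOpen (Xᶜ ∩ along p q ⁻¹' Ioo 0 (along p q q)) :=
    hX.isOpen_compl.inter (isOpen_Ioo.preimage (continuous_along p q))
  obtain ⟨r, hr, hb⟩ := Metric.isOpen_iff.1 hU y ⟨hyX, h1⟩
  exact ⟨r, hr, fun z hz => (hb hz).1, fun z hz hs =>
    mem_segment_of_side h hs (hb hz).2.1.le (hb hz).2.2.le⟩

/-- Around an end point of a segment, the segment looks like a ray. -/
theorem exists_ball_of_left {X : Set Plane} (hX : IsClosed X) {p q : Plane}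
    (h : p ≠ q) (hyX : p ∉ X) :
    ∃ r > 0, Metric.ball p r ⊆ Xᶜ ∧
      ∀ z ∈ Metric.ball p r, z ∉ segment ℝ p q → side p q z = 0 → along p q z < 0 := by
  have hN := along_self_pos h
  have hU : IsOpen (Xᶜ ∩ along p q ⁻¹' Iio (along p q q)) :=
    hX.isOpen_compl.inter (isOpen_Iio.preimage (continuous_along p q))
  obtain ⟨r, hr, hb⟩ := Metric.isOpen_iff.1 hU p ⟨hyX, by simpa [along_left] using hN⟩
  refine ⟨r, hr, fun z hz => (hb hz).1, fun z hz hzs hs => ?_⟩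
  by_contra! h0
  exact hzs (mem_segment_of_side h hs h0 (hb hz).2.le)

theorem exists_along_neg {p q : Plane} (h : p ≠ q) {U : Set Plane} (hU : U ∈ 𝓝 p) :
    (∃ z ∈ U, 0 < side p q z ∧ along p q z < 0) ∧ ∃ z ∈ U, side p q z < 0 ∧ along p q z < 0 := by
  have hN := along_self_pos h
  unfold along at hN
  constructor
  · obtain ⟨e, he, hu⟩ := eventually_add_smul hU (normal p q - (q - p))
    refine ⟨_, hu (e / 2) (by rw [abs_of_pos] <;> linarith), ?_, ?_⟩
    · rw [side_add_smul, side_left]; simp [normal]; nlinarith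
    · rw [along_add_smul, along_left]; simp [normal]; nlinarith
  · obtain ⟨e, he, hu⟩ := eventually_add_smul hU (-normal p q - (q - p))
    refine ⟨_, hu (e / 2) (by rw [abs_of_pos] <;> linarith), ?_, ?_⟩
    · rw [side_add_smul, side_left]; simp [normal]; nlinarith
    · rw [along_add_smul, along_left]; simp [normal]; nlinarith

/-- Around the free end of a segment, the complement of the segment is connected. -/
theorem exists_ball_polyJoined {X : Set Plane} (hX : IsClosed X) {p q : Plane}
    (h : p ≠ q) (hyX : p ∉ X) :
    ∃ r > 0, Metric.ball p r ⊆ Xᶜ ∧ ∀ z ∈ Metric.ball p r, ∀ w ∈ Metric.ball p r,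
      z ∉ segment ℝ p q → w ∉ segment ℝ p q → PolyJoined (X ∪ segment ℝ p q)ᶜ z w := by
  obtain ⟨r, hr, hb, hl⟩ := exists_ball_of_left hX h hyX
  refine ⟨r, hr, hb, ?_⟩
  obtain ⟨⟨a, ha, ha1, ha2⟩, c, hc, hc1, hc2⟩ := exists_along_neg h (Metric.ball_mem_nhds p hr)
  -- The half-disc behind `p` overlaps the half-discs on both sides, in `a` and in `c`, so every
  -- point of the ball off the segment reaches `a`.
  have key : ∀ z ∈ Metric.ball p r, z ∉ segment ℝ p q →
      PolyJoined (X ∪ segment ℝ p q)ᶜ z a := by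
    intro z hz hzs
    rcases lt_trichotomy (side p q z) 0 with h0 | h0 | h0
    · exact (polyJoined_side_neg hb hz hc h0 hc1).trans (polyJoined_along_neg hb hc ha hc2 ha2)
    · exact polyJoined_along_neg hb hz ha (hl z hz hzs h0) ha2
    · exact polyJoined_side_pos hb hz ha h0 ha1
  exact fun z hz w hw hzs hws => (key z hz hzs).trans (key w hw hws).symm

/-! ### How a new segment cuts the faces -/

section spread

variable {X W : Set Plane} {p q : Plane}

/-- Close to a point of the segment on which `W` surrounds it, `W` has points on both sides. In a
small ball the segment leaves two half-discs, or a single connected piece at an end point, so these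
points of `W` already reach everything in the ball. -/
theorem ball_subset_of_good (hX : IsClosed X) (hpq : p ≠ q)
    (hW : ∀ z w, z ∈ W → PolyJoined (X ∪ segment ℝ p q)ᶜ z w → w ∈ W)
    {y : Plane} (hy : y ∈ segment ℝ p q) (hyX : y ∉ X) :
    ∃ r > 0, ∀ y' ∈ Metric.ball y r, y' ∈ segment ℝ p q →
      (∀ᶠ z in 𝓝 y', z ∉ segment ℝ p q → z ∈ W) →
      ∀ z ∈ Metric.ball y r, z ∉ segment ℝ p q → z ∈ W := by
  have aux : ∀ {r}, ∀ y' ∈ Metric.ball y r, y' ∈ segment ℝ p q →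
      (∀ᶠ z in 𝓝 y', z ∉ segment ℝ p q → z ∈ W) →
      (∃ z ∈ Metric.ball y r, 0 < side p q z ∧ z ∈ W) ∧
        ∃ z ∈ Metric.ball y r, side p q z < 0 ∧ z ∈ W := by
    intro r y' hy' hys hg
    have hg' := hg.and (Metric.isOpen_ball.mem_nhds hy')
    constructor
    · obtain ⟨z, ⟨hz, hzb⟩, hs⟩ := exists_side_pos hpq hys hg'
      exact ⟨z, hzb, hs, hz fun h => hs.ne' (side_eq_zero_of_mem h)⟩
    · obtain ⟨z, ⟨hz, hzb⟩, hs⟩ := exists_side_neg hpq hys hg'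
      exact ⟨z, hzb, hs, hz fun h => hs.ne (side_eq_zero_of_mem h)⟩
  by_cases hyp : y ∉ X ∧ (y = p ∨ y = q)
  · obtain ⟨r, hr, hb, hj⟩ : ∃ r > 0, Metric.ball y r ⊆ Xᶜ ∧ ∀ z ∈ Metric.ball y r,
        ∀ w ∈ Metric.ball y r, z ∉ segment ℝ p q → w ∉ segment ℝ p q →
          PolyJoined (X ∪ segment ℝ p q)ᶜ z w := by
      rcases hyp.2 with rfl | rfl
      · exact exists_ball_polyJoined hX hpq hyX
      · rw [segment_symm]; exact exists_ball_polyJoined hX hpq.symm hyX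
    refine ⟨r, hr, fun y' hy' hys hg z hz hzs => ?_⟩
    obtain ⟨⟨a, ha, ha0, haW⟩, -⟩ := aux y' hy' hys hg
    exact hW a z haW (hj a ha z hz (fun h => ha0.ne' (side_eq_zero_of_mem h)) hzs)
  · have hyo : y ∈ openSegment ℝ p q :=
      mem_openSegment_of_ne_left_right (fun h => hyp ⟨hyX, .inl h.symm⟩)
        (fun h => hyp ⟨hyX, .inr h.symm⟩) hy
    obtain ⟨r, hr, hb, hs⟩ := exists_ball_of_openSegment hX hpq hyo hyX
    refine ⟨r, hr, fun y' hy' hys hg z hz hzs => ?_⟩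
    obtain ⟨⟨a, ha, ha0, haW⟩, ⟨c, hc, hc0, hcW⟩⟩ := aux y' hy' hys hg
    rcases lt_trichotomy (side p q z) 0 with h0 | h0 | h0
    · exact hW c z hcW (polyJoined_side_neg hb hc hz hc0 h0)
    · exact absurd (hs z hz h0) hzs
    · exact hW a z haW (polyJoined_side_pos hb ha hz ha0 h0)

/-- Let `W` be a union of faces after a segment is drawn. If `W` contains everything close
to one point of the segment, then it contains everything that could be joined to the segment. -/
theorem mem_of_polyJoined_segment (hX : IsClosed X) (hpq : p ≠ q)
    (hd : Disjoint (openSegment ℝ p q) X) (hWs : W ⊆ (X ∪ segment ℝ p q)ᶜ)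
    (hW : ∀ z w, z ∈ W → PolyJoined (X ∪ segment ℝ p q)ᶜ z w → w ∈ W)
    {y₀ : Plane} (hy₀ : y₀ ∈ segment ℝ p q) (hy₀X : y₀ ∉ X)
    (hg : ∀ᶠ z in 𝓝 y₀, z ∉ segment ℝ p q → z ∈ W)
    {z y : Plane} (hz : z ∉ X ∪ segment ℝ p q) (hy : y ∈ segment ℝ p q) (hyX : y ∉ X)
    (hzy : PolyJoined Xᶜ z y) : z ∈ W := by
  have hYo : IsOpen (X ∪ segment ℝ p q)ᶜ := (hX.union (isClosed_segment p q)).isOpen_compl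
  -- This set lies between the open segment and its closure.
  have hpre : IsPreconnected (segment ℝ p q \ X) :=
    (convex_openSegment p q).isPreconnected.subset_closure
      (fun x hx => ⟨openSegment_subset_segment ℝ p q hx, disjoint_left.1 hd hx⟩)
      (fun x hx => by rw [closure_openSegment]; exact hx.1)
  -- The points of the segment that `W` surrounds form an open set, and so do the others: `V` is a
  -- union of balls around bad points in which one good point would make the centre good.
  -- Connectedness then leaves only good points.
  have good : ∀ x ∈ segment ℝ p q, x ∉ X → ∀ᶠ z in 𝓝 x, z ∉ segment ℝ p q → z ∈ W := by
    by_contra hcon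
    simp only [not_forall] at hcon
    obtain ⟨x, hx, hxX, hxg⟩ := hcon
    have hU : IsOpen {x | ∀ᶠ z in 𝓝 x, z ∉ segment ℝ p q → z ∈ W} := isOpen_setOfPred_eventually_nhds
    let V : Set Plane := {v | ∃ x ∈ segment ℝ p q, x ∉ X ∧
      (¬ ∀ᶠ z in 𝓝 x, z ∉ segment ℝ p q → z ∈ W) ∧ ∃ r > 0, v ∈ Metric.ball x r ∧
        ∀ y' ∈ Metric.ball x r, y' ∈ segment ℝ p q →
      (∀ᶠ z in 𝓝 y', z ∉ segment ℝ p q → z ∈ W) →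
      ∀ z ∈ Metric.ball x r, z ∉ segment ℝ p q → z ∈ W}
    have hV : IsOpen V := by
      rw [isOpen_iff_mem_nhds]
      rintro v ⟨x, hx, hxX, hxg, r, hr, hv, hl⟩
      filter_upwards [Metric.isOpen_ball.mem_nhds hv] with v' hv'
      exact ⟨x, hx, hxX, hxg, r, hr, hv', hl⟩
    have hVmem : ∀ x ∈ segment ℝ p q, x ∉ X →
        (¬ ∀ᶠ z in 𝓝 x, z ∉ segment ℝ p q → z ∈ W) → x ∈ V := by
      intro x hx hxX hxg
      obtain ⟨r, hr, hl⟩ := ball_subset_of_good hX hpq hW hx hxX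
      exact ⟨x, hx, hxX, hxg, r, hr, Metric.mem_ball_self hr, hl⟩
    obtain ⟨v, hv, hvU, x', hx', hxX', hxg', r, hr, hvb, hl⟩ := hpre _ _ hU hV
      (fun x hx => by
        by_cases h : ∀ᶠ z in 𝓝 x, z ∉ segment ℝ p q → z ∈ W
        · exact Or.inl h
        · exact Or.inr (hVmem x hx.1 hx.2 h))
      ⟨y₀, ⟨hy₀, hy₀X⟩, hg⟩ ⟨x, ⟨hx, hxX⟩, hVmem x hx hxX hxg⟩
    exact hxg' (Filter.mem_of_superset (Metric.ball_mem_nhds x' hr)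
      fun z hz => hl v hvb hv.1 hvU z hz)
  have hWo : IsOpen W := isOpen_of_saturated hYo hWs hW
  have hVo : IsOpen ((X ∪ segment ℝ p q)ᶜ \ W) := isOpen_of_saturated hYo sdiff_subset
    fun z w hz h => ⟨h.mem hz.1, fun hw => hz.2 (hW w z hw h.symm)⟩
  -- With the whole segment surrounded by `W`, the interior of `W` together with the segment and the
  -- remaining faces are open, disjoint and cover `Xᶜ`. The path that ends on the segment stays in
  -- the first set.
  have := PolyJoined.mem_of_separation (S := Xᶜ) (U := interior (W ∪ segment ℝ p q)) isOpen_interior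
    hVo ?_ ?_ hzy.symm ?_
  · exact (interior_subset this).resolve_right fun h => hz (.inr h)
  · intro x hx
    by_cases hxs : x ∈ segment ℝ p q
    · refine .inl (mem_interior_iff_mem_nhds.2 ?_)
      filter_upwards [good x hxs hx] with z hz
      exact or_iff_not_imp_right.2 hz
    · by_cases hxW : x ∈ W
      · exact .inl (interior_mono subset_union_left (hWo.interior_eq.symm ▸ hxW))
      · exact .inr ⟨fun h => h.elim hx hxs, hxW⟩
  · rw [disjoint_left]
    intro x hx hx'
    exact (interior_subset hx).elim hx'.2 fun h => hx'.1 (.inr h)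
  · refine mem_interior_iff_mem_nhds.2 ?_
    filter_upwards [good y hy hyX] with z hz
    exact or_iff_not_imp_right.2 hz

/-- Drawing a segment with a free end does not cut a face. -/
theorem PolyJoined.union_segment_of_free (hX : IsClosed X) (hpq : p ≠ q)
    (hd : segment ℝ p q ∩ X ⊆ {q}) (hp : p ∉ X) {z w : Plane}
    (hz : z ∉ X ∪ segment ℝ p q) (hw : w ∉ X ∪ segment ℝ p q) (h : PolyJoined Xᶜ z w) :
    PolyJoined (X ∪ segment ℝ p q)ᶜ z w := by
  obtain ⟨r, hr, hb, hj⟩ := exists_ball_polyJoined hX hpq hp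
  obtain ⟨c, hc, hcs⟩ := exists_side_pos hpq (left_mem_segment ℝ p q) (Metric.ball_mem_nhds p hr)
  have hcs' : c ∉ segment ℝ p q := fun h => hcs.ne' (side_eq_zero_of_mem h)
  have hcY : c ∈ (X ∪ segment ℝ p q)ᶜ := fun h => h.elim (hb hc) hcs'
  have hdo : Disjoint (openSegment ℝ p q) X := by
    rw [disjoint_left]
    intro x hx hxX
    obtain rfl := hd ⟨openSegment_subset_segment ℝ p q hx, hxX⟩
    rw [right_mem_openSegment_iff] at hx
    exact hpq hx
  -- Here `W` is the face of `c`; it surrounds the free end `p` because a small ball minus the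
  -- segment is connected there.
  have key : ∀ z ∉ X ∪ segment ℝ p q, ∀ y ∈ segment ℝ p q, y ∉ X → PolyJoined Xᶜ z y →
      PolyJoined (X ∪ segment ℝ p q)ᶜ c z := by
    intro z hz y hy hyX hzy
    refine (mem_of_polyJoined_segment
      (W := {z | z ∈ (X ∪ segment ℝ p q)ᶜ ∧ PolyJoined (X ∪ segment ℝ p q)ᶜ c z}) hX hpq hdo
      (fun z hz => hz.1) (fun z w hz hzw => ⟨hzw.mem hz.1, hz.2.trans hzw⟩)
      (left_mem_segment ℝ p q) hp ?_ hz hy hyX hzy).2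
    filter_upwards [Metric.ball_mem_nhds p hr] with x hx hxs
    exact ⟨fun h => h.elim (hb hx) hxs, hj c hc x hx hcs' hxs⟩
  rcases h.avoid_or (segment ℝ p q) with h' | ⟨g, hg, hgX, hzg⟩
  · exact h'.mono (by rw [compl_union]; rfl)
  · exact (key z hz g hg hgX hzg).symm.trans (key w hw g hg hgX (h.symm.trans hzg))

/-- Drawing a segment cuts a face into at most two faces, one on each side of the segment. -/
theorem PolyJoined.union_segment_or (hX : IsClosed X) (hpq : p ≠ q)
    (hd : Disjoint (openSegment ℝ p q) X) {m : Plane} (hm : m ∈ openSegment ℝ p q) {v : Plane}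
    (hv : side p q (p + v) ≠ 0) :
    ∃ e > 0, ∀ t : ℝ, 0 < t → t < e → ∀ z ∉ X ∪ segment ℝ p q, PolyJoined Xᶜ z m →
      PolyJoined (X ∪ segment ℝ p q)ᶜ z (m + t • v) ∨
      PolyJoined (X ∪ segment ℝ p q)ᶜ z (m - t • v) := by
  have hms := openSegment_subset_segment ℝ p q hm
  have hmX := disjoint_left.1 hd hm
  obtain ⟨r, hr, hb, hs⟩ := exists_ball_of_openSegment hX hpq hm hmX
  obtain ⟨e, he, hev⟩ := eventually_add_smul (Metric.ball_mem_nhds m hr) v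
  refine ⟨e, he, fun t ht0 ht z hz hzm => ?_⟩
  have h1 := hev t (by rwa [abs_of_pos ht0])
  have h2 : m - t • v ∈ Metric.ball m r := by
    have := hev (-t) (by rwa [abs_neg, abs_of_pos ht0])
    rwa [neg_smul, ← sub_eq_add_neg] at this
  have s1 : side p q (m + t • v) = t * side p q (p + v) := side_add_smul_mem_iff p q hms v t
  have s2 : side p q (m - t • v) = -(t * side p q (p + v)) := by
    rw [sub_eq_add_neg, ← neg_smul, side_add_smul_mem_iff p q hms]; ring
  have hne : t * side p q (p + v) ≠ 0 := mul_ne_zero ht0.ne' hv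
  have mem : ∀ x ∈ Metric.ball m r, side p q x ≠ 0 → x ∈ (X ∪ segment ℝ p q)ᶜ :=
    fun x hx hxs h => h.elim (hb hx) fun h => hxs (side_eq_zero_of_mem h)
  have := (mem_of_polyJoined_segment
      (W := {z | z ∈ (X ∪ segment ℝ p q)ᶜ ∧ (PolyJoined (X ∪ segment ℝ p q)ᶜ z (m + t • v) ∨
      PolyJoined (X ∪ segment ℝ p q)ᶜ z (m - t • v))}) hX hpq hd
      (fun z hz => hz.1) (fun z w hz hzw => ⟨hzw.mem hz.1, hz.2.imp hzw.symm.trans hzw.symm.trans⟩)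
      hms hmX ?_ hz hms hmX hzm).2
  · exact this
  filter_upwards [Metric.ball_mem_nhds m hr] with x hx hxs
  have hx0 : side p q x ≠ 0 := fun h => hxs (hs x hx h)
  refine ⟨mem x hx hx0, ?_⟩
  -- The points `m + t • v` and `m - t • v` lie on opposite sides, so whichever side `x` is on, its
  -- half-disc contains one of them.
  rcases hx0.lt_or_gt with h0 | h0 <;> rcases hne.lt_or_gt with h0' | h0'
  · exact .inl (polyJoined_side_neg hb hx h1 h0 (s1 ▸ h0'))
  · exact .inr (polyJoined_side_neg hb hx h2 h0 (by rw [s2]; linarith))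
  · exact .inr (polyJoined_side_pos hb hx h2 h0 (by rw [s2]; linarith))
  · exact .inl (polyJoined_side_pos hb hx h1 h0 (s1 ▸ h0'))

end spread

/-! ### Separation by a closed polygon, via winding angles -/

/-- The identification of the plane with the complex numbers. -/
noncomputable def toComplex : Plane ≃L[ℝ] ℂ := Complex.equivRealProdCLM.symm

theorem toComplex_re (z : Plane) : (toComplex z).re = z.1 := rfl

theorem toComplex_im (z : Plane) : (toComplex z).im = z.2 := rfl

theorem toComplex_sub_ne_zero {a z : Plane} (h : z ≠ a) : toComplex a - toComplex z ≠ 0 :=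
  sub_ne_zero.2 fun h' => h (toComplex.injective h').symm

/-- The angle under which the directed segment from `a` to `b` is seen from `z`. -/
noncomputable def viewAngle (a b z : Plane) : ℝ :=
  ((toComplex b - toComplex z) / (toComplex a - toComplex z)).arg

/-- Polar form of the quotient; the factor `k` is the ratio of the two distances from `z`. -/
theorem exp_viewAngle {a b z : Plane} (ha : z ≠ a) (hb : z ≠ b) : ∃ k : ℝ, 0 < k ∧
    toComplex b - toComplex z =
      k * Complex.exp (viewAngle a b z * Complex.I) * (toComplex a - toComplex z) := by
  have ha' := toComplex_sub_ne_zero ha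
  refine ⟨‖(toComplex b - toComplex z) / (toComplex a - toComplex z)‖,
    norm_pos_iff.2 (div_ne_zero (toComplex_sub_ne_zero hb) ha'), ?_⟩
  rw [viewAngle, Complex.norm_mul_exp_arg_mul_I, div_mul_cancel₀ _ ha']

/-- The principal argument is discontinuous only where the quotient is a nonpositive real, and this
says that `z` is a convex combination of `a` and `b`. -/
theorem continuousAt_viewAngle {a b z : Plane} (hz : z ∉ segment ℝ a b) :
    ContinuousAt (viewAngle a b) z := by
  have ha : z ≠ a := fun h => hz (h ▸ left_mem_segment ℝ a b)
  have ha' := toComplex_sub_ne_zero ha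
  have hs : (toComplex b - toComplex z) / (toComplex a - toComplex z) ∈ Complex.slitPlane := by
    rw [Complex.mem_slitPlane_iff_not_le_zero]
    intro h
    obtain ⟨r, hr, hre⟩ : ∃ r : ℝ, r ≤ 0 ∧
        (toComplex b - toComplex z) / (toComplex a - toComplex z) = r := by
      rw [Complex.le_def] at h
      exact ⟨_, h.1, Complex.ext rfl (by simpa using h.2)⟩
    rw [div_eq_iff ha'] at hre
    apply hz
    have h1 := congrArg Complex.re hre
    have h2 := congrArg Complex.im hre
    simp [toComplex_re, toComplex_im] at h1 h2
    have hpos : 0 < 1 - r := by linarith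
    refine ⟨-r / (1 - r), 1 / (1 - r), div_nonneg (by linarith) hpos.le, by positivity,
      by field_simp; ring, ?_⟩
    ext
    · simp only [Prod.fst_add, Prod.smul_fst, smul_eq_mul]; field_simp; linarith
    · simp only [Prod.snd_add, Prod.smul_snd, smul_eq_mul]; field_simp; linarith
  have hc : ContinuousAt
      (fun z => (toComplex b - toComplex z) / (toComplex a - toComplex z)) z := by
    have := toComplex.continuous
    exact ContinuousAt.div (by fun_prop) (by fun_prop) ha'
  exact ContinuousAt.comp (g := Complex.arg) (Complex.continuousAt_arg hs) hc

/-- The total angle under which a polygonal path from `a` to `b` is seen is a continuous function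
off the path. -/
theorem PolyJoined.exists_angle {X : Set Plane} {a b : Plane} (h : PolyJoined X a b) :
    ∃ θ : Plane → ℝ, ∀ z ∉ X, ContinuousAt θ z ∧ ∃ k : ℝ, 0 < k ∧
      toComplex b - toComplex z =
        k * Complex.exp (θ z * Complex.I) * (toComplex a - toComplex z) := by
  induction h with
  | refl => exact ⟨fun _ => 0, fun z _ => ⟨continuousAt_const, 1, one_pos, by simp⟩⟩
  | @tail x y _ hxy ih =>
    obtain ⟨θ, hθ⟩ := ih
    -- Angles add while the quotients along the path multiply.
    refine ⟨fun z => viewAngle x y z + θ z, fun z hz => ?_⟩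
    obtain ⟨hc, k, hk, he⟩ := hθ z hz
    have hzs : z ∉ segment ℝ x y := fun h => hz (hxy h)
    obtain ⟨k', hk', he'⟩ := exp_viewAngle (a := x) (b := y) (z := z)
      (fun h => hzs (h ▸ left_mem_segment ℝ x y)) (fun h => hzs (h ▸ right_mem_segment ℝ x y))
    refine ⟨(continuousAt_viewAngle hzs).add hc, k' * k, mul_pos hk' hk, ?_⟩
    rw [he', he]
    push_cast
    rw [add_mul, Complex.exp_add]
    ring

/-- If the ends of a segment are joined by a polygonal path that misses the point `m` of the
segment, then the two sides of the segment at `m` are separated by the closed polygon. -/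
theorem not_polyJoined_of_polyJoined {X : Set Plane} (hX : IsClosed X) {p q m : Plane}
    (hpq : p ≠ q) (h : PolyJoined X p q) (hm : m ∈ openSegment ℝ p q) (hmX : m ∉ X) :
    ∃ U ∈ 𝓝 m, ∀ z ∈ U, ∀ w ∈ U, 0 < side p q z → side p q w < 0 →
      ¬ PolyJoined (X ∪ segment ℝ p q)ᶜ z w := by
  obtain ⟨θ, hθ⟩ := h.symm.exists_angle
  -- `φ` is the total angle of the closed polygon, that is, 2π times a winding number.
  set φ : Plane → ℝ := fun z => viewAngle p q z + θ z
  have hφc : ∀ z ∈ (X ∪ segment ℝ p q)ᶜ, ContinuousAt φ z := fun z hz =>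
    (continuousAt_viewAngle fun h => hz (.inr h)).add (hθ z fun h => hz (.inl h)).1
  -- Going once around multiplies `p - z` by `k * k' * exp (φ z * I)`, which must therefore be 1.
  have hφ : ∀ z ∈ (X ∪ segment ℝ p q)ᶜ, ∃ n : ℤ, φ z = n * (2 * Real.pi) := by
    intro z hz
    obtain ⟨-, k, hk, he⟩ := hθ z fun h => hz (.inl h)
    have hzp : z ≠ p := fun h => hz (.inr (h ▸ left_mem_segment ℝ p q))
    obtain ⟨k', hk', he'⟩ := exp_viewAngle (a := p) (b := q) (z := z) hzp
      (fun h => hz (.inr (h ▸ right_mem_segment ℝ p q)))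
    rw [he'] at he
    have h1 : ((k * k' : ℝ) : ℂ) * Complex.exp (φ z * Complex.I) = 1 := by
      apply mul_right_cancel₀ (toComplex_sub_ne_zero hzp)
      simp only [φ]
      push_cast
      rw [add_mul, Complex.exp_add]
      rw [one_mul]
      refine Eq.trans ?_ he.symm
      ring
    have h2 : k * k' = 1 := by
      have := congrArg norm h1
      rw [norm_mul, Complex.norm_exp_ofReal_mul_I, Complex.norm_real, mul_one, norm_one,
        Real.norm_of_nonneg (by positivity)] at this
      exact this
    rw [h2, Complex.ofReal_one, one_mul, Complex.exp_eq_one_iff] at h1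
    obtain ⟨n, hn⟩ := h1
    refine ⟨n, ?_⟩
    have := mul_right_cancel₀ Complex.I_ne_zero (hn.trans (by ring :
      _ = ((n : ℂ) * (2 * Real.pi)) * Complex.I))
    exact_mod_cast this
  -- The inner product of `p - z` and `q - z` is negative at `m`, hence nearby: the segment is seen
  -- there under an angle beyond a right angle, with the sign given by the side.
  set d : Plane → ℝ := fun z => (q.1 - z.1) * (p.1 - z.1) + (q.2 - z.2) * (p.2 - z.2)
  have hdm : d m < 0 := by
    obtain ⟨t, h0, h1, rfl⟩ := mem_openSegment_iff_exists.1 hm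
    have : d (p + t • (q - p)) = -(t * (1 - t) * along p q q) := by
      simp only [d, along, Prod.fst_add, Prod.snd_add, Prod.smul_fst, Prod.smul_snd, smul_eq_mul,
        Prod.fst_sub, Prod.snd_sub]
      ring
    rw [this, neg_lt_zero]
    exact mul_pos (mul_pos h0 (by linarith)) (along_self_pos hpq)
  have hdc : Continuous d := by fun_prop
  refine ⟨_, Filter.inter_mem ((isOpen_Iio.preimage hdc).mem_nhds hdm)
    ((hθ m hmX).1 (Metric.ball_mem_nhds _ one_pos)), ?_⟩
  rintro z ⟨hz, hzθ⟩ w ⟨hw, hwθ⟩ hz0 hw0 hzw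
  have hden : ∀ x, d x < 0 → 0 < Complex.normSq (toComplex p - toComplex x) := by
    intro x hx
    rw [Complex.normSq_pos]
    apply toComplex_sub_ne_zero
    rintro rfl
    simp [d] at hx
  have hre : ∀ x, d x < 0 → ((toComplex q - toComplex x) / (toComplex p - toComplex x)).re < 0 := by
    intro x hx
    rw [Complex.div_re, ← add_div]
    exact div_neg_of_neg_of_pos hx (hden x hx)
  have him : ∀ x, ((toComplex q - toComplex x) / (toComplex p - toComplex x)).im =
      side p q x / Complex.normSq (toComplex p - toComplex x) := by
    intro x
    rw [Complex.div_im, ← sub_div]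
    congr 1
    simp only [Complex.sub_re, Complex.sub_im, toComplex_re, toComplex_im, side]
    ring
  have haz : Real.pi / 2 < viewAngle p q z := by
    rw [viewAngle, ← not_le, Complex.arg_le_pi_div_two_iff, not_or, not_le, not_lt, him]
    exact ⟨hre z hz, (div_pos hz0 (hden z hz)).le⟩
  have haw : viewAngle p q w < -(Real.pi / 2) := by
    rw [viewAngle, ← not_le, Complex.neg_pi_div_two_le_arg_iff, not_or, not_le, not_le, him]
    exact ⟨hre w hw, div_neg_of_neg_of_pos hw0 (hden w hw)⟩
  -- The segment contributes a jump of more than π, while `θ` varies by less than 2 because both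
  -- values are within 1 of `θ m`.
  have hlt : φ w < φ z := by
    rw [mem_preimage, Metric.mem_ball, Real.dist_eq, abs_lt] at hzθ hwθ
    have := Real.pi_gt_three
    simp only [φ]
    linarith [hzθ.1, hwθ.2]
  have hzY : z ∈ (X ∪ segment ℝ p q)ᶜ := by
    rcases Relation.ReflTransGen.cases_head hzw with h | ⟨c, h, -⟩
    · exact absurd hlt (by rw [h]; exact lt_irrefl _)
    · exact h (left_mem_segment ℝ z c)
  have hwY := hzw.mem hzY
  have hYo : IsOpen (X ∪ segment ℝ p q)ᶜ := (hX.union (isClosed_segment p q)).isOpen_compl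
  have hφo : ContinuousOn φ (X ∪ segment ℝ p q)ᶜ := fun x hx => (hφc x hx).continuousWithinAt
  obtain ⟨n, hn⟩ := hφ w hwY
  obtain ⟨l, hl⟩ := hφ z hzY
  have hpi := Real.pi_pos
  have hnl : (n : ℝ) + 1 ≤ l := by
    rw [hn, hl] at hlt
    have := lt_of_mul_lt_mul_right hlt (by positivity)
    exact_mod_cast this
  -- `φ` takes only even multiples of π, so it never equals `φ w + π`; this value separates `w` from
  -- `z`.
  have := PolyJoined.mem_of_separation (S := (X ∪ segment ℝ p q)ᶜ)
    (hφo.isOpen_inter_preimage hYo (isOpen_Iio (a := φ w + Real.pi)))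
    (hφo.isOpen_inter_preimage hYo (isOpen_Ioi (a := φ w + Real.pi))) ?_ ?_ hzw.symm
    ⟨hwY, by simpa using hpi⟩
  · have h1 : φ z < φ w + Real.pi := this.2
    rw [hn, hl] at h1
    nlinarith
  · intro x hx
    rcases lt_trichotomy (φ x) (φ w + Real.pi) with h | h | h
    · exact .inl ⟨hx, h⟩
    · obtain ⟨j, hj⟩ := hφ x hx
      rw [hj, hn] at h
      have h2 : ((2 * j : ℤ) : ℝ) = ((2 * n + 1 : ℤ) : ℝ) := by
        push_cast
        apply mul_right_cancel₀ hpi.ne'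
        linarith
      have h3 := Int.cast_injective h2
      omega
    · exact .inr ⟨hx, h⟩
  · rw [disjoint_left]
    exact fun x hx hx' => lt_asymm (a := φ x) (b := φ w + Real.pi) hx.2 hx'.2

/-! ### Simple polygonal curves -/

theorem carrier_cons_cons (p q : Plane) (l : List Plane) :
    carrier (p :: q :: l) = segment ℝ p q ∪ carrier (q :: l) := rfl

theorem carrier_singleton (p : Plane) : carrier [p] = {p} := rfl

theorem isSimple_cons_cons {p q : Plane} {l : List Plane} : IsSimple (p :: q :: l) ↔
    p ≠ q ∧ segment ℝ p q ∩ carrier (q :: l) = {q} ∧ IsSimple (q :: l) := Iff.rfl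

theorem head_mem_carrier (p : Plane) (l : List Plane) : p ∈ carrier (p :: l) := by
  cases l with
  | nil => rfl
  | cons q l => exact .inl (left_mem_segment ℝ p q)

theorem mem_carrier_of_head? {a : Plane} {l : List Plane} (h : l.head? = some a) :
    a ∈ carrier l := by
  cases l with
  | nil => simp at h
  | cons q l => simp at h; exact h ▸ head_mem_carrier q l

theorem mem_carrier_of_getLast? {b : Plane} {l : List Plane} (h : l.getLast? = some b) :
    b ∈ carrier l := by
  induction l with
  | nil => simp at h
  | cons p l ih =>
    cases l with
    | nil => simp at h; exact h ▸ rfl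
    | cons q l => exact .inr (ih (by simpa using h))

theorem isCompact_segment (p q : Plane) : IsCompact (segment ℝ p q) := by
  rw [segment_eq_image']
  exact isCompact_Icc.image (by fun_prop)

theorem isCompact_carrier (l : List Plane) : IsCompact (carrier l) := by
  induction l with
  | nil => exact isCompact_empty
  | cons p l ih =>
    cases l with
    | nil => exact isCompact_singleton
    | cons q l => exact (isCompact_segment p q).union ih

theorem isClosed_carrier (l : List Plane) : IsClosed (carrier l) := (isCompact_carrier l).isClosed

theorem carrier_append (l₁ : List Plane) (x : Plane) (l₂ : List Plane) :
    carrier (l₁ ++ x :: l₂) = carrier (l₁ ++ [x]) ∪ carrier (x :: l₂) := by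
  induction l₁ with
  | nil =>
    exact (union_eq_self_of_subset_left (singleton_subset_iff.2 (head_mem_carrier x l₂))).symm
  | cons a l₁ ih =>
    cases l₁ with
    | nil =>
      change segment ℝ a x ∪ _ = (segment ℝ a x ∪ {x}) ∪ _
      rw [union_assoc, union_eq_self_of_subset_left
        (singleton_subset_iff.2 (head_mem_carrier x l₂))]
    | cons b l₁ =>
      simp only [List.cons_append, carrier_cons_cons] at ih ⊢
      rw [ih, union_assoc]

/-- The recursive definition compares each segment only with what follows; this form allows a curve
to be cut or glued at any corner. -/
theorem isSimple_append {l₁ : List Plane} {x : Plane} {l₂ : List Plane} :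
    IsSimple (l₁ ++ x :: l₂) ↔ IsSimple (l₁ ++ [x]) ∧ IsSimple (x :: l₂) ∧
      carrier (l₁ ++ [x]) ∩ carrier (x :: l₂) ⊆ {x} := by
  have hx := head_mem_carrier x l₂
  induction l₁ with
  | nil => exact ⟨fun h => ⟨trivial, h, inter_subset_left⟩, fun h => h.2.1⟩
  | cons a l₁ ih =>
    cases l₁ with
    | nil =>
      simp only [List.cons_append, List.nil_append, isSimple_cons_cons, carrier_cons_cons,
        carrier_singleton]
      constructor
      · rintro ⟨h1, h2, h3⟩
        refine ⟨⟨h1, ?_, trivial⟩, h3, ?_⟩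
        · exact inter_eq_right.2 (singleton_subset_iff.2 (right_mem_segment ℝ a x))
        · rw [union_inter_distrib_right, h2]
          exact union_subset subset_rfl inter_subset_left
      · rintro ⟨⟨h1, -, -⟩, h3, h4⟩
        refine ⟨h1, Subset.antisymm ?_ ?_, h3⟩
        · exact (inter_subset_inter_left _ subset_union_left).trans h4
        · exact singleton_subset_iff.2 ⟨right_mem_segment ℝ a x, hx⟩
    | cons b l₁ =>
      simp only [List.cons_append, isSimple_cons_cons, carrier_cons_cons] at ih ⊢
      refine (and_congr_right fun _ => and_congr_right fun _ => ih).trans ?_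
      rw [← List.cons_append, carrier_append, List.cons_append]
      have hb := head_mem_carrier b (l₁ ++ [x])
      have hxl : x ∈ carrier (b :: (l₁ ++ [x])) := mem_carrier_of_getLast? (by
        rw [← List.cons_append]; exact List.getLast?_concat)
      constructor
      · rintro ⟨h1, h2, h3, h4, h5⟩
        refine ⟨⟨h1, ?_, h3⟩, h4, ?_⟩
        · refine Subset.antisymm ?_ (singleton_subset_iff.2 ⟨right_mem_segment ℝ a b, hb⟩)
          rw [← h2]
          exact inter_subset_inter_right _ subset_union_left
        · rw [union_inter_distrib_right]
          refine union_subset ?_ h5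
          rintro y ⟨hy, hy'⟩
          obtain rfl : y = b := by
            rw [← mem_singleton_iff, ← h2]; exact ⟨hy, .inr hy'⟩
          exact h5 ⟨hb, hy'⟩
      · rintro ⟨⟨h1, h2, h3⟩, h4, h5⟩
        refine ⟨h1, ?_, h3, h4, (inter_subset_inter_left _ subset_union_right).trans h5⟩
        rw [inter_union_distrib_left, h2]
        refine union_eq_self_of_subset_right ?_
        rintro y ⟨hy, hy'⟩
        obtain rfl := h5 ⟨.inl hy, hy'⟩
        rw [← h2]
        exact ⟨hy, hxl⟩

theorem polyJoined_head_carrier {a x : Plane} {l : List Plane} (hx : x ∈ carrier (a :: l)) :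
    PolyJoined (carrier (a :: l)) a x := by
  induction l generalizing a with
  | nil => rw [mem_singleton_iff.1 hx]; exact .refl _
  | cons q l ih =>
    rcases hx with hx | hx
    · exact .of_convex (convex_segment a q) subset_union_left (left_mem_segment ℝ a q) hx
    · exact (PolyJoined.of_segment subset_union_left).trans ((ih hx).mono subset_union_right)

theorem polyJoined_of_mem_carrier {l : List Plane} {x y : Plane} (hx : x ∈ carrier l)
    (hy : y ∈ carrier l) : PolyJoined (carrier l) x y := by
  cases l with
  | nil => exact hx.elim
  | cons a l => exact (polyJoined_head_carrier hx).symm.trans (polyJoined_head_carrier hy)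

/-- A simple curve remains connected when its first point is removed. -/
theorem polyJoined_carrier_diff_head {a x y : Plane} {l : List Plane} (hl : IsSimple (a :: l))
    (hx : x ∈ carrier (a :: l)) (hxa : x ≠ a) (hy : y ∈ carrier (a :: l)) (hya : y ≠ a) :
    PolyJoined (carrier (a :: l) \ {a}) x y := by
  cases l with
  | nil => exact absurd (mem_singleton_iff.1 hx) hxa
  | cons q l =>
    obtain ⟨haq, hs, hl⟩ := hl
    have ha : a ∉ carrier (q :: l) := fun h => haq (by
      rw [← mem_singleton_iff, ← hs]; exact ⟨left_mem_segment ℝ a q, h⟩)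
    have key : ∀ x ∈ carrier (a :: q :: l), x ≠ a →
        PolyJoined (carrier (a :: q :: l) \ {a}) q x := by
      rintro x (hx | hx) hxa
      · refine .of_segment fun z hz => ⟨.inl ((convex_segment a q).segment_subset
          (right_mem_segment ℝ a q) hx hz), ?_⟩
        rintro rfl
        obtain ⟨t, h0, h1, rfl⟩ := mem_segment_iff_exists.1 hx
        obtain ⟨s, g0, g1, hs⟩ := mem_segment_iff_exists.1 hz
        have ht : 0 < t := h0.lt_of_ne (by rintro rfl; simp at hxa)
        -- The coefficient is positive for `t > 0` and `0 ≤ s ≤ 1`.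
        have h3 : (1 - s + s * t) • (q - z) = 0 := by
          have : z + ((1 - s + s * t) • (q - z)) = z := by
            conv_rhs => rw [hs]
            module
          simpa using this
        rcases smul_eq_zero.1 h3 with h3 | h3
        · rcases g0.eq_or_lt with rfl | g0
          · norm_num at h3
          · nlinarith [mul_pos g0 ht]
        · exact haq (sub_eq_zero.1 h3).symm
      · exact (polyJoined_head_carrier hx).mono fun z hz => ⟨.inr hz, fun h => ha (h ▸ hz)⟩
    exact (key x hx hxa).symm.trans (key y hy hya)

/-- A simple curve remains connected when its last point is removed. -/
theorem polyJoined_carrier_diff_last {a b x : Plane} {l : List Plane} (hl : IsSimple (a :: l))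
    (hb : (a :: l).getLast? = some b) (hx : x ∈ carrier (a :: l)) (hxb : x ≠ b) :
    PolyJoined (carrier (a :: l) \ {b}) a x := by
  induction l generalizing a with
  | nil =>
    simp at hb
    exact absurd (hb ▸ mem_singleton_iff.1 hx) hxb
  | cons q l ih =>
    have hl0 := hl
    obtain ⟨haq, hs, hl⟩ := hl
    have hb' : (q :: l).getLast? = some b := by simpa using hb
    have hbl := mem_carrier_of_getLast? hb'
    have hbs : b ∈ segment ℝ a q → b = q := fun h => by
      rw [← mem_singleton_iff, ← hs]; exact ⟨h, hbl⟩
    rcases hx with hx | hx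
    · refine .of_segment fun z hz => ⟨.inl ((convex_segment a q).segment_subset
          (left_mem_segment ℝ a q) hx hz), ?_⟩
      rintro rfl
      obtain rfl := hbs ((convex_segment a q).segment_subset (left_mem_segment ℝ a q) hx hz)
      obtain ⟨t, h0, h1, rfl⟩ := mem_segment_iff_exists.1 hx
      obtain ⟨s, g0, g1, hs⟩ := mem_segment_iff_exists.1 hz
      have h3 : (1 - s * t) • (z - a) = 0 := by
        calc (1 - s * t) • (z - a) = z - (a + s • (a + t • (z - a) - a)) := by module
          _ = 0 := by rw [← hs, sub_self]
      rcases smul_eq_zero.1 h3 with h3 | h3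
      · have : t = 1 := by nlinarith
        subst this
        simp at hxb
      · exact haq (sub_eq_zero.1 h3).symm
    · have hqb : q ≠ b := by
        rintro rfl
        cases l with
        | nil => exact hxb hx
        | cons r l =>
          have hl2 := (isSimple_cons_cons.1 hl)
          have : q ∈ carrier (r :: l) := mem_carrier_of_getLast? (by simpa using hb')
          exact hl2.1 (by rw [← mem_singleton_iff, ← hl2.2.1]
                          exact ⟨left_mem_segment ℝ q r, this⟩)
      refine PolyJoined.trans (.of_segment fun z hz => ⟨.inl hz, fun h => hqb ?_⟩)
        ((ih hl hb' hx).mono fun z hz => ⟨.inr hz.1, hz.2⟩)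
      rw [mem_singleton_iff] at h
      subst h
      exact (hbs hz).symm

/-- Drawing a simple curve from a point of `X` to a free end does not cut a face. -/
theorem PolyJoined.union_carrier_of_head {X : Set Plane} (hX : IsClosed X) {a : Plane}
    {l : List Plane} (hl : IsSimple (a :: l)) (ha : a ∈ X) (hd : carrier (a :: l) ∩ X ⊆ {a})
    {z w : Plane} (hz : z ∉ X ∪ carrier (a :: l)) (hw : w ∉ X ∪ carrier (a :: l))
    (h : PolyJoined Xᶜ z w) : PolyJoined (X ∪ carrier (a :: l))ᶜ z w := by
  induction l generalizing a X with
  | nil =>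
    rwa [carrier_singleton, union_eq_self_of_subset_right (singleton_subset_iff.2 ha)]
  | cons q l ih =>
    obtain ⟨haq, hs, hl⟩ := hl
    rw [carrier_cons_cons, ← union_assoc] at hz hw ⊢
    -- The curve is drawn outwards from its attached end, so that each segment has a free end when
    -- it is drawn.
    refine ih (hX.union (isClosed_segment a q)) hl (.inr (right_mem_segment ℝ a q)) ?_ hz hw ?_
    · rintro x ⟨hx, hx' | hx'⟩
      · obtain rfl := hd ⟨.inr hx, hx'⟩
        rw [← hs]
        exact ⟨left_mem_segment ℝ x q, hx⟩
      · rw [← hs]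
        exact ⟨hx', hx⟩
    · rw [segment_symm]
      refine h.union_segment_of_free hX haq.symm ?_ ?_ (fun h => ?_) (fun h => ?_)
      · rw [segment_symm]
        exact (inter_subset_inter_left _ subset_union_left).trans hd
      · exact fun hq => haq (hd ⟨.inl (right_mem_segment ℝ a q), hq⟩).symm
      · rw [segment_symm] at h; exact hz (.inl h)
      · rw [segment_symm] at h; exact hw (.inl h)

/-- Drawing a simple curve from a free end to a point of `X` does not cut a face. -/
theorem PolyJoined.union_carrier_of_getLast? {X : Set Plane} (hX : IsClosed X) {b : Plane}
    {l : List Plane} (hl : IsSimple l) (hb : l.getLast? = some b) (hbX : b ∈ X)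
    (hd : carrier l ∩ X ⊆ {b})
    {z w : Plane} (hz : z ∉ X ∪ carrier l) (hw : w ∉ X ∪ carrier l)
    (h : PolyJoined Xᶜ z w) : PolyJoined (X ∪ carrier l)ᶜ z w := by
  induction l with
  | nil => simpa [carrier] using h
  | cons a l ih =>
    cases l with
    | nil =>
      obtain rfl : a = b := by simpa using hb
      rwa [carrier_singleton, union_eq_self_of_subset_right (singleton_subset_iff.2 hbX)]
    | cons q l =>
      obtain ⟨haq, hs, hl⟩ := hl
      have hb' : (q :: l).getLast? = some b := by simpa using hb
      have ha : a ∉ carrier (q :: l) := fun h => haq (by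
        rw [← mem_singleton_iff, ← hs]; exact ⟨left_mem_segment ℝ a q, h⟩)
      rw [carrier_cons_cons, union_comm (segment ℝ a q), ← union_assoc] at hz hw ⊢
      -- The attached end is now the last point, so the tail is drawn before the first segment.
      refine (ih hl hb' ((inter_subset_inter_left _ subset_union_right).trans hd)
        (fun h => hz (.inl h)) (fun h => hw (.inl h))).union_segment_of_free
        (hX.union (isClosed_carrier _)) haq ?_ ?_ hz hw
      · rw [inter_union_distrib_left, hs]
        refine union_subset ?_ subset_rfl
        rintro x ⟨hx, hx'⟩
        obtain rfl := hd ⟨.inl hx, hx'⟩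
        rw [← hs]
        exact ⟨hx, mem_carrier_of_getLast? hb'⟩
      · rintro (h | h)
        · obtain rfl := hd ⟨.inl (left_mem_segment ℝ a q), h⟩
          exact ha (mem_carrier_of_getLast? hb')
        · exact ha h

/-- Drop everything before `w`. This makes it possible to switch onto a simple curve at the first
point where it is met. -/
theorem exists_isSimple_suffix {l : List Plane} (hl : IsSimple l) {w : Plane}
    (hw : w ∈ carrier l) : ∃ l', IsSimple (w :: l') ∧ (w :: l').getLast? = l.getLast? ∧
      carrier (w :: l') ⊆ carrier l := by
  induction l with
  | nil => exact hw.elim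
  | cons p l ih =>
    cases l with
    | nil => exact ⟨[], trivial, by rw [mem_singleton_iff.1 hw], by rw [mem_singleton_iff.1 hw]⟩
    | cons q l =>
      obtain ⟨hpq, hs, hl⟩ := hl
      by_cases hwl : w ∈ carrier (q :: l)
      · obtain ⟨l', h1, h2, h3⟩ := ih hl hwl
        exact ⟨l', h1, by simpa using h2, h3.trans subset_union_right⟩
      · have hwp : w ∈ segment ℝ p q := hw.resolve_right hwl
        have hsub : segment ℝ w q ⊆ segment ℝ p q :=
          (convex_segment p q).segment_subset hwp (right_mem_segment ℝ p q)
        refine ⟨q :: l, ⟨?_, Subset.antisymm ?_ ?_, hl⟩, by simp, union_subset_union_left _ hsub⟩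
        · rintro rfl; exact hwl (head_mem_carrier _ _)
        · rw [← hs]; exact inter_subset_inter_left _ hsub
        · exact singleton_subset_iff.2 ⟨right_mem_segment ℝ w q, head_mem_carrier q l⟩

/-- Points that are joined by a polygonal path are joined by a simple polygonal curve. -/
theorem PolyJoined.exists_isSimple {S : Set Plane} {a b : Plane} (h : PolyJoined S a b)
    (hb : b ∈ S) : ∃ l, IsSimple (a :: l) ∧ (a :: l).getLast? = some b ∧ carrier (a :: l) ⊆ S := by
  induction h using Relation.ReflTransGen.head_induction_on with
  | refl => exact ⟨[], trivial, rfl, singleton_subset_iff.2 hb⟩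
  | @head x y hxy _ ih =>
    obtain ⟨l, hl, hlast, hlS⟩ := ih
    -- The least such parameter is the first point at which the new segment hits the simple curve
    -- built so far. The segment is cut there and continued by the rest of the curve; minimality
    -- makes the result simple.
    have hK : IsCompact (Icc (0 : ℝ) 1 ∩ (fun t : ℝ => x + t • (y - x)) ⁻¹' carrier (y :: l)) :=
      isCompact_Icc.inter_right ((isClosed_carrier _).preimage (by fun_prop))
    obtain ⟨t, ⟨⟨h0, h1⟩, ht⟩, hmin⟩ := hK.exists_isLeast
      ⟨1, ⟨zero_le_one, le_rfl⟩, by simpa using head_mem_carrier y l⟩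
    obtain ⟨l', g1, g2, g3⟩ := exists_isSimple_suffix (w := x + t • (y - x)) hl ht
    by_cases hxw : x = x + t • (y - x)
    · rw [← hxw] at g1 g2 g3
      exact ⟨l', g1, g2.trans hlast, g3.trans hlS⟩
    · have hsub : segment ℝ x (x + t • (y - x)) ⊆ segment ℝ x y :=
        (convex_segment x y).segment_subset (left_mem_segment ℝ x y)
          (mem_segment_iff_exists.2 ⟨t, h0, h1, rfl⟩)
      refine ⟨(x + t • (y - x)) :: l', ⟨hxw, Subset.antisymm ?_ ?_, g1⟩, ?_, ?_⟩
      · rintro z ⟨hz, hz'⟩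
        obtain ⟨s, s0, s1, rfl⟩ := mem_segment_iff_exists.1 hz
        have hst : x + s • (x + t • (y - x) - x) = x + (s * t) • (y - x) := by module
        rw [hst] at hz' ⊢
        have : t ≤ s * t := hmin ⟨⟨by positivity, by nlinarith⟩, g3 hz'⟩
        have : s * t = t := le_antisymm (by nlinarith) this
        rw [this]; rfl
      · exact singleton_subset_iff.2 ⟨right_mem_segment ℝ _ _, head_mem_carrier _ _⟩
      · simpa using g2.trans hlast
      · exact union_subset (hsub.trans hxy) (g3.trans hlS)

theorem segment_union_segment {p q m : Plane} (hm : m ∈ segment ℝ p q) :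
    segment ℝ p m ∪ segment ℝ m q = segment ℝ p q := by
  refine Subset.antisymm (union_subset ?_ ?_) ?_
  · exact (convex_segment p q).segment_subset (left_mem_segment ℝ p q) hm
  · exact (convex_segment p q).segment_subset hm (right_mem_segment ℝ p q)
  · obtain ⟨t, h0, h1, rfl⟩ := mem_segment_iff_exists.1 hm
    intro x hx
    obtain ⟨s, s0, s1, rfl⟩ := mem_segment_iff_exists.1 hx
    rcases le_total s t with h | h
    · left
      rcases h0.eq_or_lt with rfl | h0
      · obtain rfl : s = 0 := by linarith
        simp
      · refine mem_segment_iff_exists.2 ⟨s / t, by positivity, (div_le_one h0).2 h, ?_⟩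
        have : s • (q - p) = (s / t) • (t • (q - p)) := by
          rw [smul_smul, div_mul_cancel₀ _ h0.ne']
        rw [this]; module
    · right
      rcases h1.eq_or_lt with rfl | h1
      · obtain rfl : s = 1 := by linarith
        simp
      · have h1' : 0 < 1 - t := by linarith
        refine mem_segment_iff_exists.2 ⟨(s - t) / (1 - t), div_nonneg (by linarith) h1'.le,
          (div_le_one h1').2 (by linarith), ?_⟩
        have : (s - t) • (q - p) = ((s - t) / (1 - t)) • ((1 - t) • (q - p)) := by
          rw [smul_smul, div_mul_cancel₀ _ h1'.ne']
        have e : q - (p + t • (q - p)) = (1 - t) • (q - p) := by module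
        rw [e, ← this]; module

theorem polyJoined_segment_diff_left {m c x : Plane} (hmc : m ≠ c) (hx : x ∈ segment ℝ m c)
    (hxm : x ≠ m) : PolyJoined (segment ℝ m c \ {m}) x c := by
  have e : carrier [m, c] = segment ℝ m c :=
    union_eq_self_of_subset_right (singleton_subset_iff.2 (right_mem_segment ℝ m c))
  have hs : IsSimple [m, c] :=
    ⟨hmc, inter_eq_right.2 (singleton_subset_iff.2 (right_mem_segment ℝ m c)), trivial⟩
  have := polyJoined_carrier_diff_head (x := x) (y := c) hs (by rwa [e]) hxm
    (by rw [e]; exact right_mem_segment ℝ m c) hmc.symm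
  rwa [e] at this

/-! ### A new curve with its crossbar -/

/-- A curve drawn from `s` to `t` outside of a closed set `X`, together with a crossbar from `c` to
`d` at the point `m` of the curve. -/
structure Chord (X : Set Plane) (s t : Plane) (l₁ l₂ : List Plane) (p q m c d : Plane) : Prop where
  closed : IsClosed X
  left_mem : s ∈ X
  right_mem : t ∈ X
  simple₁ : IsSimple (s :: (l₁ ++ [p, m]))
  simple₂ : IsSimple (m :: q :: (l₂ ++ [t]))
  mem_openSegment : m ∈ openSegment ℝ p q
  mem_crossbar : m ∈ openSegment ℝ c d
  inter₁ : ∀ x ∈ carrier (s :: (l₁ ++ [p, m])), x ∈ X → x = s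
  inter₂ : ∀ x ∈ carrier (m :: q :: (l₂ ++ [t])), x ∈ X → x = t
  notMem : m ∉ X
  -- The second alternative covers two tips at the same vertex, whose curve is closed.
  inter : ∀ x ∈ carrier (s :: (l₁ ++ [p, m])), x ∈ carrier (m :: q :: (l₂ ++ [t])) →
    x = m ∨ x = s ∧ x = t
  ne_left : m ≠ c
  ne_right : m ≠ d
  stub_left : ∀ x ∈ segment ℝ m c,
    x ∈ carrier (s :: (l₁ ++ [p, m])) ∪ carrier (m :: q :: (l₂ ++ [t])) → x = m
  stub_right : ∀ x ∈ segment ℝ m d,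
    x ∈ carrier (s :: (l₁ ++ [p, m])) ∪ carrier (m :: q :: (l₂ ++ [t])) → x = m

namespace Chord

variable {X : Set Plane} {s t : Plane} {l₁ l₂ : List Plane} {p q m c d : Plane}

/-- The set of points of the curve of a chord. -/
def points (s t : Plane) (l₁ l₂ : List Plane) (p q m : Plane) : Set Plane :=
  carrier (s :: (l₁ ++ [p, m])) ∪ carrier (m :: q :: (l₂ ++ [t]))

/-- The part of the curve of a chord before the crossed segment. -/
def before (s : Plane) (l₁ : List Plane) (p : Plane) : List Plane := s :: (l₁ ++ [p])

/-- The part of the curve of a chord after the crossed segment. -/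
def after (t : Plane) (l₂ : List Plane) (q : Plane) : List Plane := q :: (l₂ ++ [t])

theorem isClosed_points (s t : Plane) (l₁ l₂ : List Plane) (p q m : Plane) :
    IsClosed (points s t l₁ l₂ p q m) := (isClosed_carrier _).union (isClosed_carrier _)

theorem carrier₁ (s : Plane) (l₁ : List Plane) (p m : Plane) :
    carrier (s :: (l₁ ++ [p, m])) = carrier (before s l₁ p) ∪ segment ℝ p m := by
  rw [← List.cons_append, carrier_append, carrier_cons_cons, carrier_singleton,
    union_eq_self_of_subset_right (singleton_subset_iff.2 (right_mem_segment ℝ p m))]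
  rfl

theorem carrier₂ (t : Plane) (l₂ : List Plane) (q m : Plane) :
    carrier (m :: q :: (l₂ ++ [t])) = segment ℝ m q ∪ carrier (after t l₂ q) := rfl

theorem isSimple_before (h : Chord X s t l₁ l₂ p q m c d) : IsSimple (before s l₁ p) := by
  have := h.simple₁
  rw [← List.cons_append, isSimple_append] at this
  exact this.1

theorem isSimple_after (h : Chord X s t l₁ l₂ p q m c d) : IsSimple (after t l₂ q) :=
  h.simple₂.2.2

theorem before_inter (h : Chord X s t l₁ l₂ p q m c d) {x : Plane}
    (hx : x ∈ carrier (before s l₁ p)) (hx' : x ∈ segment ℝ p m) : x = p := by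
  have := h.simple₁
  rw [← List.cons_append, isSimple_append] at this
  exact this.2.2 ⟨hx, .inl hx'⟩

theorem after_inter (h : Chord X s t l₁ l₂ p q m c d) {x : Plane}
    (hx : x ∈ carrier (after t l₂ q)) (hx' : x ∈ segment ℝ m q) : x = q := by
  rw [← mem_singleton_iff, ← h.simple₂.2.1]
  exact ⟨hx', hx⟩

theorem p_ne_m (h : Chord X s t l₁ l₂ p q m c d) : p ≠ m := by
  have := h.simple₁
  rw [← List.cons_append, isSimple_append] at this
  exact this.2.1.1

theorem m_ne_q (h : Chord X s t l₁ l₂ p q m c d) : m ≠ q := h.simple₂.1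

theorem p_ne_q (h : Chord X s t l₁ l₂ p q m c d) : p ≠ q := by
  rintro rfl
  have := h.mem_openSegment
  rw [openSegment_same] at this
  exact h.p_ne_m this.symm

theorem m_notMem_before (h : Chord X s t l₁ l₂ p q m c d) : m ∉ carrier (before s l₁ p) :=
  fun hm => h.p_ne_m (h.before_inter hm (right_mem_segment ℝ p m)).symm

theorem m_notMem_after (h : Chord X s t l₁ l₂ p q m c d) : m ∉ carrier (after t l₂ q) :=
  fun hm => h.m_ne_q (h.after_inter hm (left_mem_segment ℝ m q))

theorem union_eq (h : Chord X s t l₁ l₂ p q m c d) :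
    X ∪ carrier (before s l₁ p) ∪ carrier (after t l₂ q) ∪ segment ℝ p q =
      X ∪ points s t l₁ l₂ p q m := by
  rw [points, carrier₁, carrier₂,
    ← segment_union_segment (openSegment_subset_segment ℝ p q h.mem_openSegment)]
  ext x
  simp only [mem_union]
  tauto

theorem s_mem_before (s : Plane) (l₁ : List Plane) (p : Plane) : s ∈ carrier (before s l₁ p) :=
  head_mem_carrier _ _

theorem p_mem_before (s : Plane) (l₁ : List Plane) (p : Plane) : p ∈ carrier (before s l₁ p) :=
  mem_carrier_of_getLast? (by rw [before, ← List.cons_append]; exact List.getLast?_concat)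

theorem q_mem_after (t : Plane) (l₂ : List Plane) (q : Plane) : q ∈ carrier (after t l₂ q) :=
  head_mem_carrier _ _

theorem getLast?_after (t : Plane) (l₂ : List Plane) (q : Plane) :
    (after t l₂ q).getLast? = some t := by
  rw [after, ← List.cons_append]; exact List.getLast?_concat

theorem t_mem_after (t : Plane) (l₂ : List Plane) (q : Plane) : t ∈ carrier (after t l₂ q) :=
  mem_carrier_of_getLast? (getLast?_after t l₂ q)

/-- This lets the crossed segment be drawn last, so that only it can cut a face. -/
theorem disjoint_openSegment (h : Chord X s t l₁ l₂ p q m c d) : Disjoint (openSegment ℝ p q)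
    (X ∪ carrier (before s l₁ p) ∪ carrier (after t l₂ q)) := by
  rw [disjoint_left]
  intro x hx hx'
  have hxp : x ≠ p := by
    rintro rfl
    exact h.p_ne_q (left_mem_openSegment_iff.1 hx)
  have hxq : x ≠ q := by
    rintro rfl
    exact h.p_ne_q (right_mem_openSegment_iff.1 hx)
  have hxs := openSegment_subset_segment ℝ p q hx
  rw [← segment_union_segment (openSegment_subset_segment ℝ p q h.mem_openSegment)] at hxs
  rcases hxs with hxs | hxs
  · have h1 : x ∈ carrier (s :: (l₁ ++ [p, m])) := by rw [carrier₁]; exact .inr hxs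
    rcases hx' with (hx' | hx') | hx'
    · have := h.inter₁ x h1 hx'
      subst this
      exact hxp (h.before_inter (s_mem_before _ _ _) hxs)
    · exact hxp (h.before_inter hx' hxs)
    · rcases h.inter x h1 (by rw [carrier₂]; exact .inr hx') with rfl | ⟨rfl, -⟩
      · exact h.m_notMem_after hx'
      · exact hxp (h.before_inter (s_mem_before _ _ _) hxs)
  · have h1 : x ∈ carrier (m :: q :: (l₂ ++ [t])) := by rw [carrier₂]; exact .inl hxs
    rcases hx' with (hx' | hx') | hx'
    · have := h.inter₂ x h1 hx'
      subst this
      exact hxq (h.after_inter (t_mem_after _ _ _) hxs)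
    · rcases h.inter x (by rw [carrier₁]; exact .inl hx') h1 with rfl | ⟨-, rfl⟩
      · exact h.m_notMem_before hx'
      · exact hxq (h.after_inter (t_mem_after _ _ _) hxs)
    · exact hxq (h.after_inter hx' hxs)

theorem isClosed_rest (h : Chord X s t l₁ l₂ p q m c d) :
    IsClosed (X ∪ carrier (before s l₁ p) ∪ carrier (after t l₂ q)) :=
  (h.closed.union (isClosed_carrier _)).union (isClosed_carrier _)

/-- Were the crossbar parallel to the crossed segment, a short piece of it at `m` would lie in that
segment, against `stub_left`. -/
theorem side_ne_zero (h : Chord X s t l₁ l₂ p q m c d) : side p q (p + (c - m)) ≠ 0 := by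
  intro h0
  obtain ⟨r, hr, -, hs⟩ := exists_ball_of_openSegment isClosed_empty h.p_ne_q h.mem_openSegment
    (notMem_empty m)
  obtain ⟨e, he, hev⟩ := eventually_add_smul (Metric.ball_mem_nhds m hr) (c - m)
  have hms := openSegment_subset_segment ℝ p q h.mem_openSegment
  set u := min (e / 2) 1
  have hu0 : 0 < u := lt_min (by linarith) one_pos
  have hue : u < e := (min_le_left _ _).trans_lt (by linarith)
  have hz := hs _ (hev u (by rwa [abs_of_pos hu0]))
    (by rw [side_add_smul_mem_iff p q hms, h0, mul_zero])
  have := h.stub_left _ (mem_segment_iff_exists.2 ⟨u, hu0.le, min_le_right _ _, rfl⟩) (by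
    rw [← segment_union_segment hms] at hz
    rw [carrier₁, carrier₂]
    rcases hz with hz | hz
    · exact .inl (.inr hz)
    · exact .inr (.inl hz))
  rw [add_eq_left, smul_eq_zero, sub_eq_zero] at this
  exact this.elim hu0.ne' h.ne_left.symm

/-- Each half of the curve meets `X` at most in its outer end, and a simple curve without an end
point is still connected. -/
theorem polyJoined_m (h : Chord X s t l₁ l₂ p q m c d) {g : Plane}
    (hg : g ∈ points s t l₁ l₂ p q m) (hgX : g ∉ X) :
    PolyJoined (points s t l₁ l₂ p q m \ X) g m := by
  rcases hg with hg | hg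
  · refine (polyJoined_carrier_diff_head h.simple₁ hg (fun e => hgX (e ▸ h.left_mem)) ?_ ?_).mono ?_
    · rw [carrier₁]; exact .inr (right_mem_segment ℝ p m)
    · rintro rfl; exact h.m_notMem_before (s_mem_before _ _ _)
    · exact fun x hx => ⟨.inl hx.1, fun hx' => hx.2 (h.inter₁ x hx.1 hx')⟩
  · refine (polyJoined_carrier_diff_last h.simple₂ (getLast?_after t l₂ q) hg
      (fun e => hgX (e ▸ h.right_mem))).symm.mono ?_
    exact fun x hx => ⟨.inr hx.1, fun hx' => hx.2 (h.inter₂ x hx.1 hx')⟩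

/-- Since `m` is strictly between `c` and `d`, the direction opposite to `c - m` is that of `d - m`.
-/
theorem exists_ratio (h : Chord X s t l₁ l₂ p q m c d) :
    ∃ r : ℝ, 0 < r ∧ ∀ u : ℝ, m - u • (c - m) = m + (u * r) • (d - m) := by
  obtain ⟨τ, h0, h1, hm⟩ := mem_openSegment_iff_exists.1 h.mem_crossbar
  have h1' : 0 < 1 - τ := by linarith
  refine ⟨τ / (1 - τ), by positivity, fun u => ?_⟩
  have e1 : c - m = (-τ) • (d - c) := by rw [hm]; module
  have e2 : d - m = (1 - τ) • (d - c) := by rw [hm]; module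
  rw [e1, e2, smul_smul, smul_smul]
  have : u * (τ / (1 - τ)) * (1 - τ) = u * τ := by field_simp
  rw [this]; module

/-- One parameter `u` serves both halves of the crossbar, so that their points have the form `m ± u
• (c - m)` required by `PolyJoined.union_segment_or`. -/
theorem exists_near (h : Chord X s t l₁ l₂ p q m c d) {U : Set Plane} (hU : U ∈ 𝓝 m) {e : ℝ}
    (he : 0 < e) : ∃ u : ℝ, 0 < u ∧ u < e ∧
      (m + u • (c - m) ∈ segment ℝ m c ∧ m + u • (c - m) ≠ m ∧
        segment ℝ m (m + u • (c - m)) ⊆ U) ∧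
      (m - u • (c - m) ∈ segment ℝ m d ∧ m - u • (c - m) ≠ m ∧
        segment ℝ m (m - u • (c - m)) ⊆ U) := by
  obtain ⟨r, hr0, hr⟩ := h.exists_ratio
  obtain ⟨ρ, hρ, hb⟩ := Metric.mem_nhds_iff.1 hU
  obtain ⟨e', he', hev⟩ := eventually_add_smul (Metric.ball_mem_nhds m hρ) (c - m)
  set u := min (min (e / 2) (e' / 2)) (min 1 (1 / r))
  have hu0 : 0 < u := by
    refine lt_min (lt_min ?_ ?_) (lt_min ?_ ?_) <;> positivity
  have hue : u < e := ((min_le_left _ _).trans (min_le_left _ _)).trans_lt (by linarith)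
  have hue' : u < e' := ((min_le_left _ _).trans (min_le_right _ _)).trans_lt (by linarith)
  have hu1 : u ≤ 1 := (min_le_right _ _).trans (min_le_left _ _)
  have hur : u * r ≤ 1 := by
    have : u ≤ 1 / r := (min_le_right _ _).trans (min_le_right _ _)
    rwa [le_div_iff₀ hr0] at this
  have hcm : u • (c - m) ≠ 0 := by
    rw [Ne, smul_eq_zero, sub_eq_zero, not_or]; exact ⟨hu0.ne', h.ne_left.symm⟩
  have hball : ∀ x ∈ Metric.ball m ρ, segment ℝ m x ⊆ U := fun x hx =>
    ((convex_ball m ρ).segment_subset (Metric.mem_ball_self hρ) hx).trans hb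
  refine ⟨u, hu0, hue, ⟨mem_segment_iff_exists.2 ⟨u, hu0.le, hu1, rfl⟩, ?_, ?_⟩, ?_, ?_, ?_⟩
  · rwa [Ne, add_eq_left]
  · exact hball _ (hev u (by rwa [abs_of_pos hu0]))
  · exact mem_segment_iff_exists.2 ⟨u * r, by positivity, hur, hr u⟩
  · rwa [Ne, sub_eq_self]
  · apply hball
    have := hev (-u) (by rwa [abs_neg, abs_of_pos hu0])
    rwa [neg_smul, ← sub_eq_add_neg] at this

/-- A point that could be joined to the new curve can be joined to one end of a small crossbar. -/
theorem polyJoined_or (h : Chord X s t l₁ l₂ p q m c d) {U : Set Plane} (hU : U ∈ 𝓝 m) :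
    ∃ c' d', (c' ∈ segment ℝ m c ∧ c' ≠ m ∧ segment ℝ m c' ⊆ U) ∧
      (d' ∈ segment ℝ m d ∧ d' ≠ m ∧ segment ℝ m d' ⊆ U) ∧
      ∀ z ∉ X ∪ points s t l₁ l₂ p q m, ∀ g ∈ points s t l₁ l₂ p q m, g ∉ X →
        PolyJoined Xᶜ z g → PolyJoined (X ∪ points s t l₁ l₂ p q m)ᶜ z c' ∨
          PolyJoined (X ∪ points s t l₁ l₂ p q m)ᶜ z d' := by
  obtain ⟨e, he, hor⟩ := PolyJoined.union_segment_or h.isClosed_rest h.p_ne_q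
    h.disjoint_openSegment h.mem_openSegment h.side_ne_zero
  obtain ⟨u, hu0, hue, hc, hd⟩ := h.exists_near hU he
  refine ⟨_, _, hc, hd, fun z hz g hg hgX hzg => ?_⟩
  have hzm : PolyJoined Xᶜ z m := hzg.trans ((h.polyJoined_m hg hgX).mono fun x hx => hx.2)
  rw [← h.union_eq] at hz ⊢
  have hmX := disjoint_left.1 h.disjoint_openSegment h.mem_openSegment
  refine hor u hu0 hue z hz ?_
  -- The parts before and after the crossed segment hang from `X` with a free end, so drawing them
  -- cuts nothing.
  have h1 := PolyJoined.union_carrier_of_head h.closed h.isSimple_before h.left_mem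
    (fun x hx => h.inter₁ x (by rw [carrier₁]; exact .inl hx.1) hx.2)
    (fun h => hz (.inl (.inl h))) (fun h => hmX (.inl h)) hzm
  refine PolyJoined.union_carrier_of_getLast? (h.closed.union (isClosed_carrier _))
    h.isSimple_after (getLast?_after t l₂ q) (.inl h.right_mem) ?_ (fun h => hz (.inl h)) hmX h1
  rintro x ⟨hx, hx' | hx'⟩
  · exact h.inter₂ x (by rw [carrier₂]; exact .inr hx) hx'
  · rcases h.inter x (by rw [carrier₁]; exact .inl hx') (by rw [carrier₂]; exact .inr hx) with
      rfl | ⟨-, rfl⟩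
    · exact absurd hx h.m_notMem_after
    · rfl

/-- If the ends of the curve are joined in `X`, then the curve separates the ends
of the crossbar. -/
theorem not_polyJoined (h : Chord X s t l₁ l₂ p q m c d) (hst : PolyJoined X s t)
    (hc : Disjoint (segment ℝ m c) X) (hd : Disjoint (segment ℝ m d) X) :
    ¬ PolyJoined (X ∪ points s t l₁ l₂ p q m)ᶜ c d := by
  intro hcd
  -- The crossed segment is closed to a polygon by the rest of the curve and a path in `X` from `s`
  -- to `t`.
  have hpq : PolyJoined (X ∪ carrier (before s l₁ p) ∪ carrier (after t l₂ q)) p q := by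
    refine PolyJoined.trans (b := s) ?_ (PolyJoined.trans (b := t) ?_ ?_)
    · exact (polyJoined_of_mem_carrier (p_mem_before _ _ _) (s_mem_before _ _ _)).mono
        fun x hx => .inl (.inr hx)
    · exact hst.mono fun x hx => .inl (.inl hx)
    · exact (polyJoined_of_mem_carrier (t_mem_after _ _ _) (q_mem_after _ _ _)).mono
        fun x hx => .inr hx
  obtain ⟨U, hU, hsep⟩ := not_polyJoined_of_polyJoined h.isClosed_rest h.p_ne_q hpq
    h.mem_openSegment (disjoint_left.1 h.disjoint_openSegment h.mem_openSegment)
  obtain ⟨u, hu0, -, ⟨hc1, hc2, hc3⟩, hd1, hd2, hd3⟩ := h.exists_near hU one_pos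
  rw [h.union_eq] at hsep
  -- The ends of the crossbar may be moved along it to points close to `m`, where the separation is
  -- known.
  have h1 : PolyJoined (X ∪ points s t l₁ l₂ p q m)ᶜ (m + u • (c - m)) c :=
    (polyJoined_segment_diff_left h.ne_left hc1 hc2).mono fun x hx hx' =>
      hx'.elim (disjoint_left.1 hc hx.1) fun hx' => hx.2 (h.stub_left x hx.1 hx')
  have h2 : PolyJoined (X ∪ points s t l₁ l₂ p q m)ᶜ (m - u • (c - m)) d :=
    (polyJoined_segment_diff_left h.ne_right hd1 hd2).mono fun x hx hx' =>
      hx'.elim (disjoint_left.1 hd hx.1) fun hx' => hx.2 (h.stub_right x hx.1 hx')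
  have h3 := (h1.trans hcd).trans h2.symm
  have hms := openSegment_subset_segment ℝ p q h.mem_openSegment
  have s1 : side p q (m + u • (c - m)) = u * side p q (p + (c - m)) :=
    side_add_smul_mem_iff p q hms _ u
  have s2 : side p q (m - u • (c - m)) = -(u * side p q (p + (c - m))) := by
    rw [sub_eq_add_neg, ← neg_smul, side_add_smul_mem_iff p q hms]; ring
  rcases (mul_ne_zero hu0.ne' h.side_ne_zero).lt_or_gt with h0 | h0
  · exact hsep _ (hd3 (right_mem_segment ℝ _ _)) _ (hc3 (right_mem_segment ℝ _ _))
      (by rw [s2]; linarith) (by rwa [s1]) h3.symm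
  · exact hsep _ (hc3 (right_mem_segment ℝ _ _)) _ (hd3 (right_mem_segment ℝ _ _))
      (by rwa [s1]) (by rw [s2]; linarith) h3

end Chord

/-! ### Upper bounds for the number of faces -/

/-- The complement of `X` has at most `N` faces. -/
def HasFacesLE (X : Set Plane) (N : ℕ) : Prop :=
  ∃ R : Finset Plane, R.card ≤ N ∧ ∀ z ∉ X, ∃ r ∈ R, PolyJoined Xᶜ z r

namespace HasFacesLE

variable {X Y : Set Plane} {N : ℕ}

theorem singleton (v : Plane) : HasFacesLE {v} 1 := by
  have hc : IsConnected ({v}ᶜ : Set Plane) := by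
    apply isConnected_compl_singleton_of_one_lt_rank
    rw [rank_prod', Module.rank_self]
    norm_num
  obtain ⟨r, hr⟩ := hc.nonempty
  exact ⟨{r}, by simp, fun z hz => ⟨r, by simp,
    IsPreconnected.polyJoined isClosed_singleton.isOpen_compl hc.isPreconnected hz hr⟩⟩

/-- Representatives covered by `Y` are moved inside their old face to points off `Y`; a face with no
such point needs no representative. -/
theorem exists_image (Y : Set Plane) (R : Finset Plane) : ∃ R' : Finset Plane, R'.card ≤ R.card ∧
    ∀ z ∉ Y, ∀ r ∈ R, PolyJoined Xᶜ z r → ∃ r' ∈ R', r' ∉ Y ∧ PolyJoined Xᶜ z r' := by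
  classical
  let f : Plane → Plane := fun r =>
    if h : ∃ w, w ∉ Y ∧ PolyJoined Xᶜ w r then h.choose else r
  refine ⟨R.image f, Finset.card_image_le, fun z hz r hr hzr => ?_⟩
  have h : ∃ w, w ∉ Y ∧ PolyJoined Xᶜ w r := ⟨z, hz, hzr⟩
  have hf : f r = h.choose := dif_pos h
  refine ⟨f r, Finset.mem_image_of_mem f hr, hf ▸ h.choose_spec.1, ?_⟩
  exact hzr.trans (hf ▸ h.choose_spec.2).symm

theorem mono_set (h : HasFacesLE X N) (hXY : X ⊆ Y)
    (hj : ∀ z ∉ Y, ∀ w ∉ Y, PolyJoined Xᶜ z w → PolyJoined Yᶜ z w) : HasFacesLE Y N := by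
  obtain ⟨R, hR, hc⟩ := h
  obtain ⟨R', hR', hc'⟩ := exists_image (X := X) Y R
  refine ⟨R', hR'.trans hR, fun z hz => ?_⟩
  obtain ⟨r, hr, hzr⟩ := hc z fun h => hz (hXY h)
  obtain ⟨r', hr', hrY, hzr'⟩ := hc' z hz r hr hzr
  exact ⟨r', hr', hj z hz r' hrY hzr'⟩

/-- Drawing a segment between two points of `X` yields at most one new face. -/
theorem union_segment (h : HasFacesLE X N) (hX : IsClosed X) {p q : Plane} (hpq : p ≠ q)
    (hp : p ∈ X) (hq : q ∈ X) (hd : Disjoint (openSegment ℝ p q) X) :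
    HasFacesLE (X ∪ segment ℝ p q) (N + 1) := by
  classical
  obtain ⟨R, hR, hc⟩ := h
  obtain ⟨m, hm⟩ : (openSegment ℝ p q).Nonempty := ⟨p + (1 / 2 : ℝ) • (q - p),
    mem_openSegment_iff_exists.2 ⟨1 / 2, by norm_num, by norm_num, rfl⟩⟩
  obtain ⟨r₀, hr₀, hmr⟩ := hc m (disjoint_left.1 hd hm)
  obtain ⟨e, he, hor⟩ := PolyJoined.union_segment_or hX hpq hd hm
    (v := normal p q) (by rw [side_normal]; exact (along_self_pos hpq).ne')
  have hor := hor (e / 2) (by linarith) (by linarith)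
  set c := m + (e / 2) • normal p q
  set d := m - (e / 2) • normal p q
  -- The representative `r₀` of the face that contains the segment is replaced by one point on each
  -- side of it.
  obtain ⟨R', hR', hc'⟩ := exists_image (X := X) (X ∪ segment ℝ p q) (R.erase r₀)
  refine ⟨insert c (insert d R'), ?_, fun z hz => ?_⟩
  · have h1 := Finset.card_insert_le c (insert d R')
    have h2 := Finset.card_insert_le d R'
    have h3 := Finset.card_erase_add_one hr₀
    omega
  · by_cases hzm : PolyJoined Xᶜ z m
    · rcases hor z hz hzm with h | h
      · exact ⟨c, by simp, h⟩
      · exact ⟨d, by simp, h⟩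
    · obtain ⟨r, hr, hzr⟩ := hc z fun h => hz (.inl h)
      have hne : r ≠ r₀ := by
        rintro rfl
        exact hzm (hzr.trans hmr.symm)
      obtain ⟨r', hr', hrY, hzr'⟩ := hc' z hz r (Finset.mem_erase.2 ⟨hne, hr⟩) hzr
      refine ⟨r', by simp [hr'], ?_⟩
      rcases hzr'.avoid_or (segment ℝ p q) with h | ⟨g, hg, hgX, hzg⟩
      · exact h.mono (by rw [compl_union]; rfl)
      -- Both ends of the segment are in `X`, so a path that meets it outside `X` reaches `m` along
      -- the open segment.
      · refine absurd (hzg.trans (.of_convex (convex_openSegment p q)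
          (fun x hx => disjoint_left.1 hd hx) ?_ hm)) hzm
        exact mem_openSegment_of_ne_left_right (fun h => hgX (h ▸ hp)) (fun h => hgX (h ▸ hq)) hg

/-- Drawing an arc between two points of `X` yields at most one new face. -/
theorem union_carrier (h : HasFacesLE X N) (hX : IsClosed X) {A : List Plane} (hA : IsArc A)
    {u w : Plane} (hu : A.head? = some u) (hw : A.getLast? = some w) (huX : u ∈ X) (hwX : w ∈ X)
    (hd : ∀ x ∈ carrier A, x ∈ X → x = u ∨ x = w) : HasFacesLE (X ∪ carrier A) (N + 1) := by
  obtain ⟨hlen, hs⟩ := hA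
  match A, hlen with
  | p :: q :: l, _ =>
    obtain rfl : p = u := by simpa using hu
    obtain ⟨hpq, hi, hs⟩ := hs
    have hw' : (q :: l).getLast? = some w := by simpa using hw
    have hwl := mem_carrier_of_getLast? hw'
    have hpl : p ∉ carrier (q :: l) := fun h => hpq (by
      rw [← mem_singleton_iff, ← hi]; exact ⟨left_mem_segment ℝ p q, h⟩)
    -- All but the first segment is drawn first, hanging from `w`, and yields no face; only the
    -- closing segment can add one.
    rw [carrier_cons_cons, union_comm (segment ℝ p q), ← union_assoc]
    refine union_segment ?_ (hX.union (isClosed_carrier _)) hpq (.inl huX)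
      (.inr (head_mem_carrier _ _)) ?_
    · refine h.mono_set subset_union_left fun z hz y hy hzy => ?_
      refine hzy.union_carrier_of_getLast? hX hs hw' hwX ?_ hz hy
      rintro x ⟨hx, hx'⟩
      rcases hd x (.inr hx) hx' with rfl | rfl
      · exact absurd hx hpl
      · rfl
    · rw [disjoint_left]
      intro x hx hx'
      have hxs := openSegment_subset_segment ℝ p q hx
      have hxp : x ≠ p := by
        rintro rfl
        exact hpq (left_mem_openSegment_iff.1 hx)
      have hxq : x ∉ carrier (q :: l) := by
        intro h
        obtain rfl : x = q := by rw [← mem_singleton_iff, ← hi]; exact ⟨hxs, h⟩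
        exact hpq (right_mem_openSegment_iff.1 hx)
      rcases hx' with hx' | hx'
      · rcases hd x (.inl hxs) hx' with rfl | rfl
        · exact hxp rfl
        · exact hxq hwl
      · exact hxq hx'

/-- Drawing an arc with exactly one end in `X` yields no new face. -/
theorem union_carrier_of_leaf (h : HasFacesLE X N) (hX : IsClosed X) {A : List Plane}
    (hA : IsSimple A) {u : Plane} (hu : A.head? = some u ∨ A.getLast? = some u) (huX : u ∈ X)
    (hd : ∀ x ∈ carrier A, x ∈ X → x = u) : HasFacesLE (X ∪ carrier A) N := by
  refine h.mono_set subset_union_left fun z hz w hw hzw => ?_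
  rcases hu with hu | hu
  · cases A with
    | nil => simp at hu
    | cons a l =>
      obtain rfl : a = u := by simpa using hu
      exact hzw.union_carrier_of_head hX hA huX (fun x hx => hd x hx.1 hx.2) hz hw
  · exact hzw.union_carrier_of_getLast? hX hA hu huX (fun x hx => hd x hx.1 hx.2) hz hw

end HasFacesLE

/-! ### The graph of a drawing and its components -/

/-- The union of the given curves. -/
def carriers (L : List (List Plane)) : Set Plane := {x | ∃ A ∈ L, x ∈ carrier A}

theorem mem_carriers {L : List (List Plane)} {x : Plane} :
    x ∈ carriers L ↔ ∃ A ∈ L, x ∈ carrier A := Iff.rfl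

theorem isCompact_carriers (L : List (List Plane)) : IsCompact (carriers L) := by
  induction L with
  | nil => convert isCompact_empty; ext; simp [mem_carriers]
  | cons A L ih =>
    convert (isCompact_carrier A).union ih
    ext; simp [mem_carriers]

theorem carriers_cons (A : List Plane) (L : List (List Plane)) :
    carriers (A :: L) = carrier A ∪ carriers L := by ext; simp [mem_carriers]

theorem carrier_stub (s : Tip) : carrier s.stub = segment ℝ s.root s.free :=
  union_eq_self_of_subset_right (singleton_subset_iff.2 (right_mem_segment ℝ _ _))

namespace Drawing

/-- The points of the vertices and edges of a drawing. -/
def graph (D : Drawing) : Set Plane := {x | x ∈ D.vertices} ∪ carriers D.edges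

/-- Two vertices are the ends of an edge. -/
def Adj (D : Drawing) (u w : Plane) : Prop :=
  ∃ A ∈ D.edges, A.head? = some u ∧ A.getLast? = some w

/-- Two vertices are in the same component of the graph. -/
def Linked (D : Drawing) : Plane → Plane → Prop := Relation.EqvGen D.Adj

/-- The points of the component of a vertex. -/
def component (D : Drawing) (v : Plane) : Set Plane :=
  {x | ∃ w ∈ D.vertices, D.Linked v w ∧ (x = w ∨ ∃ A ∈ D.edges, A.head? = some w ∧ x ∈ carrier A)}

theorem isClosed_graph (D : Drawing) : IsClosed D.graph :=
  (List.finite_toSet D.vertices).isClosed.union (isCompact_carriers _).isClosed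

theorem isCompact_component (D : Drawing) (v : Plane) : IsCompact (D.component v) := by
  classical
  have h1 : {w | w ∈ D.vertices ∧ D.Linked v w}.Finite :=
    (List.finite_toSet D.vertices).subset fun x hx => hx.1
  have : D.component v = {w | w ∈ D.vertices ∧ D.Linked v w} ∪
      carriers (D.edges.filter fun A => ∃ w ∈ D.vertices, D.Linked v w ∧ A.head? = some w) := by
    ext x
    simp only [component, mem_union, mem_carriers, List.mem_filter, decide_eq_true_eq, mem_ofPred_eq]
    constructor
    · rintro ⟨w, hw, hvw, rfl | ⟨A, hA, hAw, hx⟩⟩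
      · exact .inl ⟨hw, hvw⟩
      · exact .inr ⟨A, ⟨hA, w, hw, hvw, hAw⟩, hx⟩
    · rintro (⟨hw, hvw⟩ | ⟨A, ⟨hA, w, hw, hvw, hAw⟩, hx⟩)
      · exact ⟨x, hw, hvw, .inl rfl⟩
      · exact ⟨w, hw, hvw, .inr ⟨A, hA, hAw, hx⟩⟩
  rw [this]
  exact h1.isCompact.union (isCompact_carriers _)

theorem Linked.refl {D : Drawing} (v : Plane) : D.Linked v v := Relation.EqvGen.refl v

theorem Linked.symm {D : Drawing} {u v : Plane} (h : D.Linked u v) : D.Linked v u :=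
  Relation.EqvGen.symm _ _ h

theorem Linked.trans {D : Drawing} {u v w : Plane} (h : D.Linked u v) (h' : D.Linked v w) :
    D.Linked u w := Relation.EqvGen.trans _ _ _ h h'

theorem Adj.linked {D : Drawing} {u v : Plane} (h : D.Adj u v) : D.Linked u v :=
  Relation.EqvGen.rel _ _ h

theorem Linked.polyJoined {D : Drawing} {u v : Plane} (h : D.Linked u v) :
    PolyJoined D.graph u v := by
  induction h with
  | rel u v h =>
    obtain ⟨A, hA, hu, hv⟩ := h
    exact (polyJoined_of_mem_carrier (mem_carrier_of_head? hu) (mem_carrier_of_getLast? hv)).mono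
      fun x hx => .inr ⟨A, hA, hx⟩
  | refl => exact .refl _
  | symm _ _ _ ih => exact ih.symm
  | trans _ _ _ _ _ ih ih' => exact ih.trans ih'

namespace IsPlane

variable {D : Drawing}

theorem pairwise_edges (hD : D.IsPlane) :
    D.edges.Pairwise fun A B => ∀ x ∈ carrier A ∩ carrier B, x ∈ D.vertices :=
  (List.pairwise_append.1 hD.noncrossing).1

theorem edge_stub (hD : D.IsPlane) {A : List Plane} (hA : A ∈ D.edges) {s : Tip} (hs : s ∈ D.tips) {x : Plane}
    (hx : x ∈ carrier A) (hx' : x ∈ segment ℝ s.root s.free) : x ∈ D.vertices :=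
  (List.pairwise_append.1 hD.noncrossing).2.2 A hA s.stub (List.mem_map_of_mem hs) x
    ⟨hx, by rwa [carrier_stub]⟩

theorem pairwise_tips (hD : D.IsPlane) : D.tips.Pairwise fun s t =>
    ∀ x ∈ carrier s.stub ∩ carrier t.stub, x ∈ D.vertices :=
  List.pairwise_map.1 (List.pairwise_append.1 hD.noncrossing).2.1

theorem root_mem (hD : D.IsPlane) {s : Tip} (hs : s ∈ D.tips) : s.root ∈ D.vertices := (hD.tip_ends s hs).1

theorem root_ne_free (hD : D.IsPlane) {s : Tip} (hs : s ∈ D.tips) : s.root ≠ s.free :=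
  (hD.isArc s.stub (List.mem_append_right _ (List.mem_map_of_mem hs))).2.1

theorem eq_root (hD : D.IsPlane) {s : Tip} (hs : s ∈ D.tips) {x : Plane} (hx : x ∈ D.vertices)
    (hx' : x ∈ segment ℝ s.root s.free) : x = s.root :=
  (hD.tip_ends s hs).2 x hx (by rwa [carrier_stub])

theorem eq_root_of_mem_graph (hD : D.IsPlane) {s : Tip} (hs : s ∈ D.tips) {x : Plane}
    (hx : x ∈ segment ℝ s.root s.free) (hxG : x ∈ D.graph) : x = s.root := by
  rcases hxG with hxG | ⟨A, hA, hxA⟩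
  · exact hD.eq_root hs hxG hx
  · exact hD.eq_root hs (hD.edge_stub hA hs hxA hx) hx

theorem free_notMem (hD : D.IsPlane) {s : Tip} (hs : s ∈ D.tips) : s.free ∉ D.graph := fun h =>
  hD.root_ne_free hs (hD.eq_root_of_mem_graph hs (right_mem_segment ℝ _ _) h).symm

theorem stub_inter (hD : D.IsPlane) {s t : Tip} (hs : s ∈ D.tips) (ht : t ∈ D.tips) (hst : s ≠ t) {x : Plane}
    (hx : x ∈ segment ℝ s.root s.free) (hx' : x ∈ segment ℝ t.root t.free) : x ∈ D.vertices := by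
  have : Std.Symm fun s t : Tip => ∀ x ∈ carrier s.stub ∩ carrier t.stub, x ∈ D.vertices :=
    ⟨fun a b h x hx => h x hx.symm⟩
  exact hD.pairwise_tips.forall hs ht hst x ⟨by rwa [carrier_stub], by rwa [carrier_stub]⟩

/-- A repeated arm would meet itself only in vertices by the pairwise clause, but its free end is no
vertex. -/
theorem tips_nodup (hD : D.IsPlane) : D.tips.Nodup := by
  refine List.Pairwise.imp_of_mem ?_ hD.pairwise_tips
  rintro s t hs - h rfl
  exact hD.free_notMem hs (.inl (h s.free ⟨mem_carrier_of_getLast? rfl, mem_carrier_of_getLast? rfl⟩))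

theorem mem_ends (hD : D.IsPlane) {A : List Plane} (hA : A ∈ D.edges) {u w x : Plane} (hu : A.head? = some u)
    (hw : A.getLast? = some w) (hx : x ∈ D.vertices) (hxA : x ∈ carrier A) : x = u ∨ x = w := by
  obtain ⟨u', -, w', -, hu', hw', h⟩ := hD.edge_ends A hA
  obtain rfl : u = u' := by simpa [hu] using hu'
  obtain rfl : w = w' := by simpa [hw] using hw'
  exact h x hx hxA

theorem linked_of_mem (hD : D.IsPlane) {A : List Plane} (hA : A ∈ D.edges) {u x : Plane} (hu : A.head? = some u)
    (hx : x ∈ D.vertices) (hxA : x ∈ carrier A) : D.Linked u x := by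
  obtain ⟨u', -, w, -, hu', hw, h⟩ := hD.edge_ends A hA
  obtain rfl : u = u' := by simpa [hu] using hu'
  rcases h x hx hxA with rfl | rfl
  · exact .refl _
  · exact Adj.linked ⟨A, hA, hu, hw⟩

theorem edges_inter (hD : D.IsPlane) {A B : List Plane} (hA : A ∈ D.edges) (hB : B ∈ D.edges) (hAB : A ≠ B)
    {x : Plane} (hx : x ∈ carrier A) (hx' : x ∈ carrier B) : x ∈ D.vertices := by
  have : Std.Symm fun A B : List Plane => ∀ x ∈ carrier A ∩ carrier B, x ∈ D.vertices :=
    ⟨fun a b h x hx => h x hx.symm⟩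
  exact hD.pairwise_edges.forall hA hB hAB x ⟨hx, hx'⟩

/-- Components are disjoint: a common point is a vertex, hence linked to both, or lies on a single
edge. -/
theorem linked_of_mem_component (hD : D.IsPlane) {v w x : Plane} (hv : x ∈ D.component v)
    (hw : x ∈ D.component w) : D.Linked v w := by
  have key : ∀ {v}, x ∈ D.component v → x ∈ D.vertices → D.Linked v x := by
    rintro v ⟨a, ha, hva, rfl | ⟨A, hA, hAa, hxA⟩⟩ hx
    · exact hva
    · exact hva.trans (hD.linked_of_mem hA hAa hx hxA)
  by_cases hx : x ∈ D.vertices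
  · exact (key hv hx).trans (key hw hx).symm
  obtain ⟨a, ha, hva, rfl | ⟨A, hA, hAa, hxA⟩⟩ := hv
  · exact absurd ha hx
  obtain ⟨b, hb, hwb, rfl | ⟨B, hB, hBb, hxB⟩⟩ := hw
  · exact absurd hb hx
  by_cases hAB : A = B
  · subst hAB
    obtain rfl : a = b := by simpa [hAa] using hBb
    exact hva.trans hwb.symm
  · exact absurd (hD.edges_inter hA hB hAB hxA hxB) hx

theorem exists_component (hD : D.IsPlane) {x : Plane} (hx : x ∈ D.graph) :
    ∃ v ∈ D.vertices, x ∈ D.component v := by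
  rcases hx with hx | ⟨A, hA, hxA⟩
  · exact ⟨x, hx, x, hx, .refl x, .inl rfl⟩
  · obtain ⟨u, hu, w, hw, hAu, hAw, h⟩ := hD.edge_ends A hA
    exact ⟨u, hu, u, hu, .refl u, .inr ⟨A, hA, hAu, hxA⟩⟩

theorem component_subset (v : Plane) : D.component v ⊆ D.graph := by
  rintro x ⟨w, hw, -, rfl | ⟨A, hA, -, hx⟩⟩
  · exact .inl hw
  · exact .inr ⟨A, hA, hx⟩

end IsPlane

end Drawing

/-! ### Reaching tips along components -/

namespace Drawing

/-- Tips are spread along the contours: whoever approaches a component of the graph can reach one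
of its open tips without leaving a given neighbourhood of this component. -/
def TipsReachable (D : Drawing) : Prop :=
  ∀ v ∈ D.vertices, ∀ O : Set Plane, IsOpen O → D.component v ⊆ O → ∀ x ∈ D.component v, ∀ z,
    z ∉ D.graph → segment ℝ x z ⊆ O → segment ℝ x z ∩ D.graph ⊆ {x} →
    ∃ s ∈ D.tips, D.Linked v s.root ∧ ∃ y ∈ segment ℝ s.root s.free, y ≠ s.root ∧
      segment ℝ s.root y ⊆ O ∧ PolyJoined (O \ D.graph) z y

end Drawing

/-! ### Euler's inequality, and connectedness of stuck positions -/

namespace Drawing.IsPlane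

variable {D : Drawing}

theorem pairwise_of_perm (hD : D.IsPlane) {L : List (List Plane)} (hL : L.Perm D.edges) :
    L.Pairwise fun A B => ∀ x ∈ carrier A ∩ carrier B, x ∈ D.vertices :=
  (hL.pairwise_iff (fun h x hx => h x hx.symm)).2 hD.pairwise_edges

/-- The faces of a subgraph that contains all vertices. -/
theorem hasFacesLE_add (hD : D.IsPlane) (B : List (List Plane)) : ∀ (A : List (List Plane)) (N : ℕ),
    (A ++ B).Perm D.edges → HasFacesLE ({x | x ∈ D.vertices} ∪ carriers A) N →
      HasFacesLE D.graph (N + B.length) := by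
  induction B with
  | nil =>
    intro A N hp h
    have : carriers A = carriers D.edges := by
      ext x
      rw [List.append_nil] at hp
      simp only [mem_carriers, hp.mem_iff]
    rwa [this] at h
  | cons e B ih =>
    intro A N hp h
    have hp' : (e :: A ++ B).Perm D.edges := List.perm_middle.symm.trans hp
    have he : e ∈ D.edges := hp.subset (by simp)
    obtain ⟨u, hu, w, hw, heu, hew, hends⟩ := hD.edge_ends e he
    have hpw := List.pairwise_cons.1 (hD.pairwise_of_perm hp')
    have := ih (e :: A) (N + 1) hp' ?_
    · rwa [List.length_cons, add_comm B.length, ← add_assoc]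
    rw [carriers_cons, union_comm (carrier e), ← union_assoc]
    refine h.union_carrier ((List.finite_toSet D.vertices).isClosed.union
      (isCompact_carriers A).isClosed) (hD.isArc e (List.mem_append_left _ he)) heu hew
      (.inl hu) (.inl hw) ?_
    rintro x hx (hx' | ⟨a, ha, hxa⟩)
    · exact hends x hx' hx
    · exact hends x (hpw.1 a (by simp [ha]) x ⟨hx, hxa⟩) hx

/-- The faces of a connected subgraph: a spanning tree is grown first. -/
theorem hasFacesLE_grow (hD : D.IsPlane) (hc : ∀ u ∈ D.vertices, ∀ w ∈ D.vertices, D.Linked u w) :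
    ∀ (k : ℕ) (H : Finset Plane) (A B : List (List Plane)), (A ++ B).Perm D.edges →
      (∀ e ∈ A, ∀ u, e.head? = some u ∨ e.getLast? = some u → u ∈ H) → H.Nonempty →
      (∀ v ∈ H, v ∈ D.vertices) → H.card + k = D.vertices.length → ∀ N,
      HasFacesLE (H ∪ carriers A) N →
      ∃ M, HasFacesLE D.graph M ∧ M + k = N + B.length := by
  classical
  -- `k` counts the vertices outside the tree with vertex set `H`. Each of them uses up one edge of
  -- `B` without adding a face; every other edge of `B` adds at most one.
  intro k
  induction k with
  | zero =>
    intro H A B hp hA _ hHV hcard N h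
    have hH : (H : Set Plane) = {x | x ∈ D.vertices} := by
      have : H = D.vertices.toFinset := Finset.eq_of_subset_of_card_le
        (fun v hv => List.mem_toFinset.2 (hHV v hv))
        (by rw [List.toFinset_card_of_nodup hD.nodup]; omega)
      ext x; simp [this]
    rw [hH] at h
    exact ⟨_, hD.hasFacesLE_add B A N hp h, rfl⟩
  | succ k ih =>
    intro H A B hp hA hne hHV hcard N h
    obtain ⟨v, hv, hvH⟩ : ∃ v ∈ D.vertices, v ∉ H := by
      by_contra! hcon
      have : D.vertices.toFinset ⊆ H := fun x hx => hcon x (List.mem_toFinset.1 hx)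
      have := Finset.card_le_card this
      rw [List.toFinset_card_of_nodup hD.nodup] at this
      omega
    obtain ⟨h0, hh0⟩ := hne
    -- If no edge left `H`, membership in `H` would be constant on components.
    obtain ⟨e, he, u, w, huw, huH, hwH⟩ : ∃ e ∈ D.edges, ∃ u w,
        (e.head? = some u ∧ e.getLast? = some w ∨ e.head? = some w ∧ e.getLast? = some u) ∧
        u ∈ H ∧ w ∉ H := by
      by_contra! hcon
      have : ∀ {a b}, D.Linked a b → (a ∈ H ↔ b ∈ H) := by
        intro a b hab
        induction hab with
        | rel a b hab =>
          obtain ⟨e, he, ha, hb⟩ := hab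
          exact ⟨fun h => hcon e he a b (.inl ⟨ha, hb⟩) h, fun h => hcon e he b a (.inr ⟨ha, hb⟩) h⟩
        | refl => rfl
        | symm _ _ _ ih => exact ih.symm
        | trans _ _ _ _ _ ih ih' => exact ih.trans ih'
      exact hvH ((this (hc h0 (hHV h0 hh0) v hv)).1 hh0)
    have heA : e ∉ A := fun h => hwH (hA e h w (huw.symm.imp And.left And.right))
    have heB : e ∈ B := (List.mem_append.1 (hp.symm.subset he)).resolve_left heA
    obtain ⟨B₁, B₂, rfl⟩ := List.append_of_mem heB
    have hp' : (e :: A ++ (B₁ ++ B₂)).Perm D.edges := by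
      refine List.Perm.trans ?_ hp
      rw [← List.append_assoc, ← List.append_assoc]
      exact List.perm_middle.symm
    obtain ⟨u', hu', w', hw', heu, hew, hends⟩ := hD.edge_ends e he
    have hends' : ∀ x ∈ D.vertices, x ∈ carrier e → x = u ∨ x = w := by
      intro x hx hxe
      rcases huw with ⟨h1, h2⟩ | ⟨h1, h2⟩
      · exact hD.mem_ends he h1 h2 hx hxe
      · exact (hD.mem_ends he h1 h2 hx hxe).symm
    have hwV : w ∈ D.vertices := by
      rcases huw with ⟨-, h2⟩ | ⟨h1, -⟩
      · rw [hew] at h2; exact Option.some.inj h2 ▸ hw'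
      · rw [heu] at h1; exact Option.some.inj h1 ▸ hu'
    have hwe : w ∈ carrier e := by
      rcases huw with ⟨-, h2⟩ | ⟨h1, -⟩
      · exact mem_carrier_of_getLast? h2
      · exact mem_carrier_of_head? h1
    have hpw := List.pairwise_cons.1 (hD.pairwise_of_perm hp')
    have hset : ((insert w H : Finset Plane) : Set Plane) ∪ carriers (e :: A) =
        (H : Set Plane) ∪ carriers A ∪ carrier e := by
      ext x
      simp only [carriers_cons, Finset.coe_insert, mem_union, mem_insert_iff]
      constructor
      · rintro ((rfl | h) | h | h) <;> tauto
      · tauto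
    suffices ∃ M, HasFacesLE D.graph M ∧ M + k = N + (B₁ ++ B₂).length by
      obtain ⟨M, hM, hMk⟩ := this
      refine ⟨M, hM, ?_⟩
      simp only [List.length_append, List.length_cons] at hMk ⊢
      omega
    refine ih (insert w H) (e :: A) (B₁ ++ B₂) hp' ?_ ⟨w, by simp⟩ ?_ ?_ N ?_
    · intro a ha x hx
      rcases List.mem_cons.1 ha with rfl | ha
      · have hxe : x ∈ carrier a := hx.elim mem_carrier_of_head? mem_carrier_of_getLast?
        have hxV : x ∈ D.vertices := by
          rcases hx with h1 | h1
          · rw [heu] at h1; exact Option.some.inj h1 ▸ hu'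
          · rw [hew] at h1; exact Option.some.inj h1 ▸ hw'
        rcases hends' x hxV hxe with rfl | rfl <;> simp [huH]
      · exact Finset.mem_insert_of_mem (hA a ha x hx)
    · intro x hx
      rcases Finset.mem_insert.1 hx with rfl | hx
      · exact hwV
      · exact hHV x hx
    · rw [Finset.card_insert_of_notMem hwH]; omega
    · rw [hset]
      refine h.union_carrier_of_leaf (H.finite_toSet.isClosed.union
        (isCompact_carriers A).isClosed) (hD.isArc e (List.mem_append_left _ he)).2 (u := u)
        (huw.imp And.left And.right) (.inl huH) ?_
      have hcase : ∀ x ∈ carrier e, x ∈ D.vertices → (x = w → False) → x = u :=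
        fun x hx hxV hxw => (hends' x hxV hx).resolve_right hxw
      rintro x hx (hxH | ⟨a, ha, hxa⟩)
      · exact hcase x hx (hHV x hxH) (by rintro rfl; exact hwH hxH)
      · have hxV := hpw.1 a (by simp [ha]) x ⟨hx, hxa⟩
        refine hcase x hx hxV ?_
        rintro rfl
        -- An edge already drawn has both ends in `H`, so it cannot pass through the new vertex.
        have haE : a ∈ D.edges := hp.subset (by simp [ha])
        obtain ⟨a1, -, a2, -, ha1, ha2, haends⟩ := hD.edge_ends a haE
        rcases haends x hxV hxa with rfl | rfl
        · exact hwH (hA a ha _ (.inl ha1))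
        · exact hwH (hA a ha _ (.inr ha2))

/-- Half of Euler's formula: a connected plane graph has at most `E - V + 2` faces. -/
theorem hasFacesLE_of_connected (hD : D.IsPlane) (hne : D.vertices ≠ [])
    (hc : ∀ u ∈ D.vertices, ∀ w ∈ D.vertices, D.Linked u w) :
    ∃ M, HasFacesLE D.graph M ∧ M + D.vertices.length = D.edges.length + 2 := by
  obtain ⟨v, hv⟩ := List.exists_mem_of_ne_nil _ hne
  have hlen := List.length_pos_of_mem hv
  have h := hD.hasFacesLE_grow hc (D.vertices.length - 1) {v} [] D.edges (by simp) (by simp)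
    (by simp) (by simpa using hv) (by simp; omega) 1 (by
      have : carriers [] = ∅ := by ext; simp [mem_carriers]
      rw [this, union_empty, Finset.coe_singleton]
      exact .singleton v)
  obtain ⟨M, hM, h⟩ := h
  exact ⟨M, hM, by omega⟩

/-- Tips that lie in different faces are not more than there are faces. -/
theorem length_tips_le (hD : D.IsPlane) {M : ℕ} (hM : HasFacesLE D.graph M)
    (h : ∀ s ∈ D.tips, ∀ t ∈ D.tips, PolyJoined D.graphᶜ s.free t.free → s = t) :
    D.tips.length ≤ M := by
  classical
  obtain ⟨R, hR, hc⟩ := hM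
  choose! f hf hf' using hc
  rw [← List.toFinset_card_of_nodup hD.tips_nodup]
  -- Each tip is sent to the representative of its face.
  refine (Finset.card_le_card_of_injOn (fun s => f s.free) ?_ ?_).trans hR
  · intro s hs
    exact hf _ (hD.free_notMem (List.mem_toFinset.1 hs))
  · intro s hs t ht hst
    have hs' := List.mem_toFinset.1 hs
    have ht' := List.mem_toFinset.1 ht
    refine h s hs' t ht' ((hf' _ (hD.free_notMem hs')).trans ?_)
    have := hf' _ (hD.free_notMem ht')
    simp only at hst
    rw [hst]
    exact this.symm

theorem polyJoined_free (hD : D.IsPlane) {s : Tip} (hs : s ∈ D.tips) {y : Plane}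
    (hy : y ∈ segment ℝ s.root s.free) (hys : y ≠ s.root) : PolyJoined D.graphᶜ y s.free :=
  (polyJoined_segment_diff_left (hD.root_ne_free hs) hy hys).mono
    fun _ hx hx' => hx.2 (hD.eq_root_of_mem_graph hs hx.1 hx')

/-- If different tips lie in different faces, then the graph is connected. -/
theorem connected_of_tipsReachable (hD : D.IsPlane) (hr : D.TipsReachable)
    (h : ∀ s ∈ D.tips, ∀ t ∈ D.tips, PolyJoined D.graphᶜ s.free t.free → s = t) :
    ∀ u ∈ D.vertices, ∀ w ∈ D.vertices, D.Linked u w := by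
  by_contra! hcon
  obtain ⟨u, hu, w, hw, huw⟩ := hcon
  set K := D.component u
  set M : Set Plane := ⋃ v ∈ {v | v ∈ D.vertices ∧ ¬ D.Linked u v}, D.component v
  have hKc : IsCompact K := D.isCompact_component u
  have hMc : IsCompact M := Set.Finite.isCompact_biUnion
    ((List.finite_toSet D.vertices).subset fun v hv => hv.1) fun v _ => D.isCompact_component v
  have hself : ∀ v ∈ D.vertices, v ∈ D.component v := fun v hv => ⟨v, hv, .refl v, .inl rfl⟩
  have hcover : ∀ x ∈ D.graph, x ∈ K ∨ x ∈ M := by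
    intro x hx
    obtain ⟨v, hv, hxv⟩ := hD.exists_component hx
    by_cases huv : D.Linked u v
    · obtain ⟨a, ha, hva, hx⟩ := hxv
      exact .inl ⟨a, ha, huv.trans hva, hx⟩
    · exact .inr (mem_biUnion (show v ∈ {v | v ∈ D.vertices ∧ ¬ D.Linked u v} from ⟨hv, huv⟩) hxv)
  have hmem : ∀ x ∈ M, ∃ v ∈ D.vertices, ¬ D.Linked u v ∧ x ∈ D.component v := by
    intro x hx
    obtain ⟨v, hv, hxv⟩ := mem_iUnion₂.1 hx
    exact ⟨v, hv.1, hv.2, hxv⟩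
  -- A closest pair between the component `K` and the union `M` of all others; any further graph
  -- point on the segment `x y` would give a smaller distance.
  obtain ⟨⟨x, y⟩, ⟨hx, hy⟩, hmin⟩ := (hKc.prod hMc).exists_isMinOn
    ⟨(u, w), hself u hu, mem_biUnion (show w ∈ {v | v ∈ D.vertices ∧ ¬ D.Linked u v} from ⟨hw, huw⟩)
      (hself w hw)⟩ (continuous_dist.continuousOn)
  have hmin' : ∀ a ∈ K, ∀ b ∈ M, dist x y ≤ dist a b := fun a ha b hb => isMinOn_iff.1 hmin (a, b) ⟨ha, hb⟩
  obtain ⟨v, hv, huv, hyv⟩ := hmem y hy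
  have hxy : x ≠ y := by
    rintro rfl
    exact huv (hD.linked_of_mem_component hx hyv)
  have hd : 0 < dist x y := dist_pos.2 hxy
  have hseg : ∀ z ∈ segment ℝ x y, z ∈ D.graph → z = x ∨ z = y := by
    intro z hz hzG
    have hsum := dist_add_dist_of_mem_segment hz
    rcases hcover z hzG with h | h
    · have := hmin' z h y hy
      exact .inl (dist_le_zero.1 (by linarith : dist x z ≤ 0)).symm
    · have := hmin' x hx z h
      exact .inr (dist_le_zero.1 (by linarith : dist z y ≤ 0))
  set z : Plane := x + (1 / 2 : ℝ) • (y - x)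
  have hz : z ∈ openSegment ℝ x y :=
    mem_openSegment_iff_exists.2 ⟨1 / 2, by norm_num, by norm_num, rfl⟩
  have hzs := openSegment_subset_segment ℝ x y hz
  have hzx : z ≠ x := by
    intro e; rw [e] at hz; exact hxy (left_mem_openSegment_iff.1 hz)
  have hzy : z ≠ y := by
    intro e; rw [e] at hz; exact hxy (right_mem_openSegment_iff.1 hz)
  have hzG : z ∉ D.graph := fun h => (hseg z hzs h).elim hzx hzy
  -- For this use no confinement is needed, so the neighbourhood is the whole plane.
  have key : ∀ v ∈ D.vertices, ∀ a ∈ D.component v, segment ℝ a z ∩ D.graph ⊆ {a} →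
      ∃ s ∈ D.tips, D.Linked v s.root ∧ PolyJoined D.graphᶜ z s.free := by
    intro v hv a ha hai
    obtain ⟨s, hs, hvs, b, hb, hbs, -, hzb⟩ := hr v hv univ isOpen_univ (subset_univ _) a ha z hzG
      (subset_univ _) hai
    exact ⟨s, hs, hvs, (hzb.mono fun x hx => hx.2).trans (hD.polyJoined_free hs hb hbs)⟩
  have hsub : ∀ a ∈ segment ℝ x y, segment ℝ a z ⊆ segment ℝ x y := fun a ha =>
    (convex_segment x y).segment_subset ha hzs
  obtain ⟨s, hs, hus, hzs'⟩ := key u hu x hx (by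
    rintro a ⟨ha, haG⟩
    rcases hseg a (hsub x (left_mem_segment ℝ x y) ha) haG with rfl | rfl
    · rfl
    · exact absurd (dist_add_dist_of_mem_segment ha) (by
        have h1 := dist_add_dist_of_mem_segment hzs
        have h2 := dist_pos.2 hzy
        rw [dist_comm a z]
        linarith))
  obtain ⟨t, ht, hvt, hzt⟩ := key v hv y hyv (by
    rintro a ⟨ha, haG⟩
    rcases hseg a (hsub y (right_mem_segment ℝ x y) ha) haG with rfl | rfl
    · exact absurd (dist_add_dist_of_mem_segment ha) (by
        have h1 := dist_add_dist_of_mem_segment hzs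
        have h2 := dist_pos.2 hzx
        rw [dist_comm y a, dist_comm y z]
        rw [dist_comm z a] at h2
        linarith)
    · rfl)
  -- Both tips share the face of the midpoint, so they coincide, and the common root links the two
  -- components.
  obtain rfl := h s hs t ht (hzs'.symm.trans hzt)
  exact huv (hus.trans hvt.symm)

end Drawing.IsPlane

/-! ### Counting faces and components -/

/-- The number of classes of an equivalence relation that meet a set. -/
noncomputable def numClasses {α : Type*} (r : Setoid α) (A : Set α) : ℕ :=
  (Quotient.mk r '' A).ncard

section numClasses

variable {α : Type*} {r r' : Setoid α} {A A' : Set α}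

theorem numClasses_le_ncard (r : Setoid α) (hA : A.Finite) : numClasses r A ≤ A.ncard :=
  ncard_image_le hA

theorem numClasses_pos (r : Setoid α) (hA : A.Finite) (hne : A.Nonempty) : 0 < numClasses r A :=
  (ncard_pos (hA.image _)).2 (hne.image _)

/-- Since `r` refines `r'`, each `r'`-class meeting `A` is the image of an `r`-class meeting `A'`.
This surjection yields both comparisons of class numbers. -/
theorem image_map_subset (hr : ∀ a b, r a b → r' a b) (hA : ∀ a ∈ A, ∃ b ∈ A', r' a b) :
    Quotient.mk r' '' A ⊆ Quotient.map' (s₁ := r) (s₂ := r') id hr '' (Quotient.mk r '' A') := by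
  rintro _ ⟨a, ha, rfl⟩
  obtain ⟨b, hb, hab⟩ := hA a ha
  exact ⟨_, ⟨b, hb, rfl⟩, (Quotient.sound hab).symm⟩

theorem numClasses_le (hr : ∀ a b, r a b → r' a b) (hA' : A'.Finite)
    (hA : ∀ a ∈ A, ∃ b ∈ A', r' a b) : numClasses r' A ≤ numClasses r A' :=
  (ncard_le_ncard (image_map_subset hr hA) ((hA'.image _).image _)).trans
    (ncard_image_le (hA'.image _))

/-- The classes of `c` and `d` have the same image, so the surjection survives the removal of the
class of `d`. -/
theorem numClasses_lt (hr : ∀ a b, r a b → r' a b) (hA' : A'.Finite)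
    (hA : ∀ a ∈ A, ∃ b ∈ A', r' a b) {c d : α} (hc : c ∈ A') (hd : d ∈ A') (hcd : r' c d)
    (hcd' : ¬ r c d) : numClasses r' A + 1 ≤ numClasses r A' := by
  have hd' : Quotient.mk r d ∈ Quotient.mk r '' A' := ⟨d, hd, rfl⟩
  have hfin := hA'.image (Quotient.mk r)
  rw [numClasses, numClasses, ← ncard_sdiff_singleton_add_one hd' hfin]
  refine Nat.add_le_add_right ((ncard_le_ncard ?_ (hfin.sdiff.image _)).trans
    (ncard_image_le (f := Quotient.map' (s₁ := r) (s₂ := r') id hr) hfin.sdiff)) 1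
  intro x hx
  obtain ⟨y, hy, rfl⟩ := image_map_subset hr hA hx
  by_cases hyd : y = Quotient.mk r d
  · refine ⟨Quotient.mk r c, ⟨⟨c, hc, rfl⟩, fun h => hcd' (Quotient.exact h)⟩, ?_⟩
    rw [hyd]
    exact Quotient.sound hcd
  · exact ⟨y, ⟨hy, hyd⟩, rfl⟩

end numClasses

namespace Drawing

/-- Being in the same face of the graph of a drawing. -/
def faceSetoid (D : Drawing) : Setoid Plane :=
  ⟨PolyJoined D.graphᶜ, .refl, .symm, .trans⟩

/-- Being in the same component of the graph of a drawing. -/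
def linkedSetoid (D : Drawing) : Setoid Plane :=
  ⟨D.Linked, .refl, .symm, .trans⟩

/-- The number of faces that contain open tips. -/
noncomputable def numFaces (D : Drawing) : ℕ :=
  numClasses D.faceSetoid (Tip.free '' {s | s ∈ D.tips})

/-- The number of components of the graph. -/
noncomputable def numComponents (D : Drawing) : ℕ :=
  numClasses D.linkedSetoid {v | v ∈ D.vertices}

theorem finite_frees (D : Drawing) : (Tip.free '' {s | s ∈ D.tips}).Finite :=
  (List.finite_toSet D.tips).image _

theorem numFaces_le (D : Drawing) : D.numFaces ≤ D.tips.length := by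
  classical
  refine (numClasses_le_ncard _ D.finite_frees).trans
    ((ncard_image_le (List.finite_toSet D.tips)).trans ?_)
  rw [← List.coe_toFinset, ncard_coe_finset]
  exact List.toFinset_card_le _

theorem numComponents_le (D : Drawing) : D.numComponents ≤ D.vertices.length := by
  classical
  refine (numClasses_le_ncard _ (List.finite_toSet D.vertices)).trans ?_
  rw [← List.coe_toFinset, ncard_coe_finset]
  exact List.toFinset_card_le _

theorem numFaces_pos {D : Drawing} (h : D.tips ≠ []) : 0 < D.numFaces := by
  obtain ⟨s, hs⟩ := List.exists_mem_of_ne_nil _ h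
  exact numClasses_pos _ D.finite_frees ⟨_, s, hs, rfl⟩

theorem numComponents_pos {D : Drawing} (h : D.vertices ≠ []) : 0 < D.numComponents := by
  obtain ⟨v, hv⟩ := List.exists_mem_of_ne_nil _ h
  exact numClasses_pos _ (List.finite_toSet D.vertices) ⟨v, hv⟩

end Drawing

/-! ### The effect of a move -/

/-- The parts of a valid move. -/
structure MoveData (D D' : Drawing) (s t : Tip) (rest : List Tip) (l₁ l₂ : List Plane)
    (p q m c d : Plane) : Prop where
  perm : D.tips.Perm (s :: t :: rest)
  head : (l₁ ++ p :: q :: l₂).head? = some s.free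
  last : (l₁ ++ p :: q :: l₂).getLast? = some t.free
  mem_openSegment : m ∈ openSegment ℝ p q
  mem_crossbar : m ∈ openSegment ℝ c d
  vertices : D'.vertices = m :: D.vertices
  edges : D'.edges = (s.root :: (l₁ ++ [p, m])) :: (m :: q :: (l₂ ++ [t.root])) :: D.edges
  tips : D'.tips = Tip.mk m c :: Tip.mk m d :: rest
  isPlane : D'.IsPlane

theorem IsMove.exists_moveData {D D' : Drawing} (h : IsMove D D') :
    ∃ s t rest l₁ l₂ p q m c d, MoveData D D' s t rest l₁ l₂ p q m c d := by
  obtain ⟨s, t, rest, l₁, l₂, p, q, m, c, d, h1, h2, h3, h4, h5, h6, h7, h8, h9⟩ := h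
  exact ⟨s, t, rest, l₁, l₂, p, q, m, c, d, h1, h2, h3, h4, h5, h6, h7, h8, h9⟩

namespace Chord

/-- Treating the outside of `O` as part of the obstacle turns statements about faces into statements
about paths that stay in `O`. -/
theorem union_compl {X : Set Plane} {s t : Plane} {l₁ l₂ : List Plane} {p q m c d : Plane}
    (h : Chord X s t l₁ l₂ p q m c d) {O : Set Plane} (hO : IsOpen O)
    (hsub : points s t l₁ l₂ p q m ⊆ O) : Chord (X ∪ Oᶜ) s t l₁ l₂ p q m c d where
  closed := h.closed.union hO.isClosed_compl
  left_mem := .inl h.left_mem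
  right_mem := .inl h.right_mem
  simple₁ := h.simple₁
  simple₂ := h.simple₂
  mem_openSegment := h.mem_openSegment
  mem_crossbar := h.mem_crossbar
  inter₁ x hx hx' := hx'.elim (h.inter₁ x hx) fun h' => absurd (hsub (.inl hx)) h'
  inter₂ x hx hx' := hx'.elim (h.inter₂ x hx) fun h' => absurd (hsub (.inr hx)) h'
  notMem hm := hm.elim h.notMem fun h' => h' (hsub (.inr (head_mem_carrier _ _)))
  inter := h.inter
  ne_left := h.ne_left
  ne_right := h.ne_right
  stub_left := h.stub_left
  stub_right := h.stub_right

end Chord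

namespace MoveData

variable {D D' : Drawing} {s t : Tip} {rest : List Tip} {l₁ l₂ : List Plane} {p q m c d : Plane}

theorem s_mem (h : MoveData D D' s t rest l₁ l₂ p q m c d) : s ∈ D.tips :=
  h.perm.symm.subset (by simp)

theorem t_mem (h : MoveData D D' s t rest l₁ l₂ p q m c d) : t ∈ D.tips :=
  h.perm.symm.subset (by simp)

theorem edge₁_mem (h : MoveData D D' s t rest l₁ l₂ p q m c d) :
    s.root :: (l₁ ++ [p, m]) ∈ D'.edges := by rw [h.edges]; simp

theorem edge₂_mem (h : MoveData D D' s t rest l₁ l₂ p q m c d) :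
    m :: q :: (l₂ ++ [t.root]) ∈ D'.edges := by rw [h.edges]; simp

theorem edge_mem (h : MoveData D D' s t rest l₁ l₂ p q m c d) {A : List Plane}
    (hA : A ∈ D.edges) : A ∈ D'.edges := by rw [h.edges]; simp [hA]

theorem vertex_mem (h : MoveData D D' s t rest l₁ l₂ p q m c d) {v : Plane}
    (hv : v ∈ D.vertices) : v ∈ D'.vertices := by rw [h.vertices]; simp [hv]

theorem m_mem (h : MoveData D D' s t rest l₁ l₂ p q m c d) : m ∈ D'.vertices := by
  rw [h.vertices]; simp

theorem m_notMem (h : MoveData D D' s t rest l₁ l₂ p q m c d) : m ∉ D.vertices := by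
  have := h.isPlane.nodup
  rw [h.vertices, List.nodup_cons] at this
  exact this.1

theorem getLast?_edge₁ (s m : Plane) (l₁ : List Plane) (p : Plane) :
    (s :: (l₁ ++ [p, m])).getLast? = some m := by
  rw [← List.cons_append, List.append_cons]; exact List.getLast?_concat

theorem getLast?_edge₂ (t m : Plane) (l₂ : List Plane) (q : Plane) :
    (m :: q :: (l₂ ++ [t])).getLast? = some t := by
  rw [← List.cons_append, ← List.cons_append]; exact List.getLast?_concat

theorem m_notMem_edge (hD : D.IsPlane) (h : MoveData D D' s t rest l₁ l₂ p q m c d)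
    {A : List Plane} (hA : A ∈ D.edges) : m ∉ carrier A := by
  intro hm
  obtain ⟨u, hu, w, hw, hAu, hAw, -⟩ := hD.edge_ends A hA
  rcases h.isPlane.mem_ends (h.edge_mem hA) hAu hAw h.m_mem hm with rfl | rfl
  · exact h.m_notMem hu
  · exact h.m_notMem hw

theorem edges_pairwise (h : MoveData D D' s t rest l₁ l₂ p q m c d) :
    (∀ x ∈ carrier (s.root :: (l₁ ++ [p, m])), x ∈ carrier (m :: q :: (l₂ ++ [t.root])) →
      x ∈ D'.vertices) ∧
    (∀ A ∈ D.edges, ∀ x ∈ carrier (s.root :: (l₁ ++ [p, m])), x ∈ carrier A → x ∈ D'.vertices) ∧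
    ∀ A ∈ D.edges, ∀ x ∈ carrier (m :: q :: (l₂ ++ [t.root])), x ∈ carrier A →
      x ∈ D'.vertices := by
  have := h.isPlane.pairwise_edges
  rw [h.edges, List.pairwise_cons, List.pairwise_cons] at this
  obtain ⟨h1, h2, -⟩ := this
  exact ⟨fun x hx hx' => h1 _ (by simp) x ⟨hx, hx'⟩,
    fun A hA x hx hx' => h1 A (by simp [hA]) x ⟨hx, hx'⟩, fun A hA x hx hx' => h2 A hA x ⟨hx, hx'⟩⟩

theorem left_tip_mem (h : MoveData D D' s t rest l₁ l₂ p q m c d) : Tip.mk m c ∈ D'.tips := by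
  rw [h.tips]; simp

theorem right_tip_mem (h : MoveData D D' s t rest l₁ l₂ p q m c d) : Tip.mk m d ∈ D'.tips := by
  rw [h.tips]; simp

theorem graph_eq (h : MoveData D D' s t rest l₁ l₂ p q m c d) :
    D'.graph = D.graph ∪ Chord.points s.root t.root l₁ l₂ p q m := by
  ext x
  simp only [Drawing.graph, h.vertices, h.edges, carriers_cons, Chord.points, mem_union,
    mem_ofPred_eq, List.mem_cons]
  constructor
  · rintro ((rfl | h) | h | h | h)
    · exact .inr (.inr (head_mem_carrier _ _))
    all_goals tauto
  · tauto

theorem graph_subset (h : MoveData D D' s t rest l₁ l₂ p q m c d) : D.graph ⊆ D'.graph := by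
  rw [h.graph_eq]; exact subset_union_left

theorem points_subset (h : MoveData D D' s t rest l₁ l₂ p q m c d) :
    Chord.points s.root t.root l₁ l₂ p q m ⊆ D'.graph := by
  rw [h.graph_eq]; exact subset_union_right

theorem chord (hD : D.IsPlane) (h : MoveData D D' s t rest l₁ l₂ p q m c d) :
    Chord D.graph s.root t.root l₁ l₂ p q m c d where
  closed := D.isClosed_graph
  left_mem := .inl (hD.root_mem h.s_mem)
  right_mem := .inl (hD.root_mem h.t_mem)
  simple₁ := (h.isPlane.isArc _ (List.mem_append_left _ h.edge₁_mem)).2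
  simple₂ := (h.isPlane.isArc _ (List.mem_append_left _ h.edge₂_mem)).2
  mem_openSegment := h.mem_openSegment
  mem_crossbar := h.mem_crossbar
  inter₁ := by
    have key : ∀ x ∈ carrier (s.root :: (l₁ ++ [p, m])), x ∈ D'.vertices → x ≠ m → x = s.root :=
      fun x hx hxV hxm => (h.isPlane.mem_ends h.edge₁_mem rfl (getLast?_edge₁ _ _ _ _)
        hxV hx).resolve_right hxm
    rintro x hx (hxV | ⟨A, hA, hxA⟩)
    · exact key x hx (h.vertex_mem hxV) (by rintro rfl; exact h.m_notMem hxV)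
    · exact key x hx (h.edges_pairwise.2.1 A hA x hx hxA)
        (by rintro rfl; exact h.m_notMem_edge hD hA hxA)
  inter₂ := by
    have key : ∀ x ∈ carrier (m :: q :: (l₂ ++ [t.root])), x ∈ D'.vertices → x ≠ m → x = t.root :=
      fun x hx hxV hxm => (h.isPlane.mem_ends h.edge₂_mem rfl (getLast?_edge₂ _ _ _ _)
        hxV hx).resolve_left hxm
    rintro x hx (hxV | ⟨A, hA, hxA⟩)
    · exact key x hx (h.vertex_mem hxV) (by rintro rfl; exact h.m_notMem hxV)
    · exact key x hx (h.edges_pairwise.2.2 A hA x hx hxA)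
        (by rintro rfl; exact h.m_notMem_edge hD hA hxA)
  notMem hm := by
    rcases hm with hm | ⟨A, hA, hm⟩
    · exact h.m_notMem hm
    · exact h.m_notMem_edge hD hA hm
  inter x hx hx' := by
    have hxV := h.edges_pairwise.1 x hx hx'
    have h1 := h.isPlane.mem_ends h.edge₁_mem rfl (getLast?_edge₁ _ _ _ _) hxV hx
    have h2 := h.isPlane.mem_ends h.edge₂_mem rfl (getLast?_edge₂ _ _ _ _) hxV hx'
    tauto
  ne_left := h.isPlane.root_ne_free h.left_tip_mem
  ne_right := h.isPlane.root_ne_free h.right_tip_mem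
  stub_left x hx hx' := h.isPlane.eq_root_of_mem_graph h.left_tip_mem hx (h.points_subset hx')
  stub_right x hx hx' := h.isPlane.eq_root_of_mem_graph h.right_tip_mem hx (h.points_subset hx')

theorem stub_subset_left (h : MoveData D D' s t rest l₁ l₂ p q m c d) :
    segment ℝ s.root s.free ⊆ Chord.points s.root t.root l₁ l₂ p q m := by
  refine fun x hx => .inl ?_
  have := h.head
  cases l₁ with
  | nil =>
    obtain rfl : p = s.free := by simpa using this
    exact .inl hx
  | cons a l =>
    obtain rfl : a = s.free := by simpa using this
    exact .inl hx

theorem stub_subset_right (h : MoveData D D' s t rest l₁ l₂ p q m c d) :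
    segment ℝ t.root t.free ⊆ Chord.points s.root t.root l₁ l₂ p q m := by
  refine fun x hx => .inr ?_
  rw [segment_symm] at hx
  have hlast := h.last
  rw [List.getLast?_append_of_ne_nil _ (by simp), List.getLast?_cons_cons] at hlast
  obtain ⟨l, hl⟩ := List.getLast?_eq_some_iff.1 hlast
  have : m :: q :: (l₂ ++ [t.root]) = (m :: l) ++ t.free :: [t.root] := by
    rw [show q :: (l₂ ++ [t.root]) = (q :: l₂) ++ [t.root] from rfl, hl]; simp
  rw [this, carrier_append]
  exact .inr (.inl hx)

theorem linked_mono (h : MoveData D D' s t rest l₁ l₂ p q m c d) {u w : Plane}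
    (huw : D.Linked u w) : D'.Linked u w :=
  Relation.EqvGen.mono (fun _ _ hA => hA.imp fun _ hA => ⟨h.edge_mem hA.1, hA.2⟩) u w huw

theorem linked_left (h : MoveData D D' s t rest l₁ l₂ p q m c d) : D'.Linked m s.root :=
  (Drawing.Adj.linked ⟨_, h.edge₁_mem, rfl, getLast?_edge₁ _ _ _ _⟩).symm

theorem linked_right (h : MoveData D D' s t rest l₁ l₂ p q m c d) : D'.Linked m t.root :=
  Drawing.Adj.linked ⟨_, h.edge₂_mem, rfl, getLast?_edge₂ _ _ _ _⟩

theorem component_subset (h : MoveData D D' s t rest l₁ l₂ p q m c d) (v : Plane) :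
    D.component v ⊆ D'.component v := by
  rintro x ⟨w, hw, hvw, hx⟩
  exact ⟨w, h.vertex_mem hw, h.linked_mono hvw,
    hx.imp_right fun ⟨A, hA, hA'⟩ => ⟨A, h.edge_mem hA, hA'⟩⟩

theorem points_subset_component (hD : D.IsPlane) (h : MoveData D D' s t rest l₁ l₂ p q m c d) :
    Chord.points s.root t.root l₁ l₂ p q m ⊆ D'.component m := by
  rintro x (hx | hx)
  · exact ⟨s.root, h.vertex_mem (hD.root_mem h.s_mem), h.linked_left,
      .inr ⟨_, h.edge₁_mem, rfl, hx⟩⟩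
  · exact ⟨m, h.m_mem, .refl m, .inr ⟨_, h.edge₂_mem, rfl, hx⟩⟩

/-- The new vertex is linked to `s.root`, so every new component contains an old vertex; if `s.root`
and `t.root` were not linked, they are now. -/
theorem numComponents_le (hD : D.IsPlane) (h : MoveData D D' s t rest l₁ l₂ p q m c d) :
    D'.numComponents ≤ D.numComponents ∧
      (¬ D.Linked s.root t.root → D'.numComponents + 1 ≤ D.numComponents) := by
  have hs := hD.root_mem h.s_mem
  have ht := hD.root_mem h.t_mem
  have hcov : ∀ a ∈ {v | v ∈ D'.vertices}, ∃ b ∈ {v | v ∈ D.vertices}, D'.linkedSetoid a b := by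
    intro a ha
    rw [mem_ofPred_eq, h.vertices, List.mem_cons] at ha
    rcases ha with rfl | ha
    · exact ⟨s.root, hs, h.linked_left⟩
    · exact ⟨a, ha, Drawing.Linked.refl a⟩
  exact ⟨numClasses_le (fun _ _ => h.linked_mono) (List.finite_toSet _) hcov,
    fun hst => numClasses_lt (fun _ _ => h.linked_mono) (List.finite_toSet _) hcov hs ht
      (h.linked_left.symm.trans h.linked_right) hst⟩

/-- New faces refine old ones, and no old face with a tip loses all its tips: the ends of `s` and
`t` reach the crossbar along the new curve. If the roots are linked, the crossbar ends share an old
face but are separated by the new curve. -/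
theorem numFaces_le (hD : D.IsPlane) (h : MoveData D D' s t rest l₁ l₂ p q m c d) :
    D.numFaces ≤ D'.numFaces ∧ (D.Linked s.root t.root → D.numFaces + 1 ≤ D'.numFaces) := by
  have hch := h.chord hD
  have hmono : ∀ a b, D'.faceSetoid a b → D.faceSetoid a b := fun a b hab =>
    PolyJoined.mono (compl_subset_compl.2 h.graph_subset) hab
  have hcx : ∀ {e}, Tip.mk m e ∈ D'.tips → segment ℝ m e ⊆ D.graphᶜ := by
    intro e he x hx hxG
    obtain rfl := h.isPlane.eq_root_of_mem_graph he hx (h.graph_subset hxG)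
    exact hch.notMem hxG
  have hc : PolyJoined D.graphᶜ m c := .of_segment (hcx h.left_tip_mem)
  have hd : PolyJoined D.graphᶜ m d := .of_segment (hcx h.right_tip_mem)
  have hfree : ∀ {g}, g ∈ Chord.points s.root t.root l₁ l₂ p q m → g ∉ D.graph →
      PolyJoined D.graphᶜ g c := fun hg hg' =>
    ((hch.polyJoined_m hg hg').mono fun x hx => hx.2).trans hc
  have hcov : ∀ a ∈ Tip.free '' {s | s ∈ D.tips}, ∃ b ∈ Tip.free '' {s | s ∈ D'.tips},
      D.faceSetoid a b := by
    rintro _ ⟨u, hu, rfl⟩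
    have hu' := h.perm.subset hu
    rw [List.mem_cons, List.mem_cons] at hu'
    rcases hu' with rfl | rfl | hu'
    · exact ⟨c, ⟨_, h.left_tip_mem, rfl⟩,
        hfree (h.stub_subset_left (right_mem_segment ℝ _ _)) (hD.free_notMem hu)⟩
    · exact ⟨c, ⟨_, h.left_tip_mem, rfl⟩,
        hfree (h.stub_subset_right (right_mem_segment ℝ _ _)) (hD.free_notMem hu)⟩
    · exact ⟨u.free, ⟨u, by rw [mem_ofPred_eq, h.tips]; simp [hu'], rfl⟩, PolyJoined.refl _⟩
  refine ⟨numClasses_le hmono D'.finite_frees hcov, fun hst =>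
    numClasses_lt hmono D'.finite_frees hcov ⟨_, h.left_tip_mem, rfl⟩ ⟨_, h.right_tip_mem, rfl⟩
      (hc.symm.trans hd) ?_⟩
  have := hch.not_polyJoined hst.polyJoined (disjoint_left.2 fun x hx => hcx h.left_tip_mem hx)
    (disjoint_left.2 fun x hx => hcx h.right_tip_mem hx)
  rwa [← h.graph_eq] at this

/-- If the new curve belongs to the component, any approach that meets it, or that used a consumed
tip, is diverted to one end of a short crossbar. If not, the old property is applied in `O` with the
curve removed; this is why arbitrary neighbourhoods are quantified over. -/
theorem tipsReachable (hD : D.IsPlane) (h : MoveData D D' s t rest l₁ l₂ p q m c d)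
    (hr : D.TipsReachable) : D'.TipsReachable := by
  intro v hv O hO hvO x hx z hz hxz hxzG
  have hD' := h.isPlane
  have hzO : z ∈ O := hxz (right_mem_segment ℝ x z)
  have hcl := Chord.isClosed_points s.root t.root l₁ l₂ p q m
  -- a point that could be joined to the new curve is joined to a new tip
  have chord_case : D'.Linked v m → ∀ g ∈ Chord.points s.root t.root l₁ l₂ p q m, g ∉ D.graph →
      PolyJoined (O \ D.graph) z g → ∃ s ∈ D'.tips, D'.Linked v s.root ∧
        ∃ y ∈ segment ℝ s.root s.free, y ≠ s.root ∧
          segment ℝ s.root y ⊆ O ∧ PolyJoined (O \ D'.graph) z y := by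
    intro hvm g hg hgG hzg
    have hsub : Chord.points s.root t.root l₁ l₂ p q m ⊆ O := by
      refine (h.points_subset_component hD).trans (Subset.trans ?_ hvO)
      rintro y ⟨w, hw, hmw, hy⟩
      exact ⟨w, hw, hvm.trans hmw, hy⟩
    -- Adding `Oᶜ` to the obstacle keeps the diverted path inside `O`.
    have hch := (h.chord hD).union_compl hO hsub
    have hset : ∀ {S : Set Plane}, (D.graph ∪ Oᶜ ∪ S)ᶜ = O \ (D.graph ∪ S) := by
      intro S; ext y; simp only [mem_compl_iff, mem_union, mem_sdiff]; tauto
    have hset' : (D.graph ∪ Oᶜ)ᶜ = O \ D.graph := by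
      ext y; simp only [mem_compl_iff, mem_union, mem_sdiff]; tauto
    obtain ⟨c', d', ⟨hc1, hc2, hc3⟩, ⟨hd1, hd2, hd3⟩, hor⟩ :=
      hch.polyJoined_or (hO.mem_nhds (hsub (.inr (head_mem_carrier _ _))))
    have hor := hor z (by
      rw [← mem_compl_iff, hset, ← h.graph_eq]; exact ⟨hzO, hz⟩) g hg
      (fun h' => h'.elim hgG fun h' => h' (hsub hg)) (by rwa [hset'])
    rw [hset, ← h.graph_eq] at hor
    rcases hor with hj | hj
    · exact ⟨_, h.left_tip_mem, hvm, c', hc1, hc2, hc3, hj⟩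
    · exact ⟨_, h.right_tip_mem, hvm, d', hd1, hd2, hd3, hj⟩
  by_cases hxG : x ∈ D.graph
  · obtain ⟨v', hv', hxv'⟩ := hD.exists_component hxG
    have hvv' : D'.Linked v v' :=
      hD'.linked_of_mem_component hx (h.component_subset v' hxv')
    have hv'O : D.component v' ⊆ D'.component v := by
      refine (h.component_subset v').trans ?_
      rintro y ⟨w, hw, hmw, hy⟩
      exact ⟨w, hw, hvv'.trans hmw, hy⟩
    have hzG : z ∉ D.graph := fun h' => hz (h.graph_subset h')
    have hxzG' : segment ℝ x z ∩ D.graph ⊆ {x} :=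
      (inter_subset_inter_right _ h.graph_subset).trans hxzG
    have hrest : ∀ u ∈ D.tips, u ≠ s → u ≠ t → u ∈ D'.tips := by
      intro u hu hus hut
      have := h.perm.subset hu
      rw [h.tips]
      simp only [List.mem_cons] at this ⊢
      tauto
    by_cases hvm : D'.Linked v m
    · obtain ⟨u, hu, hv'u, y, hy, hyu, hyO, hzy⟩ :=
        hr v' hv' O hO (hv'O.trans hvO) x hxv' z hzG hxz hxzG'
      rcases hzy.avoid_or (Chord.points s.root t.root l₁ l₂ p q m) with hzy' | ⟨g, hg, hg', hzg⟩
      · have hyG : y ∉ D.graph := fun h' => hyu (hD.eq_root_of_mem_graph hu hy h')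
        by_cases hus : u = s
        · subst hus
          exact chord_case hvm y (h.stub_subset_left hy) hyG hzy
        by_cases hut : u = t
        · subst hut
          exact chord_case hvm y (h.stub_subset_right hy) hyG hzy
        refine ⟨u, hrest u hu hus hut, hvv'.trans (h.linked_mono hv'u), y, hy, hyu, hyO,
          hzy'.mono ?_⟩
        rw [h.graph_eq]
        exact fun a ha => ⟨ha.1.1, fun h' => h'.elim ha.1.2 ha.2⟩
      · exact chord_case hvm g hg hg'.2 hzg
    -- The tip found cannot be `s` or `t`, since their roots are linked to `m`.
    · have hdis : ∀ a ∈ D'.component v, a ∉ Chord.points s.root t.root l₁ l₂ p q m :=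
        fun a ha ha' => hvm (hD'.linked_of_mem_component ha (h.points_subset_component hD ha'))
      obtain ⟨u, hu, hv'u, y, hy, hyu, hyO, hzy⟩ := hr v' hv'
        (O \ Chord.points s.root t.root l₁ l₂ p q m) (hO.sdiff hcl)
        (fun a ha => ⟨hvO (hv'O ha), hdis a (hv'O ha)⟩) x hxv' z hzG
        (fun a ha => ⟨hxz ha, fun h' => hdis x hx (by
          have := hxzG ⟨ha, h.points_subset h'⟩
          rwa [mem_singleton_iff.1 this] at h')⟩) hxzG'
      refine ⟨u, hrest u hu ?_ ?_, hvv'.trans (h.linked_mono hv'u), y, hy, hyu,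
        hyO.trans sdiff_subset, hzy.mono ?_⟩
      · rintro rfl
        exact hvm ((hvv'.trans (h.linked_mono hv'u)).trans h.linked_left.symm)
      · rintro rfl
        exact hvm ((hvv'.trans (h.linked_mono hv'u)).trans h.linked_right.symm)
      · rw [h.graph_eq]
        exact fun a ha => ⟨ha.1.1, fun h' => h'.elim ha.2 ha.1.2⟩
  · have hxP : x ∈ Chord.points s.root t.root l₁ l₂ p q m := by
      have := Drawing.IsPlane.component_subset v hx
      rw [h.graph_eq] at this
      exact this.resolve_left hxG
    refine chord_case (hD'.linked_of_mem_component hx (h.points_subset_component hD hxP)) x hxP hxG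
      (.of_segment ?_)
    rw [segment_symm]
    refine fun a ha => ⟨hxz ha, fun h' => hxG ?_⟩
    have := hxzG ⟨ha, h.graph_subset h'⟩
    rwa [mem_singleton_iff.1 this] at h'

end MoveData

/-! ### Existence of a move between two tips of one face -/

/-- The points of the given open arms. -/
def stubs (L : List Tip) : Set Plane := carriers (L.map Tip.stub)

theorem mem_stubs {L : List Tip} {x : Plane} :
    x ∈ stubs L ↔ ∃ s ∈ L, x ∈ segment ℝ s.root s.free := by
  simp [stubs, mem_carriers, carrier_stub]

theorem isClosed_stubs (L : List Tip) : IsClosed (stubs L) := (isCompact_carriers _).isClosed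

namespace Drawing.IsPlane

variable {D : Drawing}

/-- The open arms do not cut the faces of the graph. -/
theorem polyJoined_compl_stubs (hD : D.IsPlane) (L : List Tip) (hL : L.Nodup)
    (hLD : ∀ u ∈ L, u ∈ D.tips) {z w : Plane} (hz : z ∉ D.graph ∪ stubs L)
    (hw : w ∉ D.graph ∪ stubs L) (h : PolyJoined D.graphᶜ z w) :
    PolyJoined (D.graph ∪ stubs L)ᶜ z w := by
  induction L with
  | nil =>
    have : stubs [] = ∅ := by ext; simp [mem_stubs]
    rwa [this, union_empty]
  | cons u L ih =>
    have hu := hLD u (by simp)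
    have hset : stubs (u :: L) = stubs L ∪ segment ℝ u.free u.root := by
      ext x; simp [mem_stubs, segment_symm ℝ u.free, or_comm]
    have hui : ∀ x ∈ segment ℝ u.free u.root, x ∈ D.graph ∪ stubs L → x = u.root := by
      intro x hx hx'
      rw [segment_symm] at hx
      rcases hx' with hx' | hx'
      · exact hD.eq_root_of_mem_graph hu hx hx'
      · obtain ⟨v, hv, hxv⟩ := mem_stubs.1 hx'
        refine hD.eq_root hu (hD.stub_inter hu (hLD v (by simp [hv])) ?_ hx hxv) hx
        rintro rfl
        exact (List.nodup_cons.1 hL).1 hv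
    rw [hset, ← union_assoc] at hz hw ⊢
    exact (ih (List.nodup_cons.1 hL).2 (fun v hv => hLD v (by simp [hv])) (fun h => hz (.inl h))
      (fun h => hw (.inl h))).union_segment_of_free (D.isClosed_graph.union (isClosed_stubs L))
      (hD.root_ne_free hu).symm (fun x hx => hui x hx.1 hx.2)
      (fun h => hD.root_ne_free hu (hui _ (left_mem_segment ℝ _ _) h).symm) hz hw

/-- An open arm can be prolonged a little beyond its free end. -/
theorem exists_prolongation (hD : D.IsPlane) {s : Tip} (hs : s ∈ D.tips) :
    ∃ e, e ∉ D.graph ∪ stubs D.tips ∧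
      segment ℝ s.free e ⊆ (D.graph ∪ stubs D.tips)ᶜ ∪ {s.free} := by
  classical
  -- Other arms stay away from `s.free`; the arm `s` itself is avoided only because the prolongation
  -- goes straight on.
  have hcl : IsClosed (D.graph ∪ stubs (D.tips.filter fun u => u ≠ s)) :=
    D.isClosed_graph.union (isClosed_stubs _)
  have hmem : s.free ∈ (D.graph ∪ stubs (D.tips.filter fun u => u ≠ s))ᶜ := by
    rintro (h | h)
    · exact hD.free_notMem hs h
    · obtain ⟨u, hu, hxu⟩ := mem_stubs.1 h
      obtain ⟨hu, hus⟩ := List.mem_filter.1 hu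
      exact hD.free_notMem hs (.inl (hD.stub_inter hu hs (by simpa using hus) hxu
        (right_mem_segment ℝ _ _)))
  obtain ⟨ε, hε, hev⟩ := eventually_add_smul (hcl.isOpen_compl.mem_nhds hmem) (s.free - s.root)
  have key : ∀ τ : ℝ, 0 < τ → τ < ε →
      s.free + τ • (s.free - s.root) ∉ D.graph ∪ stubs D.tips := by
    intro τ h0 h1
    have hτ := hev τ (by rwa [abs_of_pos h0])
    rintro (h | h)
    · exact hτ (.inl h)
    · obtain ⟨u, hu, hxu⟩ := mem_stubs.1 h
      by_cases hus : u = s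
      · subst hus
        obtain ⟨r, -, hr1, hr⟩ := mem_segment_iff_exists.1 hxu
        have : (1 + τ - r) • (u.free - u.root) = 0 := by
          calc _ = (u.free + τ • (u.free - u.root)) - (u.root + r • (u.free - u.root)) := by module
            _ = 0 := by rw [hr, sub_self]
        rcases smul_eq_zero.1 this with h | h
        · linarith
        · exact hD.root_ne_free hu (sub_eq_zero.1 h).symm
      · exact hτ (.inr (mem_stubs.2 ⟨u, List.mem_filter.2 ⟨hu, by simpa using hus⟩, hxu⟩))
  refine ⟨_, key (ε / 2) (by linarith) (by linarith), fun x hx => ?_⟩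
  obtain ⟨r, hr0, hr1, rfl⟩ := mem_segment_iff_exists.1 hx
  rw [add_sub_cancel_left, smul_smul]
  rcases hr0.eq_or_lt with rfl | hr0
  · right; simp
  · left; exact key _ (by positivity) (by nlinarith)

/-- Two tips in the same face can be joined by a simple polygonal curve. -/
theorem exists_curve (hD : D.IsPlane) {s t : Tip} (hs : s ∈ D.tips) (ht : t ∈ D.tips)
    (hj : PolyJoined D.graphᶜ s.free t.free) : ∃ l, IsSimple (s.free :: l) ∧
      (s.free :: l).getLast? = some t.free ∧ ∀ x ∈ carrier (s.free :: l),
        x ∉ D.graph ∪ stubs D.tips ∨ x = s.free ∨ x = t.free := by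
  obtain ⟨e, he, hse⟩ := hD.exists_prolongation hs
  obtain ⟨f, hf, htf⟩ := hD.exists_prolongation ht
  have hout : ∀ {u : Tip} {e}, u ∈ D.tips →
      segment ℝ u.free e ⊆ (D.graph ∪ stubs D.tips)ᶜ ∪ {u.free} →
      PolyJoined D.graphᶜ u.free e := by
    intro u e hu h
    refine .of_segment (h.trans (union_subset ?_ ?_))
    · exact compl_subset_compl.2 subset_union_left
    · exact singleton_subset_iff.2 (hD.free_notMem hu)
  have hef := hD.polyJoined_compl_stubs D.tips hD.tips_nodup (fun _ h => h) he hf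
    (((hout hs hse).symm.trans hj).trans (hout ht htf))
  -- Only the two free ends are readmitted, so a simple curve in `S` touches the old picture nowhere
  -- else.
  set S : Set Plane := (D.graph ∪ stubs D.tips)ᶜ ∪ {s.free, t.free}
  have hst : PolyJoined S s.free t.free := by
    refine PolyJoined.trans (.of_segment (hse.trans ?_)) ((hef.mono subset_union_left).trans
      (PolyJoined.symm (.of_segment (htf.trans ?_))))
    · exact union_subset_union_right _ (by simp)
    · exact union_subset_union_right _ (by simp)
  obtain ⟨l, hl, hlast, hlS⟩ := hst.exists_isSimple (.inr (by simp))
  exact ⟨l, hl, hlast, fun x hx => (hlS hx).imp id fun h => by simpa using h⟩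

end Drawing.IsPlane

theorem isSimple_pair {a b : Plane} (h : a ≠ b) : IsSimple [a, b] :=
  ⟨h, inter_eq_right.2 (singleton_subset_iff.2 (right_mem_segment ℝ a b)), trivial⟩

theorem carrier_pair (a b : Plane) : carrier [a, b] = segment ℝ a b :=
  union_eq_self_of_subset_right (singleton_subset_iff.2 (right_mem_segment ℝ a b))

theorem segment_inter_segment {p q m : Plane} (hpq : p ≠ q) (hm : m ∈ segment ℝ p q) {x : Plane}
    (hx : x ∈ segment ℝ p m) (hx' : x ∈ segment ℝ m q) : x = m := by
  obtain ⟨t, h0, h1, rfl⟩ := mem_segment_iff_exists.1 hm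
  obtain ⟨a, a0, a1, hxa⟩ := mem_segment_iff_exists.1 hx
  obtain ⟨b, b0, b1, hxb⟩ := mem_segment_iff_exists.1 hx'
  have e : (a * t - (t + b * (1 - t))) • (q - p) = 0 := by
    calc _ = (p + a • (p + t • (q - p) - p)) -
          (p + t • (q - p) + b • (q - (p + t • (q - p)))) := by module
      _ = 0 := by rw [← hxa, ← hxb, sub_self]
  rcases smul_eq_zero.1 e with e | e
  · have : b * (1 - t) = 0 := by
      have := mul_nonneg b0 (sub_nonneg.2 h1)
      nlinarith
    have e2 : a * t = t := by linarith
    rw [hxa]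
    calc p + a • (p + t • (q - p) - p) = p + (a * t) • (q - p) := by module
      _ = _ := by rw [e2]
  · exact absurd (sub_eq_zero.1 e).symm hpq

/-- A short crossbar can be drawn across a segment. -/
theorem exists_crossbar {Z : Set Plane} (hZ : IsClosed Z) {p q m : Plane} (hpq : p ≠ q)
    (hm : m ∈ segment ℝ p q) (hmZ : m ∉ Z) : ∃ c d, m ≠ c ∧ m ≠ d ∧ m ∈ openSegment ℝ c d ∧
      (∀ x ∈ segment ℝ m c, x ∈ Z ∪ segment ℝ p q → x = m) ∧
      (∀ x ∈ segment ℝ m d, x ∈ Z ∪ segment ℝ p q → x = m) ∧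
      ∀ x ∈ segment ℝ m c, x ∈ segment ℝ m d → x = m := by
  -- The crossbar is perpendicular to the segment and short enough to avoid `Z`; off `m` its points
  -- have nonzero `side`.
  obtain ⟨e, he, hev⟩ := eventually_add_smul (hZ.isOpen_compl.mem_nhds hmZ) (normal p q)
  have hN := along_self_pos hpq
  have hside : ∀ τ : ℝ, side p q (m + τ • normal p q) = τ * along p q q := fun τ => by
    rw [side_add_smul_mem_iff p q hm, side_normal]
  have hn : normal p q ≠ 0 := by
    intro h
    have := side_normal p q
    rw [h, add_zero, side_left] at this
    exact hN.ne this
  have hseg : ∀ σ : ℝ, |σ| < e → ∀ x ∈ segment ℝ m (m + σ • normal p q),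
      ∃ τ : ℝ, 0 ≤ τ ∧ τ ≤ 1 ∧ |τ * σ| < e ∧ x = m + (τ * σ) • normal p q := by
    intro σ hσ x hx
    obtain ⟨τ, h0, h1, rfl⟩ := mem_segment_iff_exists.1 hx
    refine ⟨τ, h0, h1, ?_, by module⟩
    rw [abs_mul, abs_of_nonneg h0]
    exact (mul_le_of_le_one_left (abs_nonneg σ) h1).trans_lt hσ
  have hmain : ∀ σ : ℝ, |σ| < e → σ ≠ 0 → ∀ x ∈ segment ℝ m (m + σ • normal p q),
      x ∈ Z ∪ segment ℝ p q → x = m := by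
    intro σ hσ hσ0 x hx hx'
    obtain ⟨τ, h0, h1, hτ, rfl⟩ := hseg σ hσ x hx
    rcases hx' with hx' | hx'
    · exact absurd hx' (hev _ hτ)
    · have := side_eq_zero_of_mem hx'
      rw [hside, mul_eq_zero, or_iff_left hN.ne'] at this
      rw [this]; simp
  have he1 : |e / 2| < e := by rw [abs_of_pos] <;> linarith
  have he2 : |-(e / 2)| < e := by rwa [abs_neg]
  have hne : ∀ σ : ℝ, σ ≠ 0 → m ≠ m + σ • normal p q := by
    intro σ hσ h
    rw [left_eq_add, smul_eq_zero] at h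
    exact h.elim hσ hn
  refine ⟨m + (e / 2) • normal p q, m + (-(e / 2)) • normal p q, hne _ (by linarith),
    hne _ (by linarith), ?_, hmain _ he1 (by linarith), hmain _ he2 (by linarith), ?_⟩
  · refine mem_openSegment_iff_exists.2 ⟨1 / 2, by norm_num, by norm_num, ?_⟩
    module
  · intro x hx hx'
    obtain ⟨τ, h0, h1, -, rfl⟩ := hseg _ he1 x hx
    obtain ⟨τ', h0', h1', -, h⟩ := hseg _ he2 _ hx'
    have := congrArg (side p q) h
    rw [hside, hside] at this
    have := mul_right_cancel₀ hN.ne' this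
    have h2 : τ * (e / 2) = 0 := by
      have := mul_nonneg h0 he.le
      have := mul_nonneg h0' he.le
      linarith
    rw [h2]; simp

/-- Two tips in the same face admit a valid move. -/
theorem Drawing.IsPlane.exists_isMove {D : Drawing} (hD : D.IsPlane) {s t : Tip} (hs : s ∈ D.tips)
    (ht : t ∈ D.tips) (hst : s ≠ t) (hj : PolyJoined D.graphᶜ s.free t.free) :
    ∃ D', IsMove D D' := by
  classical
  obtain ⟨l, hl, hlast, hlS⟩ := hD.exists_curve hs ht hj
  have hfree : s.free ≠ t.free := fun h => hD.free_notMem hs (.inl (hD.stub_inter hs ht hst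
    (right_mem_segment ℝ _ _) (h ▸ right_mem_segment ℝ _ _)))
  obtain ⟨q, l₂, rfl⟩ : ∃ q l₂, l = q :: l₂ := by
    cases l with
    | nil => exact absurd (by simpa using hlast) hfree
    | cons q l₂ => exact ⟨q, l₂, rfl⟩
  obtain ⟨hpq, hi, hl⟩ := hl
  set p := s.free with hp
  have hlast' : (q :: l₂).getLast? = some t.free := by simpa using hlast
  -- The first segment of the curve is crossed, so `l₁` is empty in the move.
  obtain ⟨m, hm, hmp, hmq⟩ : ∃ m ∈ openSegment ℝ p q, m ≠ p ∧ m ≠ q := by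
    have hm : p + (1 / 2 : ℝ) • (q - p) ∈ openSegment ℝ p q :=
      mem_openSegment_iff_exists.2 ⟨1 / 2, by norm_num, by norm_num, rfl⟩
    refine ⟨_, hm, fun h => ?_, fun h => ?_⟩
    · rw [h] at hm; exact hpq (left_mem_openSegment_iff.1 hm)
    · rw [h] at hm; exact hpq (right_mem_openSegment_iff.1 hm)
  have hms := openSegment_subset_segment ℝ p q hm
  have hpm_sub : segment ℝ p m ⊆ segment ℝ p q :=
    (convex_segment p q).segment_subset (left_mem_segment ℝ p q) hms
  have hmq_sub : segment ℝ m q ⊆ segment ℝ p q :=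
    (convex_segment p q).segment_subset hms (right_mem_segment ℝ p q)
  have hi' : ∀ x ∈ segment ℝ p q, x ∈ carrier (q :: l₂) → x = q := fun x hx hx' => by
    rw [← mem_singleton_iff, ← hi]; exact ⟨hx, hx'⟩
  -- the curve meets the old picture only in the two free ends
  have hSG : ∀ x ∈ carrier (p :: q :: l₂), x ∉ D.graph := by
    intro x hx hxG
    rcases hlS x hx with h | rfl | rfl
    · exact h (.inl hxG)
    · exact hD.free_notMem hs hxG
    · exact hD.free_notMem ht hxG
  have hSu : ∀ x ∈ carrier (p :: q :: l₂), ∀ u ∈ D.tips, x ∈ segment ℝ u.root u.free →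
      u = s ∧ x = p ∨ u = t ∧ x = t.free := by
    intro x hx u hu hxu
    rcases hlS x hx with h | rfl | rfl
    · exact absurd (.inr (mem_stubs.2 ⟨u, hu, hxu⟩)) h
    · refine .inl ⟨?_, rfl⟩
      by_contra hus
      exact hSG _ hx (.inl (hD.stub_inter hu hs hus hxu (right_mem_segment ℝ _ _)))
    · refine .inr ⟨?_, rfl⟩
      by_contra hus
      exact hSG _ hx (.inl (hD.stub_inter hu ht hus hxu (right_mem_segment ℝ _ _)))
  have hpF : p ∉ carrier (q :: l₂) := fun h => hpq (hi' p (left_mem_segment ℝ p q) h)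
  have htF : t.free ∈ carrier (q :: l₂) := mem_carrier_of_getLast? hlast'
  have hmF : m ∉ carrier (q :: l₂) := fun h => hmq (hi' m hms h)
  have hmG : m ∉ D.graph := hSG m (.inl hms)
  have hmu : ∀ u ∈ D.tips, m ∉ segment ℝ u.root u.free := by
    intro u hu h
    rcases hSu m (.inl hms) u hu h with ⟨-, h⟩ | ⟨-, h⟩
    · exact hmp h
    · exact hmF (h ▸ htF)
  -- `Z` contains the whole old picture and the rest of the curve, so the crossbar meets nothing but
  -- `m`.
  obtain ⟨c, d, hmc, hmd, hcd, hc, hd, hcd'⟩ := exists_crossbar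
    (Z := D.graph ∪ stubs D.tips ∪ carrier (q :: l₂))
    ((D.isClosed_graph.union (isClosed_stubs _)).union (isClosed_carrier _)) hpq hms (by
      rintro ((h | h) | h)
      · exact hmG h
      · obtain ⟨u, hu, h⟩ := mem_stubs.1 h
        exact hmu u hu h
      · exact hmF h)
  -- the two new edges
  obtain ⟨L, hL⟩ := List.getLast?_eq_some_iff.1 hlast'
  have hL' : q :: (l₂ ++ [t.root]) = L ++ t.free :: [t.root] := by
    rw [← List.cons_append, hL]; simp
  have hc1 : ∀ x, x ∈ carrier (s.root :: ([] ++ [p, m])) ↔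
      x ∈ segment ℝ s.root s.free ∨ x ∈ segment ℝ p m := by
    intro x
    rw [List.nil_append, carrier_cons_cons, carrier_pair]; rfl
  have hc2' : carrier (q :: (l₂ ++ [t.root])) = carrier (q :: l₂) ∪ segment ℝ t.root t.free := by
    rw [hL', carrier_append, ← hL, carrier_pair, segment_symm]
  have hc2 : ∀ x, x ∈ carrier (m :: q :: (l₂ ++ [t.root])) ↔
      (x ∈ segment ℝ m q ∨ x ∈ carrier (q :: l₂)) ∨ x ∈ segment ℝ t.root t.free := by
    intro x
    rw [carrier_cons_cons, hc2', ← union_assoc]; rfl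
  have hsub1 : ∀ x ∈ segment ℝ p m, x ∈ carrier (p :: q :: l₂) := fun x hx => .inl (hpm_sub hx)
  have hsub2 : ∀ x, x ∈ segment ℝ m q ∨ x ∈ carrier (q :: l₂) → x ∈ carrier (p :: q :: l₂) :=
    fun x hx => hx.imp_left fun h => hmq_sub h
  have hA1 : IsArc (s.root :: ([] ++ [p, m])) := by
    refine ⟨by simp, hD.root_ne_free hs, ?_, isSimple_pair hmp.symm⟩
    refine Subset.antisymm ?_ (singleton_subset_iff.2
      ⟨right_mem_segment ℝ _ _, head_mem_carrier _ _⟩)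
    rintro x ⟨hx, hx'⟩
    change x ∈ carrier [p, m] at hx'
    rw [carrier_pair] at hx'
    exact (hSu x (hsub1 x hx') s hs hx).elim (fun h => h.2) fun h => absurd h.1 hst
  have hA2 : IsArc (m :: q :: (l₂ ++ [t.root])) := by
    refine ⟨by simp, hmq, ?_, ?_⟩
    · refine Subset.antisymm ?_ (singleton_subset_iff.2
        ⟨right_mem_segment ℝ _ _, head_mem_carrier _ _⟩)
      rintro x ⟨hx, hx'⟩
      rw [hc2'] at hx'
      refine hi' x (hmq_sub hx) (hx'.elim id fun hx' => ?_)
      rcases hSu x (hsub2 x (.inl hx)) t ht hx' with h | h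
      · exact absurd h.1.symm hst
      · exact h.2 ▸ htF
    · rw [hL', isSimple_append, ← hL, carrier_pair, segment_symm]
      refine ⟨hl, isSimple_pair (hD.root_ne_free ht).symm, ?_⟩
      rintro x ⟨hx, hx'⟩
      exact (hSu x (.inr hx) t ht hx').elim (fun h => absurd h.1.symm hst) fun h => h.2
  obtain ⟨rest, hperm⟩ : ∃ rest, D.tips.Perm (s :: t :: rest) :=
    ⟨(D.tips.erase s).erase t, (List.perm_cons_erase hs).trans (.cons s
      (List.perm_cons_erase ((List.mem_erase_of_ne hst.symm).2 ht)))⟩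
  have hnd : (s :: t :: rest).Nodup := hperm.nodup_iff.1 hD.tips_nodup
  have hrest : ∀ u ∈ rest, u ∈ D.tips ∧ u ≠ s ∧ u ≠ t := by
    intro u hu
    refine ⟨hperm.symm.subset (by simp [hu]), ?_, ?_⟩
    · rintro rfl; exact (List.nodup_cons.1 hnd).1 (by simp [hu])
    · rintro rfl; exact (List.nodup_cons.1 (List.nodup_cons.1 hnd).2).1 hu
  have hE1 : ∀ x ∈ carrier (s.root :: ([] ++ [p, m])),
      x ∈ D.graph ∪ stubs D.tips ∪ carrier (q :: l₂) ∪ segment ℝ p q := by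
    intro x hx
    rcases (hc1 x).1 hx with hx | hx
    · exact .inl (.inl (.inr (mem_stubs.2 ⟨s, hs, hx⟩)))
    · exact .inr (hpm_sub hx)
  have hE2 : ∀ x ∈ carrier (m :: q :: (l₂ ++ [t.root])),
      x ∈ D.graph ∪ stubs D.tips ∪ carrier (q :: l₂) ∪ segment ℝ p q := by
    intro x hx
    rcases (hc2 x).1 hx with (hx | hx) | hx
    · exact .inr (hmq_sub hx)
    · exact .inl (.inr hx)
    · exact .inl (.inl (.inr (mem_stubs.2 ⟨t, ht, hx⟩)))
  have hEA : ∀ A ∈ D.edges, ∀ x ∈ carrier A,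
      x ∈ D.graph ∪ stubs D.tips ∪ carrier (q :: l₂) ∪ segment ℝ p q :=
    fun A hA x hx => .inl (.inl (.inl (.inr ⟨A, hA, hx⟩)))
  have hEu : ∀ u ∈ rest, ∀ x ∈ segment ℝ u.root u.free,
      x ∈ D.graph ∪ stubs D.tips ∪ carrier (q :: l₂) ∪ segment ℝ p q :=
    fun u hu x hx => .inl (.inl (.inr (mem_stubs.2 ⟨u, (hrest u hu).1, hx⟩)))
  have hEV : ∀ v ∈ D.vertices,
      v ∈ D.graph ∪ stubs D.tips ∪ carrier (q :: l₂) ∪ segment ℝ p q :=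
    fun v hv => .inl (.inl (.inl (.inl hv)))
  have h1G : ∀ x ∈ carrier (s.root :: ([] ++ [p, m])), x ∈ D.graph → x = s.root := by
    intro x hx hxG
    rcases (hc1 x).1 hx with hx | hx
    · exact hD.eq_root_of_mem_graph hs hx hxG
    · exact absurd hxG (hSG x (hsub1 x hx))
  have h2G : ∀ x ∈ carrier (m :: q :: (l₂ ++ [t.root])), x ∈ D.graph → x = t.root := by
    intro x hx hxG
    rcases (hc2 x).1 hx with hx | hx
    · exact absurd hxG (hSG x (hsub2 x hx))
    · exact hD.eq_root_of_mem_graph ht hx hxG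
  have h1u : ∀ u ∈ rest, ∀ x ∈ carrier (s.root :: ([] ++ [p, m])),
      x ∈ segment ℝ u.root u.free → x ∈ D.vertices := by
    intro u hu x hx hxu
    obtain ⟨hu, hus, hut⟩ := hrest u hu
    rcases (hc1 x).1 hx with hx | hx
    · exact hD.stub_inter hu hs hus hxu hx
    · exact (hSu x (hsub1 x hx) u hu hxu).elim (fun h => absurd h.1 hus) fun h => absurd h.1 hut
  have h2u : ∀ u ∈ rest, ∀ x ∈ carrier (m :: q :: (l₂ ++ [t.root])),
      x ∈ segment ℝ u.root u.free → x ∈ D.vertices := by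
    intro u hu x hx hxu
    obtain ⟨hu, hus, hut⟩ := hrest u hu
    rcases (hc2 x).1 hx with hx | hx
    · exact (hSu x (hsub2 x hx) u hu hxu).elim (fun h => absurd h.1 hus) fun h => absurd h.1 hut
    · exact hD.stub_inter hu ht hut hxu hx
  have h12 : ∀ x ∈ carrier (s.root :: ([] ++ [p, m])), x ∈ carrier (m :: q :: (l₂ ++ [t.root])) →
      x = m ∨ x ∈ D.vertices := by
    intro x hx hx'
    rcases (hc1 x).1 hx with hx | hx <;> rcases (hc2 x).1 hx' with hx' | hx'
    · rcases hSu x (hsub2 x hx') s hs hx with ⟨-, rfl⟩ | h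
      · rcases hx' with hx' | hx'
        · exact absurd (segment_inter_segment hpq hms (left_mem_segment ℝ p m) hx').symm hmp
        · exact absurd hx' hpF
      · exact absurd h.1 hst
    · exact .inr (hD.stub_inter hs ht hst hx hx')
    · rcases hx' with hx' | hx'
      · exact .inl (segment_inter_segment hpq hms hx hx')
      · obtain rfl := hi' x (hpm_sub hx) hx'
        exact .inl (segment_inter_segment hpq hms hx (right_mem_segment ℝ m x))
    · rcases hSu x (hsub1 x hx) t ht hx' with h | ⟨-, rfl⟩
      · exact absurd h.1.symm hst
      · have := hi' _ (hpm_sub hx) htF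
        rw [this] at hx ⊢
        exact .inl (segment_inter_segment hpq hms hx (right_mem_segment ℝ m q))
  refine ⟨⟨m :: D.vertices, (s.root :: ([] ++ [p, m])) :: (m :: q :: (l₂ ++ [t.root])) :: D.edges,
    Tip.mk m c :: Tip.mk m d :: rest⟩, s, t, rest, [], l₂, p, q, m, c, d, hperm, rfl, ?_, hm, hcd,
    rfl, rfl, rfl, ?_⟩
  · simpa using hlast
  refine ⟨?_, ?_, ?_, ?_, ?_⟩
  · exact List.nodup_cons.2 ⟨fun h => hmG (.inl h), hD.nodup⟩
  · intro A hA
    simp only [Drawing.curves, List.map_cons, List.mem_append, List.mem_cons, List.mem_map] at hA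
    rcases hA with (rfl | rfl | hA) | rfl | rfl | ⟨u, hu, rfl⟩
    · exact hA1
    · exact hA2
    · exact hD.isArc A (List.mem_append_left _ hA)
    · exact ⟨by simp [Tip.stub], isSimple_pair hmc⟩
    · exact ⟨by simp [Tip.stub], isSimple_pair hmd⟩
    · exact hD.isArc _ (List.mem_append_right _ (List.mem_map_of_mem (hrest u hu).1))
  · intro A hA
    simp only [List.mem_cons] at hA
    rcases hA with rfl | rfl | hA
    · refine ⟨s.root, by simp [hD.root_mem hs], m, by simp, rfl, by simp, fun v hv hvA => ?_⟩
      rcases List.mem_cons.1 hv with rfl | hv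
      · exact .inr rfl
      · exact .inl (h1G v hvA (.inl hv))
    · refine ⟨m, by simp, t.root, by simp [hD.root_mem ht], rfl,
        MoveData.getLast?_edge₂ _ _ _ _, fun v hv hvA => ?_⟩
      rcases List.mem_cons.1 hv with rfl | hv
      · exact .inl rfl
      · exact .inr (h2G v hvA (.inl hv))
    · obtain ⟨u, hu, w, hw, hAu, hAw, h⟩ := hD.edge_ends A hA
      refine ⟨u, by simp [hu], w, by simp [hw], hAu, hAw, fun v hv hvA => ?_⟩
      rcases List.mem_cons.1 hv with rfl | hv
      · exact absurd (.inr ⟨A, hA, hvA⟩) hmG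
      · exact h v hv hvA
  · intro u hu
    simp only [List.mem_cons] at hu
    rcases hu with rfl | rfl | hu
    · refine ⟨by simp, fun v hv hvA => ?_⟩
      rw [carrier_stub] at hvA
      rcases List.mem_cons.1 hv with rfl | hv
      · rfl
      · exact hc v hvA (hEV v hv)
    · refine ⟨by simp, fun v hv hvA => ?_⟩
      rw [carrier_stub] at hvA
      rcases List.mem_cons.1 hv with rfl | hv
      · rfl
      · exact hd v hvA (hEV v hv)
    · have hu' := (hrest u hu).1
      refine ⟨by simp [hD.root_mem hu'], fun v hv hvA => ?_⟩
      rw [carrier_stub] at hvA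
      rcases List.mem_cons.1 hv with rfl | hv
      · exact absurd hvA (hmu u hu')
      · exact hD.eq_root hu' hv hvA
  · simp only [Drawing.curves, List.map_cons]
    have hstub : ∀ e, carrier (Tip.stub ⟨m, e⟩) = segment ℝ m e := fun e => carrier_pair m e
    refine List.pairwise_append.2 ⟨?_, ?_, ?_⟩
    · refine List.pairwise_cons.2 ⟨?_, List.pairwise_cons.2 ⟨?_, ?_⟩⟩
      · rintro A hA x ⟨hx, hx'⟩
        rcases List.mem_cons.1 hA with rfl | hA
        · exact List.mem_cons.2 (h12 x hx hx')
        · rw [h1G x hx (.inr ⟨A, hA, hx'⟩)]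
          simp [hD.root_mem hs]
      · rintro A hA x ⟨hx, hx'⟩
        rw [h2G x hx (.inr ⟨A, hA, hx'⟩)]
        simp [hD.root_mem ht]
      · exact hD.pairwise_edges.imp fun h x hx => List.mem_cons_of_mem _ (h x hx)
    · refine List.pairwise_cons.2 ⟨?_, List.pairwise_cons.2 ⟨?_, ?_⟩⟩
      · rintro A hA x ⟨hx, hx'⟩
        rw [hstub] at hx
        simp only [List.mem_cons, List.mem_map] at hA
        rcases hA with rfl | ⟨u, hu, rfl⟩
        · rw [hcd' x hx (by rwa [hstub] at hx')]; simp
        · rw [carrier_stub] at hx'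
          rw [hc x hx (hEu u hu x hx')]; simp
      · rintro A hA x ⟨hx, hx'⟩
        rw [hstub] at hx
        simp only [List.mem_map] at hA
        obtain ⟨u, hu, rfl⟩ := hA
        rw [carrier_stub] at hx'
        rw [hd x hx (hEu u hu x hx')]; simp
      · have := (hperm.pairwise_iff (fun h x hx => h x hx.symm)).1 hD.pairwise_tips
        have := (List.pairwise_cons.1 (List.pairwise_cons.1 this).2).2
        exact List.pairwise_map.2 (this.imp fun h x hx => List.mem_cons_of_mem _ (h x hx))
    · rintro A hA B hB x ⟨hx, hx'⟩
      have hAx : x ∈ D.graph ∪ stubs D.tips ∪ carrier (q :: l₂) ∪ segment ℝ p q := by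
        simp only [List.mem_cons] at hA
        rcases hA with rfl | rfl | hA
        · exact hE1 x hx
        · exact hE2 x hx
        · exact hEA A hA x hx
      simp only [List.mem_cons, List.mem_map] at hB
      rcases hB with rfl | rfl | ⟨u, hu, rfl⟩
      · rw [hstub] at hx'
        rw [hc x hx' hAx]; simp
      · rw [hstub] at hx'
        rw [hd x hx' hAx]; simp
      · rw [carrier_stub] at hx'
        refine List.mem_cons_of_mem _ ?_
        simp only [List.mem_cons] at hA
        rcases hA with rfl | rfl | hA
        · exact h1u u hu x hx hx'
        · exact h2u u hu x hx hx'
        · exact hD.edge_stub hA (hrest u hu).1 hx hx'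

/-! ### Starting positions -/

/-- A punctured ball is connected. -/
theorem polyJoined_ball_diff {v : Plane} {r : ℝ} {a b : Plane} (ha : a ∈ Metric.ball v r)
    (hb : b ∈ Metric.ball v r) (hav : a ≠ v) (hbv : b ≠ v) :
    PolyJoined (Metric.ball v r \ {v}) a b := by
  have hseg : ∀ {x y}, x ∈ Metric.ball v r → y ∈ Metric.ball v r → v ∉ segment ℝ x y →
      PolyJoined (Metric.ball v r \ {v}) x y := fun hx hy h =>
    .of_segment fun z hz => ⟨(convex_ball v r).segment_subset hx hy hz, fun hzv => h (hzv ▸ hz)⟩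
  by_cases hv : v ∈ segment ℝ a b
  · have hab : a ≠ b := by
      rintro rfl
      rw [segment_same] at hv
      exact hav (mem_singleton_iff.1 hv).symm
    have hr : 0 < r := (dist_nonneg.trans_lt (Metric.mem_ball.1 ha))
    -- If the straight way passes through `v`, a detour over a point off the line avoids it.
    obtain ⟨c, hc, hcs⟩ := exists_side_pos hab hv (Metric.ball_mem_nhds v hr)
    have key : ∀ x, side a b x = 0 → x ≠ v → v ∉ segment ℝ x c := by
      intro x hx hxv hvx
      have hvs := side_eq_zero_of_mem hv
      obtain ⟨τ, -, -, hτ⟩ := mem_segment_iff_exists.1 hvx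
      rw [hτ, side_add_smul, hx, zero_add] at hvs
      have e : (b.1 - a.1) * (c - x).2 - (b.2 - a.2) * (c - x).1 = side a b c := by
        rw [← sub_zero (side a b c), ← hx]
        simp only [side, Prod.fst_sub, Prod.snd_sub]; ring
      rw [e, mul_eq_zero, or_iff_left hcs.ne'] at hvs
      rw [hvs] at hτ
      exact hxv (by simpa using hτ.symm)
    exact (hseg ha hc (key a (side_left a b) hav)).trans
      (hseg hb hc (key b (side_eq_zero_of_mem (right_mem_segment ℝ a b)) hbv)).symm
  · exact hseg ha hb hv

namespace Drawing.IsInitial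

variable {n : ℕ} {t : Fin n → ℕ} {D : Drawing}

theorem isPlane (hD : D.IsInitial t) : D.IsPlane := by
  obtain ⟨v, a, h1, h2, h3, h4⟩ := hD
  exact h4

theorem length_vertices (hD : D.IsInitial t) : D.vertices.length = n := by
  obtain ⟨v, a, h1, h2, h3, h4⟩ := hD
  rw [h1, List.length_ofFn]

theorem edges_eq (hD : D.IsInitial t) : D.edges = [] := by
  obtain ⟨v, a, h1, h2, h3, h4⟩ := hD
  exact h2

theorem length_tips (hD : D.IsInitial t) : D.tips.length = ∑ i, t i := by
  obtain ⟨v, a, h1, h2, h3, h4⟩ := hD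
  rw [h3, List.length_flatten, List.map_ofFn, List.sum_ofFn]
  simp

theorem exists_tip (hD : D.IsInitial t) (ht : ∀ i, 1 ≤ t i) {v : Plane} (hv : v ∈ D.vertices) :
    ∃ s ∈ D.tips, s.root = v := by
  obtain ⟨w, a, h1, h2, h3, h4⟩ := hD
  rw [h1, List.mem_ofFn] at hv
  obtain ⟨i, rfl⟩ := hv
  refine ⟨⟨w i, a i ⟨0, ht i⟩⟩, ?_, rfl⟩
  rw [h3, List.mem_flatten]
  exact ⟨_, List.mem_ofFn.2 ⟨i, rfl⟩, List.mem_ofFn.2 ⟨_, rfl⟩⟩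

/-- A component is a single spot, which has a tip; near it the graph is just that point, and one can
walk around it in a small punctured disc from the approach `z'` to the arm. -/
theorem tipsReachable (hD : D.IsInitial t) (ht : ∀ i, 1 ≤ t i) : D.TipsReachable := by
  intro v hv O hO hvO x hx z hz hxz hxzG
  have hlink : ∀ {u w}, D.Linked u w → u = w := by
    intro u w h
    induction h with
    | rel u w h =>
      obtain ⟨A, hA, -⟩ := h
      simp [hD.edges_eq] at hA
    | refl => rfl
    | symm _ _ _ ih => exact ih.symm
    | trans _ _ _ _ _ ih ih' => exact ih.trans ih'
  obtain rfl : x = v := by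
    obtain ⟨w, hw, hvw, rfl | ⟨A, hA, -⟩⟩ := hx
    · exact (hlink hvw).symm
    · simp [hD.edges_eq] at hA
  have hgraph : D.graph = {y | y ∈ D.vertices} := by
    ext y
    simp [Drawing.graph, hD.edges_eq, mem_carriers]
  have hxO : x ∈ O := hxz (left_mem_segment ℝ x z)
  have hcl : IsClosed ({y | y ∈ D.vertices} \ {x}) :=
    ((List.finite_toSet D.vertices).sdiff).isClosed
  obtain ⟨r, hr, hb⟩ := Metric.isOpen_iff.1 (hO.inter hcl.isOpen_compl) x ⟨hxO, fun h => h.2 rfl⟩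
  obtain ⟨s, hs, rfl⟩ := hD.exists_tip ht hv
  have hzx : z ≠ s.root := fun h => hz (h ▸ by rw [hgraph]; exact hv)
  have hpt : ∀ w, w ≠ s.root → ∃ y ∈ segment ℝ s.root w, y ∈ Metric.ball s.root r ∧ y ≠ s.root := by
    intro w hw
    obtain ⟨e, he, hev⟩ := eventually_add_smul (Metric.ball_mem_nhds s.root hr) (w - s.root)
    have h0 : 0 < min (e / 2) 1 := lt_min (by linarith) one_pos
    refine ⟨_, mem_segment_iff_exists.2 ⟨min (e / 2) 1, h0.le, min_le_right _ _, rfl⟩,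
      hev _ ?_, ?_⟩
    · rw [abs_of_pos h0]
      exact (min_le_left _ _).trans_lt (by linarith)
    · rw [Ne, add_eq_left, smul_eq_zero, sub_eq_zero, not_or]
      exact ⟨h0.ne', hw⟩
  obtain ⟨z', hz's, hz'b, hz'x⟩ := hpt z hzx
  obtain ⟨y, hys, hyb, hyx⟩ := hpt s.free (hD.isPlane.root_ne_free hs).symm
  refine ⟨s, hs, .refl _, y, hys, hyx, ?_, ?_⟩
  · exact ((convex_ball _ r).segment_subset (Metric.mem_ball_self hr) hyb).trans
      fun a ha => (hb ha).1
  · refine PolyJoined.trans (b := z') ?_ ((polyJoined_ball_diff hz'b hyb hz'x hyx).mono ?_)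
    · refine ((polyJoined_segment_diff_left hzx.symm hz's hz'x).symm).mono fun a ha =>
        ⟨hxz ha.1, fun haG => ha.2 (hxzG ⟨ha.1, haG⟩)⟩
    · intro a ha
      refine ⟨(hb ha.1).1, fun haG => (hb ha.1).2 ⟨?_, ha.2⟩⟩
      rwa [hgraph] at haG

end Drawing.IsInitial

/-! ### The invariant and the outcome of the game -/

/-- What is known about a position reached after `k` moves from `n` spots with `T` tips. -/
structure Drawing.Reached (n T k : ℕ) (D : Drawing) : Prop where
  isPlane : D.IsPlane
  length_vertices : D.vertices.length = n + k
  length_edges : D.edges.length = 2 * k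
  length_tips : D.tips.length = T
  tipsReachable : D.TipsReachable
  count : 1 + D.numComponents + k ≤ D.numFaces + n

theorem Drawing.IsInitial.reached {n : ℕ} {t : Fin n → ℕ} {D : Drawing} (hD : D.IsInitial t)
    (hn : 1 ≤ n) (ht : ∀ i, 1 ≤ t i) : D.Reached n (∑ i, t i) 0 where
  isPlane := hD.isPlane
  length_vertices := hD.length_vertices
  length_edges := by rw [hD.edges_eq]; rfl
  length_tips := hD.length_tips
  tipsReachable := hD.tipsReachable ht
  count := by
    have h1 := D.numComponents_le
    rw [hD.length_vertices] at h1
    have hne : D.vertices ≠ [] := by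
      rw [← List.length_pos_iff, hD.length_vertices]; exact hn
    obtain ⟨v, hv⟩ := List.exists_mem_of_ne_nil _ hne
    obtain ⟨s, hs, -⟩ := hD.exists_tip ht hv
    have := Drawing.numFaces_pos (List.ne_nil_of_mem hs)
    omega

/-- The left side of `count` gains 1 from `k`; this is paid by a new face if the roots were linked
and by a lost component otherwise. -/
theorem IsMove.reached {n T k : ℕ} {D D' : Drawing} (h : IsMove D D') (hD : D.Reached n T k) :
    D'.Reached n T (k + 1) := by
  obtain ⟨s, t, rest, l₁, l₂, p, q, m, c, d, h⟩ := h.exists_moveData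
  refine ⟨h.isPlane, ?_, ?_, ?_, h.tipsReachable hD.isPlane hD.tipsReachable, ?_⟩
  · rw [h.vertices, List.length_cons, hD.length_vertices]; omega
  · rw [h.edges, List.length_cons, List.length_cons, hD.length_edges]; omega
  · rw [h.tips, ← hD.length_tips, h.perm.length_eq]; rfl
  · have h0 := hD.count
    obtain ⟨h1, h1'⟩ := h.numComponents_le hD.isPlane
    obtain ⟨h2, h2'⟩ := h.numFaces_le hD.isPlane
    by_cases hst : D.Linked s.root t.root
    · have := h2' hst; omega
    · have := h1' hst; omega

theorem IsPlay.reached {n T k : ℕ} {D D' : Drawing} (h : IsPlay D k D') (hD : D.Reached n T 0) :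
    D'.Reached n T k := by
  induction h with
  | start => exact hD
  | step _ hm ih => exact hm.reached ih

namespace Drawing.Reached

variable {n T k : ℕ} {D : Drawing}

/-- `count` with at least one component and at most `T` faces containing tips. -/
theorem le (hD : D.Reached n T k) (hn : 1 ≤ n) : k + 2 ≤ n + T := by
  have h1 := hD.count
  have h2 := D.numFaces_le
  rw [hD.length_tips] at h2
  have h3 : 0 < D.numComponents := numComponents_pos (by
    rw [← List.length_pos_iff, hD.length_vertices]; omega)
  omega

/-- With no move left each tip has a face of its own, so the graph is connected and Euler's
inequality bounds `T` by 2k - (n + k) + 2. -/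
theorem ge_of_isOver (hD : D.Reached n T k) (hn : 1 ≤ n) (h : IsOver D) : n + T ≤ k + 2 := by
  have hne : D.vertices ≠ [] := by rw [← List.length_pos_iff, hD.length_vertices]; omega
  have htips : ∀ s ∈ D.tips, ∀ t ∈ D.tips, PolyJoined D.graphᶜ s.free t.free → s = t := by
    intro s hs t ht hst
    by_contra hne
    obtain ⟨D', hD'⟩ := hD.isPlane.exists_isMove hs ht hne hst
    exact h D' hD'
  obtain ⟨M, hM, hMe⟩ := hD.isPlane.hasFacesLE_of_connected hne
    (hD.isPlane.connected_of_tipsReachable hD.tipsReachable htips)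
  have := hD.isPlane.length_tips_le hM htips
  rw [hD.length_tips] at this
  rw [hD.length_vertices, hD.length_edges] at hMe
  omega

theorem isOver_iff (hD : D.Reached n T k) (hn : 1 ≤ n) : IsOver D ↔ k + 2 = n + T := by
  constructor
  · intro h
    have := hD.le hn
    have := hD.ge_of_isOver hn h
    omega
  · intro h D' hD'
    have := (hD'.reached hD).le hn
    omega

/-- The player to move wins if and only if an odd number of moves remains. -/
theorem canForceWin_iff (hn : 1 ≤ n) : ∀ (r : ℕ) {k : ℕ} {D : Drawing}, D.Reached n T k →
    k + r + 2 = n + T → (CanForceWin D ↔ Odd r) := by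
  intro r
  induction r using Nat.strong_induction_on with
  | _ r ih =>
    intro k D hD hr
    constructor
    · rintro ⟨_, D', hm, hw⟩
      have hD' := hm.reached hD
      have hle := hD'.le hn
      -- A move has been made, so `r ≥ 1` by `hle`; if `r ≥ 2` the opponent still has a reply, after
      -- which induction applies to `r - 2`.
      rcases Nat.lt_or_ge r 2 with h2 | h2
      · obtain rfl : r = 1 := by omega
        exact odd_one
      · have hno : ¬ IsOver D' := by rw [hD'.isOver_iff hn]; omega
        simp only [IsOver, not_forall, not_not] at hno
        obtain ⟨D'', hm'⟩ := hno
        have := (ih (r - 2) (by omega) (hm'.reached hD') (by omega)).1 (hw D'' hm')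
        obtain ⟨j, hj⟩ := this
        exact ⟨j + 1, by omega⟩
    · intro hodd
      have hpos := hodd.pos
      have hno : ¬ IsOver D := by rw [hD.isOver_iff hn]; omega
      simp only [IsOver, not_forall, not_not] at hno
      obtain ⟨D', hm⟩ := hno
      -- Any move will do, since parity alone decides.
      refine .intro D D' hm fun D'' hm' => ?_
      have hD'' := hm'.reached (hm.reached hD)
      have hle := hD''.le hn
      refine (ih (r - 2) (by omega) hD'' (by omega)).2 ?_
      obtain ⟨j, hj⟩ := hodd
      exact ⟨j - 1, by omega⟩

end Drawing.Reached

theorem turn_eq_second_iff (k : ℕ) : turn k = .second ↔ Odd k := by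
  induction k with
  | zero => simp [turn]
  | succ k ih =>
    rw [Nat.odd_add_one, ← ih, turn]
    cases turn k <;> simp [Player.other]

theorem winnerAfter_eq_first_iff (k : ℕ) : winnerAfter k = .first ↔ Odd k := by
  rw [← turn_eq_second_iff, winnerAfter]
  cases turn k <;> simp [Player.other]

end BrusselsSprout

theorem corollary1 (n : ℕ) (hn : 1 ≤ n) (t : Fin n → ℕ) (ht : ∀ i, 1 ≤ t i)
    (D : BrusselsSprout.Drawing) (hD : D.IsInitial t) :
    (∃ N : ℕ, (N : ℤ) = ((n : ℤ) - 2) + ∑ i, (t i : ℤ) ∧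
      BrusselsSprout.EndsAfterExactly D N) ∧
    (∀ (k : ℕ) (D' : BrusselsSprout.Drawing),
      BrusselsSprout.IsPlay D k D' → BrusselsSprout.IsOver D' →
        (BrusselsSprout.winnerAfter k = BrusselsSprout.Player.first ↔ Odd (n + ∑ i, t i))) ∧
    (BrusselsSprout.CanForceWin D ↔ Odd (n + ∑ i, t i)) := by
  have h0 := hD.reached hn ht
  have hle := h0.le hn
  have hodd : ∀ k, k + 2 = n + ∑ i, t i → (Odd k ↔ Odd (n + ∑ i, t i)) := by
    intro k hk
    rw [← hk, Nat.odd_add]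
    simp
  -- The natural subtraction is not truncated, by `hle`.
  refine ⟨⟨n + ∑ i, t i - 2, ?_, fun k D' hk => ?_⟩, fun k D' hk hover => ?_, ?_⟩
  · rw [Nat.cast_sub (by omega)]
    push_cast
    ring
  · have hr := hk.reached h0
    have := hr.le hn
    refine ⟨by omega, ?_⟩
    rw [hr.isOver_iff hn]
    omega
  · rw [BrusselsSprout.winnerAfter_eq_first_iff]
    exact hodd k (((hk.reached h0).isOver_iff hn).1 hover)
  · rw [BrusselsSprout.Drawing.Reached.canForceWin_iff hn (n + ∑ i, t i - 2) h0 (by omega)]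
    exact hodd _ (by omega)
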